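/- Lattices are $\mathbb{Z}$-lattices $L$ of full rank on positive definite ternary quadratic spaces $(V,Q)$ over $\mathbb{Q}$ which are non-classic integral, i.e. $Q(L)\subseteq\mathbb{Z}$; $B$ is the bilinear form with $B(x,x)=Q(x)$, $dL=\det(B(x_i,x_j))$ for a basis $(x_i)$ of $L$, and $L^a$ is $L$ with its form multiplied by $a$. The genus $\mathrm{gen}(L)$ is the set of lattices $K$ on $V$ such that for every prime $p$ some isometry of $V_p$ maps $L_p$ onto $K_p$; the spinor genus $\mathrm{spn}(L)$ is the set of lattices $K$ on $V$ for which there are an isometry $\sigma$ of $V$ and, for every prime $p$, a rotation $s_p$ of $V_p$ of trivial spinor norm with $K_p=\sigma s_pL_p$. Let $\mathrm{gen}(L)_S$ be the set of spinor genera in $\mathrm{gen}(L)$ and $g(L)=|\mathrm{gen}(L)_S|$. For a positive integer $n$, $([N],[M])$ is a *representable pair by scaling $n$* if there is a representation $\phi\colon M^n\to N$ with $[N:\phi(M^n)]=n$. In that case $\mathfrak{G}(N,M)$ is the bipartite graph with parts $\mathrm{gen}(N)_S$ and $\mathrm{gen}(M)_S$ in which two spinor genera are joined by an edge if and only if they contain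 lattices $N''$ and $M''$, respectively, such that $([N''],[M''])$ is a representable pair by scaling $n$. **Theorem.** Let $n$ be a square-free positive integer, let $([N],[M])$ be a representable pair by scaling $n$, with representation $\phi$, and assume that no prime divisor of $n$ divides all values of $Q$ on $N$ (for instance, that $N$ is primitive). Let $n_2$ be the product of the primes $p\mid n$ for which the $\frac12\mathbb{Z}_p$-modular component in a Jordan decomposition of $N_p$ has rank two, let $n_1=n/n_2$, and let $n_2(e)$ be the product of the primes $q\mid n_2$ for which $\mathrm{ord}_q(4\,dN)$ is even. There is a basis $x_1,x_2,x_3$ of $N$ such that $\phi(M^n)=\mathbb{Z}x_1+\mathbb{Z}x_2+\mathbb{Z}(nx_3)$. For any such basis put $$L_{N,M}=\bigl(\mathbb{Z}x_1+\mathbb{Z}x_2+\mathbb{Z}(n_1n_2(e)x_3)\bigr)^{\frac{1}{n_1n_2(e)}},\qquad g_{N,M}=g(L_{N,M}).$$ Then $g(N)$, $g(M)$ and $g_{N,M}$ are finite and positive, $g_{N,M}$ divides both $g(M)$ and $g(N)$, and every connected component of $\mathfrak{G}(N,M)$ is a complete bipartite graph $K_{\alpha,\beta}$ with $$\alpha=\frac{g(M)}{g_{N,M}},\qquad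 \beta=\frac{g(N)}{g_{N,M}},$$ where the $\alpha$ vertices lie in $\mathrm{gen}(M)_S$ and the $\beta$ vertices in $\mathrm{gen}(N)_S$. -/

import Mathlib

open scoped TensorProduct

noncomputable section

namespace SpinorGenera

/-! ### Quadratic forms over a field of characteristic zero -/

/-- The symmetric bilinear form `B` of a quadratic form, normalised by `B(x, x) = Q(x)`. -/
def bil {K V : Type*} [Field K] [AddCommGroup V] [Module K V]
    (Q : QuadraticForm K V) (x y : V) : K :=
  QuadraticMap.polar Q x y / 2

/-- The symmetry (reflection) `τ_v : x ↦ x - (2 B(v, x) / Q(v)) v`; only used for `Q v ≠ 0`. -/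
def symmetry {K V : Type*} [Field K] [AddCommGroup V] [Module K V]
    (Q : QuadraticForm K V) (v : V) : Module.End K V :=
  LinearMap.id - (Q v)⁻¹ • (QuadraticMap.polarBilin Q v).smulRight v

/-- The kernel `O'` of the spinor norm on the rotation group: products `τ_{v₁} ⋯ τ_{v_r}` of an
even number of symmetries whose spinor norm `Q(v₁) ⋯ Q(v_r)` is a square. -/
def InSpinorKernel {K V : Type*} [Field K] [AddCommGroup V] [Module K V]
    (Q : QuadraticForm K V) (s : Module.End K V) : Prop :=
  ∃ l : List V, (∀ v ∈ l, Q v ≠ 0) ∧ Even l.length ∧ IsSquare (l.map Q).prod ∧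
    s = (l.map (symmetry Q)).prod

/-! ### Lattices on a rational quadratic space and their localizations -/

/-- The lattice `L` is non-classic integral: its norm ideal is contained in `ℤ`. -/
def IsIntegral {V : Type*} [AddCommGroup V] [Module ℚ V]
    (Q : QuadraticForm ℚ V) (L : Submodule ℤ V) : Prop :=
  ∀ x ∈ L, ∃ k : ℤ, Q x = k

/-- The norm ideal of the integral lattice `L` is prime to `n`: no prime divisor of `n`
divides all the values of `Q` on `L`. This holds for every `n` if `L` is primitive. -/
def NormPrimeTo {V : Type*} [AddCommGroup V] [Module ℚ V]
    (Q : QuadraticForm ℚ V) (L : Submodule ℤ V) (n : ℕ) : Prop :=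
  ∀ p : ℕ, p.Prime → p ∣ n → ∃ x ∈ L, ∃ k : ℤ, Q x = k ∧ ¬ (p : ℤ) ∣ k

/-- The discriminant `det (B(x_i, x_j))` of a ternary lattice, for a `ℤ`-basis `x` of it
(the value does not depend on the basis, see `disc_eq`). -/
def disc {V : Type*} [AddCommGroup V] [Module ℚ V]
    (Q : QuadraticForm ℚ V) (L : Submodule ℤ V) : ℚ :=
  open Classical in
  if h : Nonempty (Module.Basis (Fin 3) ℤ L) then
    (Matrix.of fun i j : Fin 3 => bil Q (h.some i : V) (h.some j : V)).det
  else 0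

theorem disc_eq {V : Type*} [AddCommGroup V] [Module ℚ V]
    (Q : QuadraticForm ℚ V) (L : Submodule ℤ V) (b : Module.Basis (Fin 3) ℤ L) :
    disc Q L = (Matrix.of fun i j : Fin 3 => bil Q (b i : V) (b j : V)).det := by
  have h : Nonempty (Module.Basis (Fin 3) ℤ L) := ⟨b⟩
  rw [disc, dif_pos h]
  generalize h.some = c
  set A : Matrix (Fin 3) (Fin 3) ℤ := b.toMatrix c with hA
  have key : (Matrix.of fun i j : Fin 3 => bil Q (c i : V) (c j : V)) =
      (A.map (Int.cast : ℤ → ℚ)).transpose *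
        (Matrix.of fun i j : Fin 3 => bil Q (b i : V) (b j : V)) * A.map (Int.cast : ℤ → ℚ) := by
    have hc : ∀ j, (c j : V) = ∑ i, ((A i j : ℚ)) • (b i : V) := by
      intro j
      have h1 := congrArg (Subtype.val) (b.sum_toMatrix_smul_self (⇑c) j)
      rw [← h1, AddSubmonoidClass.coe_finsetSum]
      exact Finset.sum_congr rfl fun i _ => (Int.cast_smul_eq_zsmul ℚ (A i j) (b i : V)).symm
    have hb : ∀ x y, bil Q x y = (QuadraticMap.polarBilin Q x y) / 2 := fun _ _ => rfl
    ext i j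
    simp only [Matrix.of_apply, Matrix.mul_apply, Matrix.transpose_apply, Matrix.map_apply, hb, hc,
      Fin.sum_univ_three]
    simp only [map_add, map_smul, LinearMap.add_apply, LinearMap.smul_apply, smul_eq_mul]
    ring
  have hdet : ((A.map (Int.cast : ℤ → ℚ)).det) * ((A.map (Int.cast : ℤ → ℚ)).det) = 1 := by
    have h2 : IsUnit A.det := by
      rw [← Matrix.isUnit_iff_isUnit_det]
      have : A * c.toMatrix b = 1 := b.toMatrix_mul_toMatrix_flip c
      exact IsUnit.of_mul_eq_one _ this
    have h3 : (A.map (Int.cast : ℤ → ℚ)).det = ((A.det : ℤ) : ℚ) :=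
      (Int.cast_det A).symm
    rw [h3]
    rcases Int.isUnit_iff.1 h2 with h4 | h4 <;> simp [h4]
  rw [key, Matrix.det_mul, Matrix.det_mul, Matrix.det_transpose]
  linear_combination
    (Matrix.of fun i j : Fin 3 => bil Q (b i : V) (b j : V)).det * hdet

/-- The quadratic form of the localization `V_p = ℚ_p ⊗ V`. -/
abbrev localForm {V : Type*} [AddCommGroup V] [Module ℚ V]
    (p : ℕ) [Fact p.Prime] (Q : QuadraticForm ℚ V) :
    QuadraticForm ℚ_[p] (ℚ_[p] ⊗[ℚ] V) :=
  Q.baseChange ℚ_[p]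

/-- The localization `L_p`, the `ℤ_p`-lattice generated by `L` in `V_p`. -/
def localization {V : Type*} [AddCommGroup V] [Module ℚ V]
    (p : ℕ) [Fact p.Prime] (L : Submodule ℤ V) : Submodule ℤ_[p] (ℚ_[p] ⊗[ℚ] V) :=
  Submodule.span ℤ_[p] ((fun x : V => (1 : ℚ_[p]) ⊗ₜ[ℚ] x) '' (L : Set V))

/-! ### Genera and spinor genera -/

/-- `gen(L)`: the lattices `K` on `V` such that, for every prime `p`, there is an isometry of
`V_p` that maps `L_p` onto `K_p`. -/
def genus {V : Type*} [AddCommGroup V] [Module ℚ V]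
    (Q : QuadraticForm ℚ V) (L : Submodule ℤ V) : Set (Submodule ℤ V) :=
  {K | K.IsLattice ℚ ∧ ∀ (p : ℕ) [Fact p.Prime],
    ∃ τ : (localForm p Q).IsometryEquiv (localForm p Q),
      localization p K =
        (localization p L).map (τ.toLinearEquiv.toLinearMap.restrictScalars ℤ_[p])}

/-- `spn(L)`: the lattices `K` on `V` for which there are an isometry `σ` of `V` and elements
`s_p` of the spinor kernels `O'(V_p)` with `K_p = σ s_p L_p` for all primes `p`. In dimension
three, `σ` may be replaced by `-σ`, so spinor genera and proper spinor genera coincide. -/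
def spinorGenus {V : Type*} [AddCommGroup V] [Module ℚ V]
    (Q : QuadraticForm ℚ V) (L : Submodule ℤ V) : Set (Submodule ℤ V) :=
  {K | K.IsLattice ℚ ∧ ∃ σ : Q.IsometryEquiv Q, ∀ (p : ℕ) [Fact p.Prime],
    ∃ s : Module.End ℚ_[p] (ℚ_[p] ⊗[ℚ] V), InSpinorKernel (localForm p Q) s ∧
      localization p K =
        ((localization p L).map (s.restrictScalars ℤ_[p])).map
          ((σ.toLinearEquiv.toLinearMap.baseChange ℚ_[p]).restrictScalars ℤ_[p])}

/-- `gen(L)_S`: the set of all spinor genera in `gen(L)`. -/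
def spinorGenera {V : Type*} [AddCommGroup V] [Module ℚ V]
    (Q : QuadraticForm ℚ V) (L : Submodule ℤ V) : Set (Set (Submodule ℤ V)) :=
  {S | ∃ K ∈ genus Q L, S = spinorGenus Q K}

/-- `g(L)`: the number of spinor genera in `gen(L)`. -/
def numSpinorGenera {V : Type*} [AddCommGroup V] [Module ℚ V]
    (Q : QuadraticForm ℚ V) (L : Submodule ℤ V) : ℕ :=
  (spinorGenera Q L).ncard

/-! ### Representable pairs and the bipartite graph of spinor genera -/

/-- `φ` is a representation `Mⁿ → N` with `[N : φ(Mⁿ)] = n`, where `Mⁿ` is `M` with its form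
multiplied by `n`. -/
def IsScaledRep {V W : Type*} [AddCommGroup V] [Module ℚ V] [AddCommGroup W] [Module ℚ W]
    (n : ℕ) (QN : QuadraticForm ℚ V) (QM : QuadraticForm ℚ W)
    (N : Submodule ℤ V) (M : Submodule ℤ W) (φ : W →ₗ[ℚ] V) : Prop :=
  (∀ x, QN (φ x) = n * QM x) ∧
    M.map (φ.restrictScalars ℤ) ≤ N ∧
    (M.map (φ.restrictScalars ℤ)).toAddSubgroup.relIndex N.toAddSubgroup = n

/-- `([N], [M])` is a representable pair by scaling `n`. -/
def IsRepresentablePair {V W : Type*} [AddCommGroup V] [Module ℚ V]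
    [AddCommGroup W] [Module ℚ W]
    (n : ℕ) (QN : QuadraticForm ℚ V) (QM : QuadraticForm ℚ W)
    (N : Submodule ℤ V) (M : Submodule ℤ W) : Prop :=
  ∃ φ : W →ₗ[ℚ] V, IsScaledRep n QN QM N M φ

/-- The bipartite graph `𝔊(N, M)` on `gen(N)_S ⊔ gen(M)_S`: two spinor genera are joined if they
contain lattices that form a representable pair by scaling `n`. -/
def spinorGraph {V W : Type*} [AddCommGroup V] [Module ℚ V] [AddCommGroup W] [Module ℚ W]
    (n : ℕ) (QN : QuadraticForm ℚ V) (QM : QuadraticForm ℚ W)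
    (N : Submodule ℤ V) (M : Submodule ℤ W) :
    SimpleGraph (spinorGenera QN N ⊕ spinorGenera QM M) where
  Adj u v := match u, v with
    | .inl S, .inr T => ∃ N' ∈ S.1, ∃ M' ∈ T.1, IsRepresentablePair n QN QM N' M'
    | .inr T, .inl S => ∃ N' ∈ S.1, ∃ M' ∈ T.1, IsRepresentablePair n QN QM N' M'
    | _, _ => False
  symm := ⟨by rintro (S | T) (S' | T') h <;> exact h⟩
  loopless := ⟨by rintro (S | T) h <;> exact h⟩

/-! ### Jordan decompositions -/

/-- The `ℤ_p`-lattice `J` is `aℤ_p`-modular: `J = {x ∈ ℚ_p J : B(x, J) ⊆ aℤ_p}`. -/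
def IsModular {p : ℕ} [Fact p.Prime] {V : Type*} [AddCommGroup V] [Module ℚ_[p] V]
    [Module ℤ_[p] V] (Q : QuadraticForm ℚ_[p] V) (a : ℚ_[p]) (J : Submodule ℤ_[p] V) : Prop :=
  ∀ x ∈ Submodule.span ℚ_[p] (J : Set V), x ∈ J ↔ ∀ y ∈ J, ‖bil Q x y‖ ≤ ‖a‖

/-- `L` is the orthogonal sum of the `J i`, `i ∈ ℤ`, where `J i` is `(pⁱ/2)ℤ_p`-modular
(and zero for all but finitely many `i`, as `L` has finite rank). -/
def IsJordanDecomposition {p : ℕ} [Fact p.Prime] {V : Type*} [AddCommGroup V] [Module ℚ_[p] V]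
    [Module ℤ_[p] V] (Q : QuadraticForm ℚ_[p] V) (L : Submodule ℤ_[p] V)
    (J : ℤ → Submodule ℤ_[p] V) : Prop :=
  (∀ i, IsModular Q ((p : ℚ_[p]) ^ i / 2) (J i)) ∧
    (∀ i j, i ≠ j → ∀ x ∈ J i, ∀ y ∈ J j, bil Q x y = 0) ∧
    iSupIndep J ∧ ⨆ i, J i = L

/-- `p` is a prime and the `(1/2)ℤ_p`-modular component in a Jordan decomposition of `N_p` has
rank two. -/
def HalfModularRankTwo {V : Type*} [AddCommGroup V] [Module ℚ V]
    (Q : QuadraticForm ℚ V) (N : Submodule ℤ V) (p : ℕ) : Prop :=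
  ∃ _ : Fact p.Prime, ∃ J : ℤ → Submodule ℤ_[p] (ℚ_[p] ⊗[ℚ] V),
    IsJordanDecomposition (localForm p Q) (localization p N) J ∧
      Module.finrank ℤ_[p] (J 0) = 2

/-! ### The intermediate lattice -/

/-- `n₂`: the product of the primes `p ∣ n` such that the `(1/2)ℤ_p`-modular component of `N_p`
has rank two. -/
def n₂ {V : Type*} [AddCommGroup V] [Module ℚ V]
    (n : ℕ) (Q : QuadraticForm ℚ V) (N : Submodule ℤ V) : ℕ :=
  open Classical in ∏ p ∈ n.primeFactors with HalfModularRankTwo Q N p, p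

/-- `n₁ = n / n₂`. -/
def n₁ {V : Type*} [AddCommGroup V] [Module ℚ V]
    (n : ℕ) (Q : QuadraticForm ℚ V) (N : Submodule ℤ V) : ℕ :=
  n / n₂ n Q N

/-- `n₂(e)`: the product of the primes `q ∣ n₂` such that `ord_q (4 dN)` is even. -/
def n₂e {V : Type*} [AddCommGroup V] [Module ℚ V]
    (n : ℕ) (Q : QuadraticForm ℚ V) (N : Submodule ℤ V) : ℕ :=
  ∏ q ∈ (n₂ n Q N).primeFactors with Even (padicValRat q (4 * disc Q N)), q

/-- `ℤ x₁ + ℤ x₂ + ℤ (k x₃)` for a basis `x₁, x₂, x₃` of the lattice `N`. -/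
def sublattice {V : Type*} [AddCommGroup V] [Module ℚ V] {N : Submodule ℤ V}
    (x : Module.Basis (Fin 3) ℤ N) (k : ℕ) : Submodule ℤ V :=
  Submodule.span ℤ {(x 0 : V), (x 1 : V), k • (x 2 : V)}

/-- `g_{N,M}`: the number of spinor genera in the genus of
`L_{N,M} = (ℤ x₁ + ℤ x₂ + ℤ (n₁ n₂(e) x₃))^{1 / (n₁ n₂(e))}`. -/
def gInter {V : Type*} [AddCommGroup V] [Module ℚ V]
    (n : ℕ) (Q : QuadraticForm ℚ V) {N : Submodule ℤ V} (x : Module.Basis (Fin 3) ℤ N) : ℕ :=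
  numSpinorGenera ((1 / ((n₁ n Q N * n₂e n Q N : ℕ) : ℚ)) • Q)
    (sublattice x (n₁ n Q N * n₂e n Q N))

end SpinorGenera

end

/-!
# The graph of spinor genera of a representable pair

Let `G` be the adelic orthogonal group of `(V, Q)`. It acts on the lattices on `V`, and `gen(L)` is
the orbit of `L`. Two lattices of the orbit lie in one spinor genus if they differ by a rational
isometry and an element of the kernel `O'_A` of the local spinor norms. The local isometries are
products of symmetries, so commutators lie in `O'_A`, and all subgroups of `G` containing `O'_A` are
normal. Therefore the spinor genera in `gen(L)` are the cosets of `H_L = O(V) O'_A Stab(L)`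
(`spinorGeneraEquiv`), and `g(L)` is the index of `H_L` in `G`. The index is finite, because by
reduction theory a genus contains finitely many classes (`finite_spinorGenera`).

The representation `φ` is a similitude that identifies `gen(M)_S` with the set of spinor genera in
the genus of `φ(M)`, so `M` may be taken to be a sublattice of `N` of index `n` on which `Q` is
divisible by `n`. At a prime `p` dividing `n`, the reduction of `Q` modulo `p` vanishes on the plane
`M / pN` of `N / pN`, and there are two cases (`sublattice_dichotomy`). In the first, `M_p` consists
of all vectors of `N_p` whose values are divisible by `p`. In the second, a hyperbolic plane
`ℤ_p e + ℤ_p f` splits off `N_p`, and `M_p` is one of two sublattices, which are interchanged by the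
symmetry of `e - f`. In both cases all such sublattices of `N_p` are conjugate under the isometries
of `N_p` (`exists_isometry_sublattice`). It follows that the spinor genera of `τN` and `υM` are
joined by an edge if and only if the cosets `τ H_N` and `υ H_M` meet (`exists_pair_iff`), that is,
if `τ` and `υ` have the same image in `G / H_N H_M`. So the graph is the one of the equation
`f(S) = g(T)` for two surjections `f`, `g` onto `G / H_N H_M`, and its components are complete
bipartite graphs on the fibres of `f` and `g` (`exists_iso_completeBipartiteGraph`), whose sizes are
the indices `[H_N H_M : H_N]` and `[H_N H_M : H_M]`.

It remains to see that `H_L = H_N H_M` for `L = L_{N,M}` (`spinorStabilizer_intermediate`). At every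
prime, `L` is `N` or `M`, so `H_L ⊆ H_N H_M`. For the converse, it suffices that the isometries of
`N_p` and of `M_p` stabilize `L_p` up to the spinor kernel. In the first case of the dichotomy,
which is that of the primes dividing `n₁`, `L_p = M_p` is preserved by the isometries of both
lattices. In the second, `N_p` and `M_p` are spanned by `e, f, g` and by `e, p f, g`, and the parity
of `ord_p (4 dN)` decides for which of the two `B(e, f)` and `Q(g)` have orders of different parity;
this lattice is `L_p`. Its symmetries take all spinor norms (`exists_stabilizer_mul_spinorKernel`),
so up to the spinor kernel every isometry of `V_p` stabilizes it.
-/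

noncomputable section

namespace SpinorGenera

/-! ### Symmetries, isometries and the spinor kernel -/

section Field

variable {K V : Type*} [Field K] [AddCommGroup V] [Module K V] (Q : QuadraticForm K V)

theorem symmetry_apply (v x : V) :
    symmetry Q v x = x - ((Q v)⁻¹ * QuadraticMap.polar Q v x) • v := by
  simp [symmetry, smul_smul]

theorem map_sub_smul (x v : V) (c : K) :
    Q (x - c • v) = Q x + c * c * Q v - c * QuadraticMap.polar Q v x := by
  have h := QuadraticMap.map_add Q x (-(c • v))
  rw [← sub_eq_add_neg, QuadraticMap.map_neg, QuadraticMap.map_smul, QuadraticMap.polar_neg_right,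
    QuadraticMap.polar_smul_right, QuadraticMap.polar_comm] at h
  rw [h]
  simp only [smul_eq_mul]
  ring

theorem polar_self_eq (v : V) : QuadraticMap.polar Q v v = 2 * Q v := by
  rw [QuadraticMap.polar_self, two_smul, two_mul]

theorem map_symmetry {v : V} (hv : Q v ≠ 0) (x : V) : Q (symmetry Q v x) = Q x := by
  rw [symmetry_apply, map_sub_smul]
  field_simp
  ring

theorem symmetry_self {v : V} (hv : Q v ≠ 0) : symmetry Q v v = -v := by
  rw [symmetry_apply, polar_self_eq, mul_left_comm, inv_mul_cancel₀ hv, mul_one, two_smul]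
  abel

theorem symmetry_mul_self {v : V} (hv : Q v ≠ 0) : symmetry Q v * symmetry Q v = 1 := by
  ext x
  rw [Module.End.mul_apply, symmetry_apply Q v x, map_sub, map_smul, symmetry_self Q hv,
    symmetry_apply]
  simp

theorem symmetry_of_polar_eq_zero {v x : V} (h : QuadraticMap.polar Q v x = 0) :
    symmetry Q v x = x := by
  simp [symmetry_apply, h]

/-- The orthogonal group of `Q`, inside the group of linear automorphisms. -/
def orthogonalGroup : Subgroup (V ≃ₗ[K] V) where
  carrier := {f | ∀ x, Q (f x) = Q x}
  mul_mem' {f g} hf hg x := by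
    rw [LinearEquiv.mul_apply, hf, hg]
  one_mem' _ := rfl
  inv_mem' {f} hf x := by
    rw [← hf]
    exact congrArg Q (f.apply_symm_apply x)

theorem mem_orthogonalGroup {f : V ≃ₗ[K] V} : f ∈ orthogonalGroup Q ↔ ∀ x, Q (f x) = Q x :=
  Iff.rfl

theorem toIsometryEquiv_mem (τ : Q.IsometryEquiv Q) : τ.toLinearEquiv ∈ orthogonalGroup Q :=
  fun x => τ.map_app x

theorem polar_map_of_mem {f : V ≃ₗ[K] V} (hf : f ∈ orthogonalGroup Q) (x y : V) :
    QuadraticMap.polar Q (f x) (f y) = QuadraticMap.polar Q x y := by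
  simp only [QuadraticMap.polar, ← map_add, mem_orthogonalGroup Q |>.1 hf]

/-- The symmetry `τ_v` of an anisotropic vector `v` as a linear automorphism. -/
def symmetryEquiv {v : V} (hv : Q v ≠ 0) : V ≃ₗ[K] V :=
  LinearEquiv.ofLinearMap (symmetry Q v) (symmetry Q v) (symmetry_mul_self Q hv)
    (symmetry_mul_self Q hv)

theorem symmetryEquiv_mem {v : V} (hv : Q v ≠ 0) : symmetryEquiv Q hv ∈ orthogonalGroup Q :=
  fun x => map_symmetry Q hv x

/-- `f` is the product of the symmetries of the anisotropic vectors in the list `l`. -/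
def IsSymmetryProd (f : Module.End K V) (l : List V) : Prop :=
  (∀ v ∈ l, Q v ≠ 0) ∧ f = (l.map (symmetry Q)).prod

variable {Q}

theorem IsSymmetryProd.mul {f g : Module.End K V} {l m : List V} (hf : IsSymmetryProd Q f l)
    (hg : IsSymmetryProd Q g m) : IsSymmetryProd Q (f * g) (l ++ m) := by
  refine ⟨fun v hv => ?_, by rw [hf.2, hg.2, List.map_append, List.prod_append]⟩
  rcases List.mem_append.1 hv with h | h
  exacts [hf.1 v h, hg.1 v h]

theorem isSymmetryProd_nil : IsSymmetryProd Q 1 [] := ⟨by simp, by simp⟩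

theorem isSymmetryProd_symmetry {v : V} (hv : Q v ≠ 0) : IsSymmetryProd Q (symmetry Q v) [v] :=
  ⟨by simpa, by simp⟩

theorem prod_symmetry_mul_reverse {l : List V} (hl : ∀ v ∈ l, Q v ≠ 0) :
    (l.map (symmetry Q)).prod * (l.reverse.map (symmetry Q)).prod = 1 := by
  induction l with
  | nil => simp
  | cons v l ih =>
    have h1 := ih fun w hw => hl w (List.mem_cons_of_mem _ hw)
    rw [List.reverse_cons, List.map_append, List.prod_append, List.map_cons, List.prod_cons,
      mul_assoc, ← mul_assoc _ _ (List.map _ [v]).prod, h1, one_mul]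
    simpa using symmetry_mul_self Q (hl v List.mem_cons_self)

theorem IsSymmetryProd.inv {f : V ≃ₗ[K] V} {l : List V}
    (hf : IsSymmetryProd Q (f : V →ₗ[K] V) l) :
    IsSymmetryProd Q ((f⁻¹ : V ≃ₗ[K] V) : V →ₗ[K] V) l.reverse := by
  refine ⟨fun v hv => hf.1 v (List.mem_reverse.1 hv), ?_⟩
  have h1 : (f : Module.End K V) * (l.reverse.map (symmetry Q)).prod = 1 := by
    rw [hf.2]
    exact prod_symmetry_mul_reverse hf.1
  ext x
  have h2 := LinearMap.congr_fun h1 x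
  exact f.symm_apply_eq.2 h2.symm

theorem inSpinorKernel_iff {s : Module.End K V} : InSpinorKernel Q s ↔
    ∃ l, IsSymmetryProd Q s l ∧ Even l.length ∧ IsSquare (l.map Q).prod :=
  ⟨fun ⟨l, h1, h2, h3, h4⟩ => ⟨l, ⟨h1, h4⟩, h2, h3⟩,
    fun ⟨l, h1, h2, h3⟩ => ⟨l, h1.1, h2, h3, h1.2⟩⟩

variable (Q)

/-- The kernel `O'` of the spinor norm as a subgroup of the group of linear automorphisms. -/
def spinorKernel : Subgroup (V ≃ₗ[K] V) where
  carrier := {f | InSpinorKernel Q (f : V →ₗ[K] V)}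
  mul_mem' {f g} hf hg := by
    obtain ⟨l, h1, h2, h3⟩ := inSpinorKernel_iff.1 hf
    obtain ⟨m, k1, k2, k3⟩ := inSpinorKernel_iff.1 hg
    refine inSpinorKernel_iff.2 ⟨l ++ m, h1.mul k1, ?_, ?_⟩
    · rw [List.length_append]
      exact h2.add k2
    · rw [List.map_append, List.prod_append]
      exact h3.mul k3
  one_mem' := inSpinorKernel_iff.2 ⟨[], isSymmetryProd_nil, by simp, by simp⟩
  inv_mem' {f} hf := by
    obtain ⟨l, h1, h2, h3⟩ := inSpinorKernel_iff.1 hf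
    refine inSpinorKernel_iff.2 ⟨l.reverse, h1.inv, by simpa, ?_⟩
    rwa [List.map_reverse, List.prod_reverse]

theorem map_prod_symmetry {l : List V} (hl : ∀ v ∈ l, Q v ≠ 0) (x : V) :
    Q ((l.map (symmetry Q)).prod x) = Q x := by
  induction l with
  | nil => simp
  | cons v l ih =>
    rw [List.map_cons, List.prod_cons, Module.End.mul_apply,
      map_symmetry Q (hl v List.mem_cons_self), ih fun w hw => hl w (List.mem_cons_of_mem _ hw)]

theorem spinorKernel_le : spinorKernel Q ≤ orthogonalGroup Q := by
  rintro f ⟨l, h1, -, -, h4⟩ x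
  have := map_prod_symmetry Q h1 x
  rw [← h4] at this
  exact this

/-- Every element of the kernel of the spinor norm, given as an endomorphism, is invertible. -/
theorem InSpinorKernel.exists_equiv {s : Module.End K V} (hs : InSpinorKernel Q s) :
    ∃ f ∈ spinorKernel Q, (f : V →ₗ[K] V) = s := by
  obtain ⟨l, h1, h2, h3, h4⟩ := hs
  have h5 : ∀ v ∈ l.reverse, Q v ≠ 0 := fun v hv => h1 v (List.mem_reverse.1 hv)
  have h6 := prod_symmetry_mul_reverse h5
  rw [List.reverse_reverse] at h6
  exact ⟨LinearEquiv.ofLinearMap (l.map (symmetry Q)).prod (l.reverse.map (symmetry Q)).prod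
    (prod_symmetry_mul_reverse h1) h6, ⟨l, h1, h2, h3, rfl⟩, h4.symm⟩

/-- Symmetries have order two, so a commutator `f g f⁻¹ g⁻¹` of products of symmetries is a product
over a list in which every vector of `f` and of `g` occurs twice; its spinor norm is a square. -/
theorem commutator_mem_spinorKernel {f g : V ≃ₗ[K] V} {l m : List V}
    (hf : IsSymmetryProd Q (f : V →ₗ[K] V) l) (hg : IsSymmetryProd Q (g : V →ₗ[K] V) m) :
    f * g * f⁻¹ * g⁻¹ ∈ spinorKernel Q := by
  refine inSpinorKernel_iff.2
    ⟨l ++ m ++ l.reverse ++ m.reverse, ((hf.mul hg).mul hf.inv).mul hg.inv, ?_, ?_⟩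
  · simp only [List.length_append, List.length_reverse]
    exact ⟨l.length + m.length, by ring⟩
  · simp only [List.map_append, List.prod_append, List.map_reverse, List.prod_reverse]
    exact ⟨(l.map Q).prod * (m.map Q).prod, by ring⟩

/-- A weak form of the Cartan–Dieudonné theorem: in a space with an orthogonal basis of
anisotropic vectors, every isometry is a product of symmetries. The images of the basis vectors
are moved back one after the other, each with one or two symmetries. -/
theorem exists_isSymmetryProd (h2 : (2 : K) ≠ 0) {n : ℕ} (b : Module.Basis (Fin n) K V)
    (hb : ∀ i, Q (b i) ≠ 0) (hbo : ∀ i j, i ≠ j → QuadraticMap.polar Q (b i) (b j) = 0)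
    {f : V ≃ₗ[K] V} (hf : f ∈ orthogonalGroup Q) :
    ∃ l, IsSymmetryProd Q (f : V →ₗ[K] V) l := by
  -- products of symmetries bring `f` to fix the first `k` basis vectors
  have key : ∀ k : ℕ, k ≤ n → ∃ (g : V ≃ₗ[K] V) (l : List V), IsSymmetryProd Q (g : V →ₗ[K] V) l ∧
      g * f ∈ orthogonalGroup Q ∧ ∀ i : Fin n, (i : ℕ) < k → (g * f) (b i) = b i := by
    intro k
    induction k with
    | zero => exact fun _ => ⟨1, [], isSymmetryProd_nil, by simpa, by simp⟩
    | succ k ih =>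
      intro hk
      obtain ⟨g, l, h1, h3, h4⟩ := ih (by omega)
      set i₀ : Fin n := ⟨k, hk⟩ with hi₀
      set w := (g * f) (b i₀) with hw
      have hQw : Q w = Q (b i₀) := h3 _
      have hperp : ∀ i : Fin n, (i : ℕ) < k → QuadraticMap.polar Q w (b i) = 0 := by
        intro i hi
        have h5 := polar_map_of_mem Q h3 (b i₀) (b i)
        rw [h4 i hi] at h5
        rw [hw, h5]
        exact hbo _ _ fun h => by simp [← h, hi₀] at hi
      have hperp' : ∀ i : Fin n, (i : ℕ) < k → QuadraticMap.polar Q (b i₀) (b i) = 0 :=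
        fun i hi => hbo _ _ fun h => by simp [← h, hi₀] at hi
      have hlt : ∀ i : Fin n, (i : ℕ) < k + 1 → (i : ℕ) < k ∨ i = i₀ := by
        intro i hi
        rcases Nat.lt_succ_iff_lt_or_eq.1 hi with h | h
        exacts [Or.inl h, Or.inr (Fin.ext h)]
      have hsub : Q (w - b i₀) = 2 * Q (b i₀) - QuadraticMap.polar Q w (b i₀) := by
        have := map_sub_smul Q w (b i₀) 1
        rw [one_smul] at this
        rw [this, hQw, QuadraticMap.polar_comm]
        ring
      have hadd : Q (w + b i₀) = 2 * Q (b i₀) + QuadraticMap.polar Q w (b i₀) := by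
        rw [QuadraticMap.map_add Q, hQw]
        ring
      -- one of `w ± b i₀` is anisotropic, because `Q (w - b i₀) + Q (w + b i₀) = 4 Q (b i₀)`
      by_cases hd : Q (w - b i₀) = 0
      · have hs : Q (w + b i₀) ≠ 0 := by
          have h4' : Q (w - b i₀) + Q (w + b i₀) = 2 * 2 * Q (b i₀) := by
            rw [hsub, hadd]
            ring
          intro h0
          rw [hd, h0, add_zero] at h4'
          exact mul_ne_zero (mul_ne_zero h2 h2) (hb i₀) h4'.symm
        refine ⟨symmetryEquiv Q (hb i₀) * (symmetryEquiv Q hs * g), _,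
          (isSymmetryProd_symmetry (hb i₀)).mul ((isSymmetryProd_symmetry hs).mul h1), ?_, ?_⟩
        · rw [mul_assoc, mul_assoc]
          exact mul_mem (symmetryEquiv_mem _ _) (mul_mem (symmetryEquiv_mem _ _) h3)
        · intro i hi
          change symmetry Q (b i₀) (symmetry Q (w + b i₀) ((g * f) (b i))) = b i
          rcases hlt i hi with h | rfl
          · rw [h4 i h, symmetry_of_polar_eq_zero Q (v := w + b i₀),
              symmetry_of_polar_eq_zero Q (hperp' i h)]
            rw [QuadraticMap.polar_add_left, hperp i h, hperp' i h, add_zero]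
          · rw [← hw]
            have h6 : symmetry Q (w + b i₀) w = - b i₀ := by
              rw [symmetry_apply]
              have : (Q (w + b i₀))⁻¹ * QuadraticMap.polar Q (w + b i₀) w = 1 := by
                rw [QuadraticMap.polar_add_left, polar_self_eq, hQw,
                  QuadraticMap.polar_comm Q (b i₀), ← hadd, inv_mul_cancel₀ hs]
              rw [this, one_smul]
              abel
            rw [h6, map_neg, symmetry_self Q (hb i₀), neg_neg]
      · refine ⟨symmetryEquiv Q hd * g, _, (isSymmetryProd_symmetry hd).mul h1, ?_, ?_⟩
        · rw [mul_assoc]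
          exact mul_mem (symmetryEquiv_mem _ _) h3
        · intro i hi
          change symmetry Q (w - b i₀) ((g * f) (b i)) = b i
          rcases hlt i hi with h | rfl
          · rw [h4 i h, symmetry_of_polar_eq_zero Q (v := w - b i₀)]
            rw [QuadraticMap.polar_sub_left, hperp i h, hperp' i h, sub_zero]
          · rw [← hw, symmetry_apply]
            have : (Q (w - b i₀))⁻¹ * QuadraticMap.polar Q (w - b i₀) w = 1 := by
              rw [QuadraticMap.polar_sub_left, polar_self_eq, hQw,
                QuadraticMap.polar_comm Q (b i₀), ← hsub, inv_mul_cancel₀ hd]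
            rw [this, one_smul]
            abel
  obtain ⟨g, l, h1, -, h4⟩ := key n le_rfl
  have h5 : g * f = 1 := by
    apply LinearEquiv.toLinearMap_injective
    exact b.ext fun i => h4 i i.2
  rw [← inv_eq_of_mul_eq_one_right h5]
  exact ⟨_, h1.inv⟩

end Field

/-! ### Transport along similitudes -/

section Similitude

variable {K V W : Type*} [Field K] [AddCommGroup V] [Module K V] [AddCommGroup W] [Module K W]
  {QV : QuadraticForm K V} {QW : QuadraticForm K W} {c : K} (ψ : W ≃ₗ[K] V)

theorem polar_similitude (hψ : ∀ x, QV (ψ x) = c * QW x) (x y : W) :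
    QuadraticMap.polar QV (ψ x) (ψ y) = c * QuadraticMap.polar QW x y := by
  simp only [QuadraticMap.polar, ← map_add, hψ]
  ring

theorem conj_mem_orthogonalGroup (hψ : ∀ x, QV (ψ x) = c * QW x) {f : W ≃ₗ[K] W}
    (hf : f ∈ orthogonalGroup QW) : (ψ.symm.trans f).trans ψ ∈ orthogonalGroup QV := by
  intro x
  have h := hψ (f (ψ.symm x))
  rw [hf, ← hψ, LinearEquiv.apply_symm_apply] at h
  exact h

theorem symmetry_similitude (hψ : ∀ x, QV (ψ x) = c * QW x) (hc : c ≠ 0) (v x : W) :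
    symmetry QV (ψ v) (ψ x) = ψ (symmetry QW v x) := by
  rw [symmetry_apply, symmetry_apply, map_sub, map_smul, polar_similitude ψ hψ, hψ]
  congr 2
  rw [mul_inv]
  field_simp

theorem InSpinorKernel.conj (hψ : ∀ x, QV (ψ x) = c * QW x) (hc : c ≠ 0) {s : Module.End K W}
    (hs : InSpinorKernel QW s) :
    InSpinorKernel QV ((ψ : W →ₗ[K] V) ∘ₗ s ∘ₗ (ψ.symm : V →ₗ[K] W)) := by
  obtain ⟨l, h1, h2, h3, h4⟩ := hs
  refine ⟨l.map ψ, ?_, by simpa, ?_, ?_⟩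
  · intro v hv
    obtain ⟨w, hw, rfl⟩ := List.mem_map.1 hv
    rw [hψ]
    exact mul_ne_zero hc (h1 w hw)
  · have h5 : ((l.map ψ).map QV).prod = c ^ l.length * (l.map QW).prod := by
      clear h1 h2 h3 h4
      induction l with
      | nil => simp
      | cons v l ih =>
        simp only [List.map_cons, List.prod_cons, List.length_cons, ih, hψ]
        ring
    rw [h5]
    exact (h2.isSquare_pow c).mul h3
  · rw [h4]
    clear h1 h2 h3 h4
    ext x
    induction l generalizing x with
    | nil => simp
    | cons v l ih =>
      simp only [List.map_cons, List.prod_cons, Module.End.mul_apply, LinearMap.comp_apply,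
        LinearEquiv.coe_coe] at ih ⊢
      rw [← ih, symmetry_similitude ψ hψ hc]

end Similitude

/-! ### Localizations of lattices -/

/-- The prime numbers, as an index set for the localizations. -/
abbrev PrimeIndex : Type := {p : ℕ // p.Prime}

instance (p : PrimeIndex) : Fact (p : ℕ).Prime := ⟨p.2⟩

theorem rat_isInt_of_forall_norm_le_one {q : ℚ}
    (h : ∀ p : PrimeIndex, ‖(q : ℚ_[p])‖ ≤ 1) : ∃ k : ℤ, q = k := by
  refine ⟨q.num, (Rat.coe_int_num_of_den_eq_one ?_).symm⟩
  by_contra hd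
  obtain ⟨p, hp, hpd⟩ := Nat.exists_prime_and_dvd hd
  have : Fact p.Prime := ⟨hp⟩
  have := PadicInt.isUnit_den (p := p) q (h ⟨p, hp⟩)
  rw [PadicInt.isUnit_iff, PadicInt.norm_natCast_eq_one_iff] at this
  exact hp.one_lt.ne' (Nat.dvd_one.1 (this ▸ Nat.dvd_gcd dvd_rfl hpd))

/-- A `p`-adic number is congruent modulo `ℤ_p` to an element of `ℤ[1/p]`. -/
theorem exists_rat_approx (p : ℕ) [Fact p.Prime] (a : ℚ_[p]) :
    ∃ c : ℚ, ‖(c : ℚ_[p]) - a‖ ≤ 1 ∧ ∀ q : PrimeIndex, (q : ℕ) ≠ p → ‖(c : ℚ_[q])‖ ≤ 1 := by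
  have hp : p.Prime := Fact.out
  obtain ⟨j, hj⟩ : ∃ j : ℕ, ‖(p : ℚ_[p]) ^ j * a‖ ≤ 1 := by
    obtain ⟨j, hj⟩ := pow_unbounded_of_one_lt ‖a‖ (y := (p : ℝ)) (by exact_mod_cast hp.one_lt)
    refine ⟨j, ?_⟩
    have hp0 : (0 : ℝ) < (p : ℝ) ^ j := by have := hp.pos; positivity
    rw [norm_mul, Padic.norm_p_pow, zpow_neg, zpow_natCast, inv_mul_le_iff₀ hp0, mul_one]
    exact hj.le
  set y : ℤ_[p] := ⟨_, hj⟩ with hy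
  have happ := PadicInt.appr_spec j y
  rw [← PadicInt.norm_le_pow_iff_mem_span_pow] at happ
  have hp0 : (p : ℚ_[p]) ^ j ≠ 0 := pow_ne_zero _ (by exact_mod_cast hp.ne_zero)
  refine ⟨(y.appr j : ℚ) / (p : ℚ) ^ j, ?_, fun q hq => ?_⟩
  · have h1 : ((((y.appr j : ℚ) / (p : ℚ) ^ j : ℚ) : ℚ_[p]) - a) * (p : ℚ_[p]) ^ j =
        -((y - (y.appr j : ℤ_[p]) : ℤ_[p]) : ℚ_[p]) := by
      rw [PadicInt.coe_sub, hy]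
      push_cast
      field_simp
      ring
    have h2 := congrArg norm h1
    rw [norm_mul, norm_neg, Padic.norm_p_pow] at h2
    rw [PadicInt.norm_def, ← h2] at happ
    have h3 : (0 : ℝ) < (p : ℝ) ^ (-(j : ℤ)) := by have := hp.pos; positivity
    exact (mul_le_iff_le_one_left h3).1 happ
  · have h3 : ‖(p : ℚ_[q])‖ = 1 := by
      have : ‖((p : ℕ) : ℤ_[q])‖ = 1 := by
        rw [PadicInt.norm_natCast_eq_one_iff]
        exact (Nat.coprime_primes q.2 hp).2 hq
      rwa [PadicInt.norm_def] at this
    push_cast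
    rw [norm_div, norm_pow, h3, one_pow, div_one]
    exact_mod_cast Padic.norm_int_le_one (p := q) (y.appr j : ℤ)

section LocalAction

variable {p : ℕ} [Fact p.Prime] {E : Type*} [AddCommGroup E] [Module ℚ_[p] E]
  [Module ℤ_[p] E] [IsScalarTower ℤ_[p] ℚ_[p] E]

/-- The image of a `ℤ_p`-submodule under a `ℚ_p`-linear automorphism. -/
def act (f : E ≃ₗ[ℚ_[p]] E) (Λ : Submodule ℤ_[p] E) :
    Submodule ℤ_[p] E :=
  Λ.map (f.toLinearMap.restrictScalars ℤ_[p])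

variable {f g : E ≃ₗ[ℚ_[p]] E}
  {Λ Λ' : Submodule ℤ_[p] E}

theorem mem_act {y : E} : y ∈ act f Λ ↔ f⁻¹ y ∈ Λ := by
  refine ⟨?_, fun h => ⟨f⁻¹ y, h, f.apply_symm_apply y⟩⟩
  rintro ⟨x, hx, rfl⟩
  convert! hx
  exact f.symm_apply_apply x

theorem apply_mem_act {y : E} : f y ∈ act f Λ ↔ y ∈ Λ := by
  rw [mem_act]
  exact iff_of_eq (congrArg (· ∈ Λ) (f.symm_apply_apply y))

theorem act_mul : act (f * g) Λ = act f (act g Λ) := by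
  ext y
  rw [mem_act, mem_act, mem_act, mul_inv_rev]
  rfl

theorem act_one : act 1 Λ = Λ := by
  ext y
  rw [mem_act, inv_one]
  rfl

theorem act_mono (h : Λ ≤ Λ') : act f Λ ≤ act f Λ' := Submodule.map_mono h

theorem act_inv_eq_iff : act f⁻¹ Λ = Λ' ↔ Λ = act f Λ' := by
  constructor
  · rintro rfl
    rw [← act_mul, mul_inv_cancel, act_one]
  · rintro rfl
    rw [← act_mul, inv_mul_cancel, act_one]

end LocalAction

section Localization

variable {V W : Type*} [AddCommGroup V] [Module ℚ V] [AddCommGroup W] [Module ℚ W]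
  (p : ℕ) [Fact p.Prime]

theorem tmul_mem_localization {L : Submodule ℤ V} {x : V} (hx : x ∈ L) :
    (1 : ℚ_[p]) ⊗ₜ[ℚ] x ∈ localization p L :=
  Submodule.subset_span ⟨x, hx, rfl⟩

theorem localization_le {L : Submodule ℤ V} {Λ : Submodule ℤ_[p] (ℚ_[p] ⊗[ℚ] V)} :
    localization p L ≤ Λ ↔ ∀ x ∈ L, (1 : ℚ_[p]) ⊗ₜ[ℚ] x ∈ Λ := by
  rw [localization, Submodule.span_le, Set.image_subset_iff]
  rfl

theorem localization_mono {L L' : Submodule ℤ V} (h : L ≤ L') :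
    localization p L ≤ localization p L' :=
  (localization_le p).2 fun _ hx => tmul_mem_localization p (h hx)

/-- `L.map` of a `ℚ`-linear equivalence, on lattices. -/
theorem localization_map (L : Submodule ℤ W) (f : W →ₗ[ℚ] V) :
    localization p (L.map (f.restrictScalars ℤ)) =
      (localization p L).map ((f.baseChange ℚ_[p]).restrictScalars ℤ_[p]) := by
  rw [localization, localization, Submodule.map_span, ← Set.image_comp]
  congr 1
  ext y
  constructor
  · rintro ⟨_, ⟨x, hx, rfl⟩, rfl⟩
    exact ⟨x, hx, by simp⟩
  · rintro ⟨x, hx, rfl⟩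
    exact ⟨f x, ⟨x, hx, rfl⟩, by simp⟩

theorem intCast_tmul (k : ℤ) (x : V) :
    (1 : ℚ_[p]) ⊗ₜ[ℚ] (k • x) = (k : ℤ_[p]) • ((1 : ℚ_[p]) ⊗ₜ[ℚ] x) := by
  rw [Int.cast_smul_eq_zsmul, TensorProduct.tmul_smul]

theorem natCast_tmul (k : ℕ) (x : V) :
    (1 : ℚ_[p]) ⊗ₜ[ℚ] (k • x) = (k : ℤ_[p]) • ((1 : ℚ_[p]) ⊗ₜ[ℚ] x) := by
  rw [Nat.cast_smul_eq_nsmul, TensorProduct.tmul_smul]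

theorem localization_span_range {ι : Type*} (b : ι → V) :
    localization p (Submodule.span ℤ (Set.range b)) =
      Submodule.span ℤ_[p] (Set.range fun i => (1 : ℚ_[p]) ⊗ₜ[ℚ] b i) := by
  refine le_antisymm ((localization_le p).2 fun x hx => ?_) (Submodule.span_le.2 ?_)
  · induction hx using Submodule.span_induction with
    | mem x h =>
      obtain ⟨i, rfl⟩ := h
      exact Submodule.subset_span ⟨i, rfl⟩
    | zero => rw [TensorProduct.tmul_zero]; exact zero_mem _
    | add x y _ _ hx hy => rw [TensorProduct.tmul_add]; exact add_mem hx hy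
    | smul k x _ hx =>
      rw [intCast_tmul]
      exact Submodule.smul_mem _ _ hx
  · rintro _ ⟨i, rfl⟩
    exact tmul_mem_localization p (Submodule.subset_span ⟨i, rfl⟩)

theorem mem_localization_iff {ι : Type*} [Finite ι] (b : Module.Basis ι ℚ V)
    {y : ℚ_[p] ⊗[ℚ] V} :
    y ∈ localization p (Submodule.span ℤ (Set.range b)) ↔
      ∀ i, ‖(b.baseChange ℚ_[p]).repr y i‖ ≤ 1 := by
  have h : (fun i => (1 : ℚ_[p]) ⊗ₜ[ℚ] b i) = b.baseChange ℚ_[p] := by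
    ext i
    rw [Module.Basis.baseChange_apply]
  rw [localization_span_range, h, Module.Basis.mem_span_iff_repr_mem]
  refine forall_congr' fun i => ⟨?_, fun h => ⟨⟨_, h⟩, rfl⟩⟩
  rintro ⟨c, hc⟩
  rw [← hc]
  exact c.2

variable {p}

theorem exists_rat_basis (L : Submodule ℤ V) [L.IsLattice ℚ] :
    ∃ (n : ℕ) (b : Module.Basis (Fin n) ℚ V), L = Submodule.span ℤ (Set.range b) := by
  let b := Module.finBasis ℤ L
  refine ⟨_, b.extendOfIsLattice ℚ, ?_⟩
  have h : ⇑(b.extendOfIsLattice ℚ) = L.subtype ∘ b := by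
    ext i
    simp
  rw [h, Set.range_comp, ← Submodule.map_span, b.span_eq, Submodule.map_top,
    Submodule.range_subtype]

/-- A vector lies in a lattice if and only if it does so at every prime. -/
theorem mem_iff_forall_mem_localization (L : Submodule ℤ V) [L.IsLattice ℚ] {x : V} :
    x ∈ L ↔ ∀ p : PrimeIndex, (1 : ℚ_[p]) ⊗ₜ[ℚ] x ∈ localization p L := by
  refine ⟨fun h p => tmul_mem_localization p h, fun h => ?_⟩
  obtain ⟨n, b, rfl⟩ := exists_rat_basis L
  rw [Module.Basis.mem_span_iff_repr_mem]
  intro i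
  obtain ⟨k, hk⟩ := rat_isInt_of_forall_norm_le_one (q := b.repr x i) fun p => by
    have := (mem_localization_iff p b).1 (h p) i
    rw [Module.Basis.baseChange_repr_tmul] at this
    simpa [Algebra.smul_def] using this
  exact ⟨k, hk.symm⟩

theorem le_of_forall_localization_le {K L : Submodule ℤ V} [L.IsLattice ℚ]
    (h : ∀ p : PrimeIndex, localization p K ≤ localization p L) : K ≤ L := fun _ hx =>
  (mem_iff_forall_mem_localization L).2 fun p => h p (tmul_mem_localization p hx)

theorem eq_of_forall_localization_eq {K L : Submodule ℤ V} [K.IsLattice ℚ] [L.IsLattice ℚ]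
    (h : ∀ p : PrimeIndex, localization p K = localization p L) : K = L :=
  le_antisymm (le_of_forall_localization_le fun p => (h p).le)
    (le_of_forall_localization_le fun p => (h p).ge)

/-- Two lattices on the same space are commensurable. -/
theorem exists_smul_mem (K L : Submodule ℤ V) [K.IsLattice ℚ] [L.IsLattice ℚ] :
    ∃ m : ℕ, m ≠ 0 ∧ ∀ x ∈ K, m • x ∈ L := by
  obtain ⟨n, b, rfl⟩ := exists_rat_basis L
  obtain ⟨s, rfl⟩ := Submodule.IsLattice.fg (M := K)
  refine ⟨∏ x ∈ s, ∏ i, (b.repr x i).den,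
    Finset.prod_ne_zero_iff.2 fun x _ => Finset.prod_ne_zero_iff.2 fun i _ => (b.repr x i).den_nz,
    fun x hx => ?_⟩
  induction hx using Submodule.span_induction with
  | mem x h =>
    rw [Module.Basis.mem_span_iff_repr_mem]
    intro i
    obtain ⟨k, hk⟩ := (Finset.dvd_prod_of_mem (fun i => (b.repr x i).den)
      (Finset.mem_univ i)).trans
        (Finset.dvd_prod_of_mem (fun x => ∏ i, (b.repr x i).den) h)
    rw [hk, ← Nat.cast_smul_eq_nsmul ℚ, map_smul, Finsupp.smul_apply, smul_eq_mul]
    refine ⟨k * (b.repr x i).num, ?_⟩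
    conv_rhs => rw [← Rat.num_div_den (b.repr x i)]
    have := (b.repr x i).den_nz
    rw [Rat.num_div_den]
    have h3 := Rat.den_mul_eq_num (b.repr x i)
    simp only [algebraMap_int_eq, eq_intCast]
    push_cast
    rw [mul_assoc, mul_left_comm, h3]
  | zero => rw [smul_zero]; exact zero_mem _
  | add x y _ _ hx hy => rw [smul_add]; exact add_mem hx hy
  | smul k x _ hx =>
    rw [smul_comm]
    exact Submodule.smul_mem _ _ hx

theorem norm_natCast_eq_one {m : ℕ} (p : ℕ) [Fact p.Prime] (h : ¬ p ∣ m) : ‖(m : ℤ_[p])‖ = 1 := by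
  rw [PadicInt.norm_natCast_eq_one_iff]
  exact (Nat.Prime.coprime_iff_not_dvd Fact.out).2 h

theorem mem_of_natCast_smul_mem {M : Type*} [AddCommGroup M] {m : ℕ} (p : ℕ) [Fact p.Prime]
    [Module ℤ_[p] M] (h : ¬ p ∣ m)
    {Λ : Submodule ℤ_[p] M} {y : M} (hy : (m : ℤ_[p]) • y ∈ Λ) :
    y ∈ Λ := by
  obtain ⟨u, hu⟩ := PadicInt.isUnit_iff.2 (norm_natCast_eq_one p h)
  have := Λ.smul_mem ((u⁻¹ : ℤ_[p]ˣ) : ℤ_[p]) hy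
  rwa [← hu, smul_smul, Units.inv_mul, one_smul] at this

theorem localization_le_of_not_dvd {K L : Submodule ℤ V} {m : ℕ} (p : ℕ) [Fact p.Prime]
    (hm : ¬ p ∣ m) (h : ∀ x ∈ K, m • x ∈ L) : localization p K ≤ localization p L := by
  refine (localization_le p).2 fun x hx => mem_of_natCast_smul_mem p hm ?_
  rw [← natCast_tmul]
  exact tmul_mem_localization p (h x hx)

/-- Two lattices on the same space agree at almost all primes. -/
theorem finite_localization_ne (K L : Submodule ℤ V) [K.IsLattice ℚ] [L.IsLattice ℚ] :
    {p : PrimeIndex | localization p K ≠ localization p L}.Finite := by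
  obtain ⟨m, hm, h1⟩ := exists_smul_mem K L
  obtain ⟨m', hm', h2⟩ := exists_smul_mem L K
  have hfin : ({p : PrimeIndex | (p : ℕ) ∣ m * m'}).Finite :=
    Set.Finite.preimage (f := Subtype.val) (s := {d | d ∣ m * m'}) Subtype.val_injective.injOn
      (Set.Finite.subset (Nat.divisors (m * m')).finite_toSet fun d (hd : d ∣ m * m') =>
        Finset.mem_coe.2 (Nat.mem_divisors.2 ⟨hd, mul_ne_zero hm hm'⟩))
  refine hfin.subset fun p hp => ?_
  by_contra hd
  exact hp (le_antisymm
    (localization_le_of_not_dvd p (fun h => hd (h.mul_right _)) h1)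
    (localization_le_of_not_dvd p (fun h => hd (h.mul_left _)) h2))

/-- A subgroup squeezed between multiples of a lattice is a lattice. -/
theorem isLattice_of_smul_mem {K L : Submodule ℤ V} [L.IsLattice ℚ] {m : ℕ} (hm : m ≠ 0)
    (h1 : ∀ x ∈ L, m • x ∈ K) (h2 : ∀ x ∈ K, m • x ∈ L) : K.IsLattice ℚ := by
  have hm' : (m : ℚ) ≠ 0 := by exact_mod_cast hm
  constructor
  · have hinj : Function.Injective ((LinearMap.lsmul ℤ V m).domRestrict K) := by
      intro x y hxy
      simp only [LinearMap.domRestrict_apply, LinearMap.lsmul_apply] at hxy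
      rw [natCast_zsmul, natCast_zsmul, ← Nat.cast_smul_eq_nsmul ℚ,
        ← Nat.cast_smul_eq_nsmul ℚ] at hxy
      exact Subtype.ext (smul_right_injective V hm' hxy)
    have hmem : ∀ x : K, (LinearMap.lsmul ℤ V m).domRestrict K x ∈ L := by
      intro x
      simp only [LinearMap.domRestrict_apply, LinearMap.lsmul_apply, natCast_zsmul]
      exact h2 x x.2
    have hN : IsNoetherian ℤ L := inferInstance
    have : IsNoetherian ℤ K := isNoetherian_of_injective
      (((LinearMap.lsmul ℤ V m).domRestrict K).codRestrict L hmem)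
      fun x y h => hinj (congrArg Subtype.val h)
    exact Module.Finite.iff_fg.1 inferInstance
  · rw [eq_top_iff, ← Submodule.IsLattice.span_eq_top (M := L), Submodule.span_le]
    intro x hx
    have h3 := Submodule.smul_mem _ (m : ℚ)⁻¹
      (Submodule.subset_span (R := ℚ) (h1 x hx) : m • x ∈ Submodule.span ℚ (K : Set V))
    rwa [← Nat.cast_smul_eq_nsmul ℚ, smul_smul, inv_mul_cancel₀ hm', one_smul] at h3

/-- The denominators of a linear automorphism of `V_p` are bounded on a lattice. -/
theorem exists_pow_smul_apply_mem (L : Submodule ℤ V) [L.IsLattice ℚ] (p : ℕ) [Fact p.Prime]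
    (f : (ℚ_[p] ⊗[ℚ] V) ≃ₗ[ℚ_[p]] (ℚ_[p] ⊗[ℚ] V)) :
    ∃ k : ℕ, ∀ y ∈ localization p L, ((p ^ k : ℕ) : ℤ_[p]) • f y ∈ localization p L := by
  obtain ⟨n, b, rfl⟩ := exists_rat_basis L
  have hp : p.Prime := Fact.out
  set c := b.baseChange ℚ_[p] with hc
  obtain ⟨k, hk⟩ := pow_unbounded_of_one_lt (∑ i, ∑ j, ‖c.repr (f (c i)) j‖)
    (y := (p : ℝ)) (by exact_mod_cast hp.one_lt)
  refine ⟨k, ?_⟩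
  have hle : localization p (Submodule.span ℤ (Set.range b)) ≤
      (localization p (Submodule.span ℤ (Set.range b))).comap
        (((p ^ k : ℕ) : ℤ_[p]) • f.toLinearMap.restrictScalars ℤ_[p]) := by
    conv_lhs => rw [localization_span_range]
    rw [Submodule.span_le]
    rintro _ ⟨i, rfl⟩
    change ((p ^ k : ℕ) : ℤ_[p]) • f ((1 : ℚ_[p]) ⊗ₜ[ℚ] b i) ∈
      localization p (Submodule.span ℤ (Set.range b))
    rw [← Module.Basis.baseChange_apply, ← hc, mem_localization_iff, ← hc]
    intro j
    rw [Nat.cast_smul_eq_nsmul, ← Nat.cast_smul_eq_nsmul ℚ_[p], map_smul, Finsupp.smul_apply,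
      smul_eq_mul, norm_mul]
    push_cast
    have hp0 : (0 : ℝ) < (p : ℝ) ^ k := by have := hp.pos; positivity
    rw [Padic.norm_p_pow, zpow_neg, zpow_natCast, inv_mul_le_iff₀ hp0, mul_one]
    refine le_trans ?_ hk.le
    exact (Finset.single_le_sum (f := fun j => ‖c.repr (f (c i)) j‖)
      (fun _ _ => norm_nonneg _) (Finset.mem_univ j)).trans
        (Finset.single_le_sum (f := fun i => ∑ j, ‖c.repr (f (c i)) j‖)
          (fun _ _ => Finset.sum_nonneg fun _ _ => norm_nonneg _) (Finset.mem_univ i))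
  exact fun y hy => hle hy

/-- Local lattices `Λ_p` that agree with `L_p` at almost all primes are the localizations of a
lattice on `V`, namely of the vectors that lie in all the `Λ_p`. -/
theorem exists_lattice_of_localizations (L : Submodule ℤ V) [L.IsLattice ℚ]
    (f : ∀ p : PrimeIndex, (ℚ_[p] ⊗[ℚ] V) ≃ₗ[ℚ_[p]] (ℚ_[p] ⊗[ℚ] V))
    (hf : {p : PrimeIndex | act (f p) (localization p L) ≠ localization p L}.Finite) :
    ∃ K : Submodule ℤ V, K.IsLattice ℚ ∧
      ∀ p : PrimeIndex, localization p K = act (f p) (localization p L) := by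
  choose k hk using fun p : PrimeIndex => exists_pow_smul_apply_mem L p (f p)
  choose k' hk' using fun p : PrimeIndex => exists_pow_smul_apply_mem L p (f p)⁻¹
  set m : ℕ := ∏ p ∈ hf.toFinset, (p : ℕ) ^ (k p + k' p) with hm
  have hm0 : m ≠ 0 := Finset.prod_ne_zero_iff.2 fun p _ => pow_ne_zero _ p.2.ne_zero
  have hdvd : ∀ p ∈ hf.toFinset, (p : ℕ) ^ (k p + k' p) ∣ m := fun p hp =>
    Finset.dvd_prod_of_mem (fun p : PrimeIndex => (p : ℕ) ^ (k p + k' p)) hp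
  -- `m L_p ⊆ f_p L_p` and `m f_p L_p ⊆ L_p` for all `p`
  have h1 : ∀ p : PrimeIndex, ∀ y ∈ localization p L,
      (m : ℤ_[p]) • y ∈ act (f p) (localization p L) := by
    intro p y hy
    by_cases hp : p ∈ hf.toFinset
    · obtain ⟨d, hd⟩ := (pow_dvd_pow _ (Nat.le_add_left _ _)).trans (hdvd p hp)
      rw [mem_act, hd, mul_comm, Nat.cast_mul, mul_smul]
      change ((f p)⁻¹.toLinearMap.restrictScalars ℤ_[p]) _ ∈ _
      rw [map_smul, map_smul]
      exact Submodule.smul_mem _ _ (hk' p y hy)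
    · rw [Set.Finite.mem_toFinset, Set.mem_ofPred_eq, not_not] at hp
      rw [hp]
      exact Submodule.smul_mem _ _ hy
  have h2 : ∀ p : PrimeIndex, ∀ y ∈ act (f p) (localization p L),
      (m : ℤ_[p]) • y ∈ localization p L := by
    intro p y hy
    by_cases hp : p ∈ hf.toFinset
    · obtain ⟨d, hd⟩ := (pow_dvd_pow _ (Nat.le_add_right _ _)).trans (hdvd p hp)
      obtain ⟨x, hx, rfl⟩ := hy
      rw [hd, mul_comm, Nat.cast_mul, mul_smul]
      exact Submodule.smul_mem _ _ (hk p x hx)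
    · rw [Set.Finite.mem_toFinset, Set.mem_ofPred_eq, not_not] at hp
      rw [hp] at hy
      exact Submodule.smul_mem _ _ hy
  let K : Submodule ℤ V :=
    { carrier := {x | ∀ p : PrimeIndex, (1 : ℚ_[p]) ⊗ₜ[ℚ] x ∈ act (f p) (localization p L)}
      add_mem' := fun hx hy p => by
        rw [TensorProduct.tmul_add]
        exact add_mem (hx p) (hy p)
      zero_mem' := fun p => by
        rw [TensorProduct.tmul_zero]
        exact zero_mem _
      smul_mem' := fun c x hx p => by
        rw [intCast_tmul]
        exact Submodule.smul_mem _ _ (hx p) }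
  have h3 : ∀ x ∈ L, m • x ∈ K := fun x hx p => by
    rw [natCast_tmul]
    exact h1 p _ (tmul_mem_localization p hx)
  have h4 : ∀ x ∈ K, m • x ∈ L := fun x hx => by
    rw [mem_iff_forall_mem_localization L]
    intro p
    rw [natCast_tmul]
    exact h2 p _ (hx p)
  refine ⟨K, isLattice_of_smul_mem hm0 h3 h4, fun p => le_antisymm ?_ ?_⟩
  · exact (localization_le _).2 fun x hx => hx p
  · -- approximate at `p` by a vector of `V` that is integral at all other primes
    intro y hy
    obtain ⟨n, b, rfl⟩ := exists_rat_basis L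
    choose c hc hc' using fun i =>
      exists_rat_approx p ((m : ℚ_[p])⁻¹ * (b.baseChange ℚ_[p]).repr y i)
    have hmp : (m : ℚ_[p]) ≠ 0 := by exact_mod_cast hm0
    set x : V := ∑ i, c i • b i with hx
    have hrepr : ∀ i, b.repr x i = c i := fun i => by rw [hx, Module.Basis.repr_sum_self]
    set z : ℚ_[p] ⊗[ℚ] V := (m : ℚ_[p])⁻¹ • y - (1 : ℚ_[p]) ⊗ₜ[ℚ] x with hz
    have hz' : z ∈ localization p (Submodule.span ℤ (Set.range b)) := by
      rw [mem_localization_iff]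
      intro i
      rw [hz, map_sub, map_smul, Finsupp.sub_apply, Finsupp.smul_apply,
        Module.Basis.baseChange_repr_tmul, hrepr, smul_eq_mul, norm_sub_rev]
      simpa [Algebra.smul_def] using hc i
    have hy' : y = (m : ℤ_[p]) • z + (1 : ℚ_[p]) ⊗ₜ[ℚ] (m • x) := by
      rw [natCast_tmul, ← smul_add, hz, sub_add_cancel, Nat.cast_smul_eq_nsmul,
        ← Nat.cast_smul_eq_nsmul ℚ_[p], smul_smul, mul_inv_cancel₀ hmp, one_smul]
    have hxK : m • x ∈ K := by
      intro q
      rw [natCast_tmul]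
      by_cases hq : q = p
      · subst hq
        rw [← natCast_tmul, ← add_sub_cancel_left ((m : ℤ_[q]) • z) ((1 : ℚ_[q]) ⊗ₜ[ℚ] (m • x)),
          ← hy']
        exact sub_mem hy (h1 q z hz')
      · refine h1 q _ ((mem_localization_iff q b).2 fun i => ?_)
        rw [Module.Basis.baseChange_repr_tmul, hrepr]
        have := hc' i q fun h => hq (Subtype.ext h)
        simpa [Algebra.smul_def] using this
    rw [hy']
    refine add_mem ?_ (tmul_mem_localization _ hxK)
    have hle : ∀ w ∈ localization (p : ℕ) (Submodule.span ℤ (Set.range b)),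
        (m : ℤ_[p]) • w ∈ localization p K := by
      intro w hw
      have : localization (p : ℕ) (Submodule.span ℤ (Set.range b)) ≤
          (localization p K).comap (LinearMap.lsmul ℤ_[p] (ℚ_[p] ⊗[ℚ] V) (m : ℤ_[p])) := by
        refine (localization_le _).2 fun v hv => ?_
        change (m : ℤ_[p]) • ((1 : ℚ_[p]) ⊗ₜ[ℚ] v) ∈ localization (p : ℕ) K
        rw [← natCast_tmul]
        exact tmul_mem_localization _ (h3 v hv)
      exact this hw
    exact hle z hz'

end Localization

/-! ### Base change of isometries -/

section BaseChange

variable {V W : Type*} [AddCommGroup V] [Module ℚ V] [AddCommGroup W] [Module ℚ W]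
  (p : ℕ) [Fact p.Prime]

theorem localForm_one_tmul (Q : QuadraticForm ℚ V) (x : V) :
    localForm p Q ((1 : ℚ_[p]) ⊗ₜ[ℚ] x) = (Q x : ℚ_[p]) := by
  rw [QuadraticForm.baseChange_tmul, one_mul, Algebra.smul_def, mul_one, eq_ratCast]

theorem polar_localForm_one_tmul (Q : QuadraticForm ℚ V) (x y : V) :
    QuadraticMap.polar (localForm p Q) ((1 : ℚ_[p]) ⊗ₜ[ℚ] x) ((1 : ℚ_[p]) ⊗ₜ[ℚ] y) =
      (QuadraticMap.polar Q x y : ℚ) := by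
  simp only [QuadraticMap.polar, ← TensorProduct.tmul_add, localForm_one_tmul]
  push_cast
  rfl

theorem localForm_similitude {QV : QuadraticForm ℚ V} {QW : QuadraticForm ℚ W} {c : ℚ}
    (f : W →ₗ[ℚ] V) (hf : ∀ x, QV (f x) = c * QW x) (y : ℚ_[p] ⊗[ℚ] W) :
    localForm p QV (f.baseChange ℚ_[p] y) = (c : ℚ_[p]) * localForm p QW y := by
  have h : (localForm p QV).comp (f.baseChange ℚ_[p]) = (c : ℚ_[p]) • localForm p QW := by
    apply baseChange_ext
    intro x
    rw [QuadraticMap.comp_apply, LinearMap.baseChange_tmul, localForm_one_tmul,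
      smul_apply, localForm_one_tmul, hf, smul_eq_mul, Rat.cast_mul]
  exact congrArg (fun q => q y) h

theorem baseChange_mem_orthogonalGroup {Q : QuadraticForm ℚ V} {σ : V ≃ₗ[ℚ] V}
    (hσ : σ ∈ orthogonalGroup Q) :
    σ.baseChange ℚ ℚ_[p] V V ∈ orthogonalGroup (localForm p Q) := by
  intro y
  have := localForm_similitude p (c := 1) (QV := Q) (QW := Q) σ.toLinearMap
    (fun x => by rw [one_mul]; exact hσ x) y
  rwa [Rat.cast_one, one_mul] at this

theorem exists_orthogonal_basis_of_posDef [FiniteDimensional ℚ V] {Q : QuadraticForm ℚ V}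
    (hQ : Q.PosDef) : ∃ b : Module.Basis (Fin (Module.finrank ℚ V)) ℚ V,
      (∀ i, Q (b i) ≠ 0) ∧ ∀ i j, i ≠ j → QuadraticMap.polar Q (b i) (b j) = 0 := by
  have h2 : Invertible (2 : ℚ) := invertibleOfNonzero two_ne_zero
  obtain ⟨b, hb⟩ := LinearMap.BilinForm.exists_orthogonal_basis
    (B := QuadraticMap.associated (R := ℚ) Q) (QuadraticForm.associated_isSymm ℚ Q)
  refine ⟨b, fun i => (hQ _ (b.ne_zero i)).ne', fun i j hij => ?_⟩
  have h3 := hb hij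
  change QuadraticMap.associated (R := ℚ) Q (b i) (b j) = 0 at h3
  have h4 := QuadraticMap.two_nsmul_associated ℚ Q
  have h5 := LinearMap.congr_fun (LinearMap.congr_fun h4 (b i)) (b j)
  simp only [LinearMap.smul_apply, QuadraticMap.polarBilin_apply_apply] at h5
  rw [← h5]
  simp [h3]

/-- Isometries of the completions of a positive definite space are products of symmetries. -/
theorem exists_isSymmetryProd_localForm [FiniteDimensional ℚ V] {Q : QuadraticForm ℚ V}
    (hQ : Q.PosDef) {f : (ℚ_[p] ⊗[ℚ] V) ≃ₗ[ℚ_[p]] (ℚ_[p] ⊗[ℚ] V)}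
    (hf : f ∈ orthogonalGroup (localForm p Q)) :
    ∃ l, IsSymmetryProd (localForm p Q) f.toLinearMap l := by
  obtain ⟨b, hb, hbo⟩ := exists_orthogonal_basis_of_posDef hQ
  refine exists_isSymmetryProd _ two_ne_zero (b.baseChange ℚ_[p]) (fun i => ?_)
    (fun i j hij => ?_) hf
  · rw [Module.Basis.baseChange_apply, localForm_one_tmul]
    exact_mod_cast hb i
  · rw [Module.Basis.baseChange_apply, Module.Basis.baseChange_apply, polar_localForm_one_tmul,
      hbo i j hij, Rat.cast_zero]

end BaseChange

/-! ### The adelic orthogonal group -/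

section Adelic

variable {V : Type*} [AddCommGroup V] [Module ℚ V]

theorem isLattice_map {W : Type*} [AddCommGroup W] [Module ℚ W] (σ : V ≃ₗ[ℚ] W)
    (L : Submodule ℤ V) [L.IsLattice ℚ] :
    (L.map (σ.toLinearMap.restrictScalars ℤ)).IsLattice ℚ := by
  refine ⟨Submodule.IsLattice.fg.map _, ?_⟩
  have h : ((L.map (σ.toLinearMap.restrictScalars ℤ) : Submodule ℤ W) : Set W) =
      σ.toLinearMap '' L := rfl
  rw [h, Submodule.span_image, Submodule.IsLattice.span_eq_top, Submodule.map_top,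
    LinearEquiv.range]

theorem act_baseChange (p : ℕ) [Fact p.Prime] (σ : V ≃ₗ[ℚ] V) (L : Submodule ℤ V) :
    act (σ.baseChange ℚ ℚ_[p] V V) (localization p L) =
      localization p (L.map (σ.toLinearMap.restrictScalars ℤ)) := by
  rw [localization_map]
  rfl

/-- The adelic orthogonal group of `Q`: families of isometries of the completions `V_p` that
preserve `N_p` for almost all `p`. It does not depend on the lattice `N`. -/
def adelicGroup (Q : QuadraticForm ℚ V) (N : Submodule ℤ V) :
    Subgroup (∀ p : PrimeIndex, (ℚ_[p] ⊗[ℚ] V) ≃ₗ[ℚ_[p]] (ℚ_[p] ⊗[ℚ] V)) where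
  carrier := {τ | (∀ p : PrimeIndex, τ p ∈ orthogonalGroup (localForm p Q)) ∧
    {p : PrimeIndex | act (τ p) (localization p N) ≠ localization p N}.Finite}
  mul_mem' {τ υ} hτ hυ := by
    refine ⟨fun p => mul_mem (hτ.1 p) (hυ.1 p), (hτ.2.union hυ.2).subset fun p hp => ?_⟩
    by_contra h
    simp only [Set.mem_union, Set.mem_ofPred_eq, not_or, not_not] at h
    refine hp ?_
    rw [Pi.mul_apply, act_mul, h.2, h.1]
  one_mem' := ⟨fun p => one_mem _, by simp [act_one]⟩
  inv_mem' {τ} hτ := by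
    refine ⟨fun p => inv_mem (hτ.1 p), hτ.2.subset fun p hp h => hp ?_⟩
    rw [Pi.inv_apply, act_inv_eq_iff]
    exact h.symm

variable (Q : QuadraticForm ℚ V) (N : Submodule ℤ V)

theorem mem_adelicGroup_of_stabilizes [N.IsLattice ℚ] (L : Submodule ℤ V) [L.IsLattice ℚ]
    {τ : ∀ p : PrimeIndex, (ℚ_[p] ⊗[ℚ] V) ≃ₗ[ℚ_[p]] (ℚ_[p] ⊗[ℚ] V)}
    (h1 : ∀ p : PrimeIndex, τ p ∈ orthogonalGroup (localForm p Q))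
    (h2 : ∀ p : PrimeIndex, act (τ p) (localization p L) = localization p L) :
    τ ∈ adelicGroup Q N := by
  refine ⟨h1, (finite_localization_ne L N).subset fun p hp h => hp ?_⟩
  rw [← h]
  exact h2 p

/-- Membership in the adelic group may be tested with two lattices that `τ` carries into
each other. -/
theorem mem_adelicGroup_of_localization [N.IsLattice ℚ] (K L : Submodule ℤ V) [K.IsLattice ℚ]
    [L.IsLattice ℚ] {τ : ∀ p : PrimeIndex, (ℚ_[p] ⊗[ℚ] V) ≃ₗ[ℚ_[p]] (ℚ_[p] ⊗[ℚ] V)}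
    (h1 : ∀ p : PrimeIndex, τ p ∈ orthogonalGroup (localForm p Q))
    (h2 : ∀ p : PrimeIndex, localization p K = act (τ p) (localization p L)) :
    τ ∈ adelicGroup Q N := by
  refine ⟨h1, ((finite_localization_ne L N).union (finite_localization_ne K N)).subset
    fun p hp => ?_⟩
  by_contra h
  simp only [Set.mem_union, Set.mem_ofPred_eq, not_or, not_not] at h
  refine hp ?_
  rw [← h.1, ← h2 p, h.1, h.2]

/-- The stabilizer of the lattice `L` in the adelic orthogonal group. -/
def adelicStabilizer (L : Submodule ℤ V) : Subgroup (adelicGroup Q N) where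
  carrier := {τ | ∀ p : PrimeIndex, act (τ.1 p) (localization p L) = localization p L}
  mul_mem' {τ υ} hτ hυ p := by
    rw [Subgroup.coe_mul, Pi.mul_apply, act_mul, hυ, hτ]
  one_mem' _ := act_one
  inv_mem' {τ} hτ p := by
    rw [Subgroup.coe_inv, Pi.inv_apply, act_inv_eq_iff, hτ]

/-- The families of elements of trivial spinor norm in the adelic orthogonal group. -/
def adelicKernel : Subgroup (adelicGroup Q N) where
  carrier := {τ | ∀ p : PrimeIndex, τ.1 p ∈ spinorKernel (localForm p Q)}
  mul_mem' hτ hυ p := mul_mem (hτ p) (hυ p)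
  one_mem' _ := one_mem _
  inv_mem' hτ p := inv_mem (hτ p)

/-- The isometries of `V`, embedded diagonally in the adelic orthogonal group. -/
def rationalIsometries : Subgroup (adelicGroup Q N) where
  carrier := {τ | ∃ σ ∈ orthogonalGroup Q, ∀ p : PrimeIndex, τ.1 p = σ.baseChange ℚ ℚ_[p] V V}
  mul_mem' := by
    rintro τ υ ⟨σ, hσ, h1⟩ ⟨ρ, hρ, h2⟩
    refine ⟨σ * ρ, mul_mem hσ hρ, fun p => ?_⟩
    rw [Subgroup.coe_mul, Pi.mul_apply, h1, h2, LinearEquiv.baseChange_mul]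
  one_mem' := ⟨1, one_mem _, fun p => by
    rw [LinearEquiv.baseChange_one]; rfl⟩
  inv_mem' := by
    rintro τ ⟨σ, hσ, h1⟩
    refine ⟨σ⁻¹, inv_mem hσ, fun p => ?_⟩
    rw [Subgroup.coe_inv, Pi.inv_apply, h1]
    refine inv_eq_of_mul_eq_one_right ?_
    rw [← LinearEquiv.baseChange_mul, mul_inv_cancel, LinearEquiv.baseChange_one]

/-- The stabilizer of the spinor genus of `L` in the adelic orthogonal group. -/
def spinorStabilizer (L : Submodule ℤ V) : Subgroup (adelicGroup Q N) :=
  rationalIsometries Q N ⊔ adelicKernel Q N ⊔ adelicStabilizer Q N L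

variable {Q N}

theorem commutator_mem_adelicKernel [FiniteDimensional ℚ V] (hQ : Q.PosDef)
    (τ υ : adelicGroup Q N) : τ * υ * τ⁻¹ * υ⁻¹ ∈ adelicKernel Q N := by
  intro p
  obtain ⟨l, hl⟩ := exists_isSymmetryProd_localForm p hQ (τ.2.1 p)
  obtain ⟨m, hm⟩ := exists_isSymmetryProd_localForm p hQ (υ.2.1 p)
  exact commutator_mem_spinorKernel _ hl hm

/-- Commutators lie in the spinor kernel, so the quotient of the adelic group by a subgroup that
contains the kernel is abelian. -/
theorem normal_of_adelicKernel_le [FiniteDimensional ℚ V] (hQ : Q.PosDef)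
    {H : Subgroup (adelicGroup Q N)} (h : adelicKernel Q N ≤ H) : H.Normal := by
  constructor
  intro υ hυ τ
  have := mul_mem (h (commutator_mem_adelicKernel hQ τ υ)) hυ
  rwa [inv_mul_cancel_right] at this

theorem adelicKernel_le_spinorStabilizer (L : Submodule ℤ V) :
    adelicKernel Q N ≤ spinorStabilizer Q N L := le_sup_right.trans le_sup_left

theorem exists_adelic_of_mem_genus [N.IsLattice ℚ] {K L : Submodule ℤ V} [L.IsLattice ℚ]
    (h : K ∈ genus Q L) :
    ∃ τ : adelicGroup Q N, ∀ p : PrimeIndex, localization p K = act (τ.1 p) (localization p L) := by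
  obtain ⟨h1, h2⟩ := h
  choose τ hτ using fun p : PrimeIndex => h2 p
  exact ⟨⟨fun p => (τ p).toLinearEquiv,
    mem_adelicGroup_of_localization Q N K L (fun p => toIsometryEquiv_mem _ _) hτ⟩, hτ⟩

theorem mem_genus_of_adelic {K L : Submodule ℤ V} (hK : K.IsLattice ℚ) (τ : adelicGroup Q N)
    (h : ∀ p : PrimeIndex, localization p K = act (τ.1 p) (localization p L)) : K ∈ genus Q L :=
  ⟨hK, fun p hp => ⟨⟨τ.1 ⟨p, hp.out⟩, τ.2.1 ⟨p, hp.out⟩⟩, h ⟨p, hp.out⟩⟩⟩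

variable (N)

theorem exists_lattice_of_adelic [N.IsLattice ℚ] (L : Submodule ℤ V) [L.IsLattice ℚ]
    (τ : adelicGroup Q N) : ∃ K : Submodule ℤ V, K.IsLattice ℚ ∧
      ∀ p : PrimeIndex, localization p K = act (τ.1 p) (localization p L) := by
  refine exists_lattice_of_localizations L τ.1
    ((τ.2.2.union (finite_localization_ne L N)).subset fun p hp => ?_)
  by_contra h
  simp only [Set.mem_union, Set.mem_ofPred_eq, not_or, not_not] at h
  refine hp ?_
  rw [h.2, h.1]

/-- The image of the lattice `L` under an element of the adelic orthogonal group. -/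
def adelicImage [N.IsLattice ℚ] (τ : adelicGroup Q N) (L : Submodule ℤ V) [L.IsLattice ℚ] :
    Submodule ℤ V :=
  (exists_lattice_of_adelic N L τ).choose

instance [N.IsLattice ℚ] (τ : adelicGroup Q N) (L : Submodule ℤ V) [L.IsLattice ℚ] :
    (adelicImage N τ L).IsLattice ℚ :=
  (exists_lattice_of_adelic N L τ).choose_spec.1

theorem localization_adelicImage [N.IsLattice ℚ] (τ : adelicGroup Q N) (L : Submodule ℤ V)
    [L.IsLattice ℚ] (p : PrimeIndex) :
    localization p (adelicImage N τ L) = act (τ.1 p) (localization p L) :=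
  (exists_lattice_of_adelic N L τ).choose_spec.2 p

theorem adelicImage_mem_genus [N.IsLattice ℚ] (τ : adelicGroup Q N) (L : Submodule ℤ V)
    [L.IsLattice ℚ] : adelicImage N τ L ∈ genus Q L :=
  mem_genus_of_adelic inferInstance τ (localization_adelicImage N τ L)

variable {N}

theorem eq_adelicImage [N.IsLattice ℚ] {τ : adelicGroup Q N} {K L : Submodule ℤ V}
    [K.IsLattice ℚ] [L.IsLattice ℚ]
    (h : ∀ p : PrimeIndex, localization p K = act (τ.1 p) (localization p L)) :
    K = adelicImage N τ L :=
  eq_of_forall_localization_eq fun p => by rw [h, localization_adelicImage]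

theorem mem_genus_iff_exists_adelicImage (N : Submodule ℤ V) [N.IsLattice ℚ] {K L : Submodule ℤ V}
    [L.IsLattice ℚ] : K ∈ genus Q L ↔ ∃ τ : adelicGroup Q N, K = adelicImage N τ L := by
  refine ⟨fun h => ?_, ?_⟩
  · obtain ⟨τ, hτ⟩ := exists_adelic_of_mem_genus (N := N) h
    have := h.1
    exact ⟨τ, eq_adelicImage hτ⟩
  · rintro ⟨τ, rfl⟩
    exact adelicImage_mem_genus N τ L

/-- The spinor genus of `τL` consists of the images of `L` under the coset of `τ` modulo the
stabilizer of `spn(L)`. The latter is normal, so rational isometries, which act after `τ`, may be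
moved past it. -/
theorem adelicImage_mem_spinorGenus_iff [FiniteDimensional ℚ V] (hQ : Q.PosDef) [N.IsLattice ℚ]
    {L : Submodule ℤ V} [L.IsLattice ℚ] (τ υ : adelicGroup Q N) :
    adelicImage N υ L ∈ spinorGenus Q (adelicImage N τ L) ↔
      τ⁻¹ * υ ∈ spinorStabilizer Q N L := by
  have hn : (rationalIsometries Q N ⊔ adelicKernel Q N).Normal :=
    normal_of_adelicKernel_le hQ le_sup_right
  have hn' : (adelicKernel Q N).Normal := normal_of_adelicKernel_le hQ le_rfl
  constructor
  · rintro ⟨-, σ, h⟩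
    choose s hs hs' using fun p : PrimeIndex => h p
    choose f hf hf' using fun p : PrimeIndex => (hs p).exists_equiv
    have hσ : σ.toLinearEquiv ∈ orthogonalGroup Q := toIsometryEquiv_mem Q σ
    set L' := (adelicImage N τ L) with hL'
    have := isLattice_map σ.toLinearEquiv N
    let σA : adelicGroup Q N := ⟨fun p => σ.toLinearEquiv.baseChange ℚ ℚ_[p] V V,
      mem_adelicGroup_of_localization Q N _ N
        (fun p => baseChange_mem_orthogonalGroup p hσ) fun p => (act_baseChange p _ _).symm⟩
    have hact : ∀ p : PrimeIndex, act (υ.1 p) (localization p L) =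
        act (σA.1 p * f p * τ.1 p) (localization p L) := by
      intro p
      rw [← localization_adelicImage N υ, hs' p, localization_adelicImage, ← hf' p, act_mul,
        act_mul]
      rfl
    let l : adelicGroup Q N := ⟨fun p => (σA.1 p * f p * τ.1 p)⁻¹ * υ.1 p,
      mem_adelicGroup_of_stabilizes Q N L
        (fun p => mul_mem (inv_mem (mul_mem (mul_mem (σA.2.1 p) (spinorKernel_le _ (hf p)))
          (τ.2.1 p))) (υ.2.1 p)) fun p => by
            rw [act_mul, act_inv_eq_iff, hact]⟩
    have hl : l ∈ adelicStabilizer Q N L := fun p => by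
      change act ((σA.1 p * f p * τ.1 p)⁻¹ * υ.1 p) _ = _
      rw [act_mul, act_inv_eq_iff, hact]
    have hfA : (fun p => f p) = (σA⁻¹ * υ * l⁻¹ * τ⁻¹).1 := by
      funext p
      change f p = (σA.1 p)⁻¹ * υ.1 p * ((σA.1 p * f p * τ.1 p)⁻¹ * υ.1 p)⁻¹ * (τ.1 p)⁻¹
      group
    let fA : adelicGroup Q N := ⟨fun p => f p, hfA ▸ (σA⁻¹ * υ * l⁻¹ * τ⁻¹).2⟩
    have hfA' : fA ∈ adelicKernel Q N := fun p => hf p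
    have hυ : τ⁻¹ * υ = (τ⁻¹ * (σA * fA) * τ⁻¹⁻¹) * l := by
      have : fA = σA⁻¹ * υ * l⁻¹ * τ⁻¹ := Subtype.ext hfA
      rw [this]
      group
    rw [hυ]
    have hσf : σA * fA ∈ rationalIsometries Q N ⊔ adelicKernel Q N :=
      mul_mem (Subgroup.mem_sup_left ⟨σ.toLinearEquiv, hσ, fun p => rfl⟩)
        (Subgroup.mem_sup_right hfA')
    exact mul_mem (Subgroup.mem_sup_left (hn.conj_mem _ hσf _)) (Subgroup.mem_sup_right hl)
  · intro h
    obtain ⟨d, hd, l, hl, hdl⟩ := Subgroup.mem_sup_of_normal_left.1 h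
    obtain ⟨g, ⟨σ, hσ, hg⟩, k, hk, hgk⟩ :=
      Subgroup.mem_sup_of_normal_right.1 (hn.conj_mem d hd τ)
    have hυ : υ = g * k * τ * l := by
      rw [hgk, inv_mul_cancel_right, mul_assoc, hdl, mul_inv_cancel_left]
    refine ⟨inferInstance, ⟨σ, hσ⟩, fun p hp => ?_⟩
    let P : PrimeIndex := ⟨p, hp.out⟩
    refine ⟨_, hk P, ?_⟩
    have h1 := localization_adelicImage N υ L P
    have h2 := localization_adelicImage N τ L P
    have h3 : υ.1 P = g.1 P * k.1 P * τ.1 P * l.1 P := by rw [hυ]; rfl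
    rw [h3, act_mul, hl P, act_mul, ← h2, act_mul, hg P] at h1
    exact h1

theorem spinorGenus_subset_genus {K L : Submodule ℤ V} (hK : K ∈ genus Q L) :
    spinorGenus Q K ⊆ genus Q L := by
  rintro K' ⟨hK', σ, h⟩
  refine ⟨hK', fun p hp => ?_⟩
  obtain ⟨τ, hτ⟩ := hK.2 p
  obtain ⟨s, hs, h1⟩ := h p
  obtain ⟨f, hf, rfl⟩ := hs.exists_equiv
  have key : ∃ g ∈ orthogonalGroup (localForm p Q),
      localization p K' = act g (localization p L) := by
    refine ⟨σ.toLinearEquiv.baseChange ℚ ℚ_[p] V V * f * τ.toLinearEquiv,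
      mul_mem (mul_mem (baseChange_mem_orthogonalGroup p (toIsometryEquiv_mem Q σ))
      (spinorKernel_le _ hf)) (toIsometryEquiv_mem _ τ), ?_⟩
    rw [act_mul, act_mul, h1, hτ]
    rfl
  obtain ⟨g, hg, h3⟩ := key
  exact ⟨⟨g, hg⟩, h3⟩

theorem spinorGenus_adelicImage_eq_iff [FiniteDimensional ℚ V] (hQ : Q.PosDef) [N.IsLattice ℚ]
    {L : Submodule ℤ V} [L.IsLattice ℚ] (τ υ : adelicGroup Q N) :
    spinorGenus Q (adelicImage N τ L) = spinorGenus Q (adelicImage N υ L) ↔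
      τ⁻¹ * υ ∈ spinorStabilizer Q N L := by
  constructor
  · intro h
    rw [← adelicImage_mem_spinorGenus_iff hQ, h, adelicImage_mem_spinorGenus_iff hQ,
      inv_mul_cancel]
    exact one_mem _
  · intro h
    ext K
    by_cases hK : K ∈ genus Q L
    · obtain ⟨ω, rfl⟩ := (mem_genus_iff_exists_adelicImage N).1 hK
      rw [adelicImage_mem_spinorGenus_iff hQ, adelicImage_mem_spinorGenus_iff hQ]
      constructor
      · intro h'
        have := mul_mem (inv_mem h) h'
        rwa [mul_inv_rev, inv_inv, mul_assoc, mul_inv_cancel_left] at this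
      · intro h'
        have := mul_mem h h'
        rwa [mul_assoc, mul_inv_cancel_left] at this
    · exact ⟨fun h' => absurd (spinorGenus_subset_genus (adelicImage_mem_genus N _ L) h') hK,
        fun h' => absurd (spinorGenus_subset_genus (adelicImage_mem_genus N _ L) h') hK⟩

/-- The spinor genera in the genus of `L` are the cosets of the stabilizer of the spinor genus
of `L` in the adelic orthogonal group. -/
def spinorGeneraEquiv [FiniteDimensional ℚ V] (hQ : Q.PosDef) (N : Submodule ℤ V) [N.IsLattice ℚ]
    (L : Submodule ℤ V) [L.IsLattice ℚ] :
    adelicGroup Q N ⧸ spinorStabilizer Q N L ≃ spinorGenera Q L :=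
  Equiv.ofBijective
    (Quotient.lift (fun τ : adelicGroup Q N =>
      (⟨spinorGenus Q (adelicImage N τ L), _, adelicImage_mem_genus N τ L, rfl⟩ :
        spinorGenera Q L)) fun τ υ h =>
          Subtype.ext ((spinorGenus_adelicImage_eq_iff hQ τ υ).2
            (QuotientGroup.leftRel_apply.1 h))) <| by
    constructor
    · rintro ⟨τ⟩ ⟨υ⟩ h
      exact QuotientGroup.eq.2
        ((spinorGenus_adelicImage_eq_iff hQ τ υ).1 (congrArg Subtype.val h))
    · rintro ⟨S, K, hK, rfl⟩
      obtain ⟨τ, rfl⟩ := (mem_genus_iff_exists_adelicImage N).1 hK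
      exact ⟨QuotientGroup.mk τ, rfl⟩

theorem spinorGeneraEquiv_mk [FiniteDimensional ℚ V] (hQ : Q.PosDef) [N.IsLattice ℚ]
    (L : Submodule ℤ V) [L.IsLattice ℚ] (τ : adelicGroup Q N) :
    (spinorGeneraEquiv hQ N L (QuotientGroup.mk τ) : Set (Submodule ℤ V)) =
      spinorGenus Q (adelicImage N τ L) := rfl

theorem numSpinorGenera_eq_index [FiniteDimensional ℚ V] (hQ : Q.PosDef) [N.IsLattice ℚ]
    (L : Submodule ℤ V) [L.IsLattice ℚ] :
    numSpinorGenera Q L = (spinorStabilizer Q N L).index := by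
  rw [numSpinorGenera, ← Nat.card_coe_set_eq, ← Nat.card_congr (spinorGeneraEquiv hQ N L),
    Subgroup.index]

end Adelic

/-! ### Transport of genera along similitudes -/

section Transport

variable {V W : Type*} [AddCommGroup V] [Module ℚ V] [AddCommGroup W] [Module ℚ W]

/-- The image of a lattice under a `ℚ`-linear equivalence. -/
def mapLattice (ψ : W ≃ₗ[ℚ] V) (L : Submodule ℤ W) : Submodule ℤ V :=
  L.map (ψ.toLinearMap.restrictScalars ℤ)

theorem mem_mapLattice {ψ : W ≃ₗ[ℚ] V} {L : Submodule ℤ W} {x : V} :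
    x ∈ mapLattice ψ L ↔ ψ.symm x ∈ L := by
  refine ⟨?_, fun h => ⟨_, h, ψ.apply_symm_apply x⟩⟩
  rintro ⟨y, hy, rfl⟩
  convert! hy
  exact ψ.symm_apply_apply y

theorem mapLattice_symm_mapLattice (ψ : W ≃ₗ[ℚ] V) (L : Submodule ℤ W) :
    mapLattice ψ.symm (mapLattice ψ L) = L := by
  ext x
  rw [mem_mapLattice, mem_mapLattice, LinearEquiv.symm_symm, LinearEquiv.symm_apply_apply]

theorem mapLattice_mapLattice_symm (ψ : W ≃ₗ[ℚ] V) (L : Submodule ℤ V) :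
    mapLattice ψ (mapLattice ψ.symm L) = L :=
  mapLattice_symm_mapLattice ψ.symm L

theorem mapLattice_injective (ψ : W ≃ₗ[ℚ] V) : Function.Injective (mapLattice ψ) := fun K L h => by
  rw [← mapLattice_symm_mapLattice ψ K, h, mapLattice_symm_mapLattice]

instance (ψ : W ≃ₗ[ℚ] V) (L : Submodule ℤ W) [L.IsLattice ℚ] : (mapLattice ψ L).IsLattice ℚ :=
  isLattice_map ψ L

variable {QV : QuadraticForm ℚ V} {QW : QuadraticForm ℚ W} {c : ℚ} (ψ : W ≃ₗ[ℚ] V)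

theorem similitude_symm (hψ : ∀ x, QV (ψ x) = c * QW x) (hc : c ≠ 0) (x : V) :
    QW (ψ.symm x) = c⁻¹ * QV x := by
  have := hψ (ψ.symm x)
  rw [LinearEquiv.apply_symm_apply] at this
  rw [this, inv_mul_cancel_left₀ hc]

theorem localForm_similitude_equiv (p : ℕ) [Fact p.Prime] (hψ : ∀ x, QV (ψ x) = c * QW x)
    (y : ℚ_[p] ⊗[ℚ] W) :
    localForm p QV (ψ.baseChange ℚ ℚ_[p] W V y) = (c : ℚ_[p]) * localForm p QW y :=
  localForm_similitude p ψ.toLinearMap hψ y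

theorem localization_mapLattice (p : ℕ) [Fact p.Prime] (L : Submodule ℤ W) :
    localization p (mapLattice ψ L) = (localization p L).map
      ((ψ.baseChange ℚ ℚ_[p] W V).toLinearMap.restrictScalars ℤ_[p]) := by
  rw [mapLattice, localization_map]
  rfl

theorem mapLattice_mem_genus_of_mem (hψ : ∀ x, QV (ψ x) = c * QW x) {K L : Submodule ℤ W}
    (hK : K ∈ genus QW L) : mapLattice ψ K ∈ genus QV (mapLattice ψ L) := by
  have := hK.1
  refine ⟨inferInstance, fun p hp => ?_⟩
  obtain ⟨τ, hτ⟩ := hK.2 p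
  have key : ∃ g ∈ orthogonalGroup (localForm p QV),
      localization p (mapLattice ψ K) = act g (localization p (mapLattice ψ L)) := by
    refine ⟨_, conj_mem_orthogonalGroup (ψ.baseChange ℚ ℚ_[p] W V)
      (localForm_similitude_equiv ψ p hψ) (toIsometryEquiv_mem _ τ), ?_⟩
    rw [localization_mapLattice, localization_mapLattice, hτ, act, ← Submodule.map_comp,
      ← Submodule.map_comp]
    congr 1
    ext y
    simp only [LinearMap.comp_apply, LinearMap.restrictScalars_apply, LinearEquiv.coe_coe,
      LinearEquiv.trans_apply, LinearEquiv.symm_apply_apply]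
  obtain ⟨g, hg, h3⟩ := key
  exact ⟨⟨g, hg⟩, h3⟩

theorem mapLattice_mem_spinorGenus_of_mem (hψ : ∀ x, QV (ψ x) = c * QW x) (hc : c ≠ 0)
    {K L : Submodule ℤ W} (hK : K ∈ spinorGenus QW L) :
    mapLattice ψ K ∈ spinorGenus QV (mapLattice ψ L) := by
  obtain ⟨hK1, σ, hK2⟩ := hK
  refine ⟨inferInstance, ⟨_, conj_mem_orthogonalGroup ψ hψ (toIsometryEquiv_mem _ σ)⟩,
    fun p hp => ?_⟩
  obtain ⟨s, hs, h⟩ := hK2 p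
  refine ⟨_, hs.conj (ψ.baseChange ℚ ℚ_[p] W V) (localForm_similitude_equiv ψ p hψ)
    (by exact_mod_cast hc), ?_⟩
  rw [localization_mapLattice, localization_mapLattice, h, ← Submodule.map_comp,
      ← Submodule.map_comp, ← Submodule.map_comp, ← Submodule.map_comp]
  congr 1
  ext y
  have h1 : ∀ z : ℚ_[p] ⊗[ℚ] W,
      ((ψ.symm.trans σ.toLinearEquiv).trans ψ).toLinearMap.baseChange ℚ_[p]
        (ψ.baseChange ℚ ℚ_[p] W V z) =
      ψ.baseChange ℚ ℚ_[p] W V (σ.toLinearEquiv.toLinearMap.baseChange ℚ_[p] z) := by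
    intro z
    induction z with
    | zero => simp
    | add x y hx hy => simp only [map_add, hx, hy]
    | tmul a x => simp
  simp only [LinearMap.comp_apply, LinearMap.restrictScalars_apply, LinearEquiv.coe_coe,
    LinearEquiv.symm_apply_apply, h1]

theorem mapLattice_mem_genus_iff (hψ : ∀ x, QV (ψ x) = c * QW x) (hc : c ≠ 0)
    {K L : Submodule ℤ W} : mapLattice ψ K ∈ genus QV (mapLattice ψ L) ↔ K ∈ genus QW L := by
  refine ⟨fun h => ?_, mapLattice_mem_genus_of_mem ψ hψ⟩
  have := mapLattice_mem_genus_of_mem ψ.symm (similitude_symm ψ hψ hc) h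
  rwa [mapLattice_symm_mapLattice, mapLattice_symm_mapLattice] at this

theorem mapLattice_mem_spinorGenus_iff (hψ : ∀ x, QV (ψ x) = c * QW x) (hc : c ≠ 0)
    {K L : Submodule ℤ W} :
    mapLattice ψ K ∈ spinorGenus QV (mapLattice ψ L) ↔ K ∈ spinorGenus QW L := by
  refine ⟨fun h => ?_, mapLattice_mem_spinorGenus_of_mem ψ hψ hc⟩
  have := mapLattice_mem_spinorGenus_of_mem ψ.symm (similitude_symm ψ hψ hc) (inv_ne_zero hc) h
  rwa [mapLattice_symm_mapLattice, mapLattice_symm_mapLattice] at this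

theorem image_mapLattice_spinorGenus (hψ : ∀ x, QV (ψ x) = c * QW x) (hc : c ≠ 0)
    (L : Submodule ℤ W) :
    mapLattice ψ '' spinorGenus QW L = spinorGenus QV (mapLattice ψ L) := by
  ext K
  constructor
  · rintro ⟨K, hK, rfl⟩
    exact (mapLattice_mem_spinorGenus_iff ψ hψ hc).2 hK
  · intro hK
    rw [← mapLattice_mapLattice_symm ψ K] at hK
    exact ⟨_, (mapLattice_mem_spinorGenus_iff ψ hψ hc).1 hK, mapLattice_mapLattice_symm ψ K⟩

/-- A similitude `ψ : W → V` induces a bijection of the spinor genera in the genus of `L` with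
those in the genus of `ψ L`. -/
def spinorGeneraMapEquiv (hψ : ∀ x, QV (ψ x) = c * QW x) (hc : c ≠ 0) (L : Submodule ℤ W) :
    spinorGenera QW L ≃ spinorGenera QV (mapLattice ψ L) :=
  Equiv.ofBijective
    (fun S => ⟨mapLattice ψ '' S.1, by
      obtain ⟨K, hK, h⟩ := S.2
      exact ⟨_, mapLattice_mem_genus_of_mem ψ hψ hK, by
        rw [h, image_mapLattice_spinorGenus ψ hψ hc]⟩⟩) <| by
    constructor
    · intro S T h
      exact Subtype.ext (Set.image_injective.2 (mapLattice_injective ψ) (congrArg Subtype.val h))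
    · rintro ⟨S, K, hK, rfl⟩
      rw [← mapLattice_mapLattice_symm ψ K] at hK
      refine ⟨⟨spinorGenus QW (mapLattice ψ.symm K), _,
        (mapLattice_mem_genus_iff ψ hψ hc).1 hK, rfl⟩, Subtype.ext ?_⟩
      change mapLattice ψ '' spinorGenus QW (mapLattice ψ.symm K) = _
      rw [image_mapLattice_spinorGenus ψ hψ hc, mapLattice_mapLattice_symm]

theorem numSpinorGenera_mapLattice (hψ : ∀ x, QV (ψ x) = c * QW x) (hc : c ≠ 0)
    (L : Submodule ℤ W) : numSpinorGenera QV (mapLattice ψ L) = numSpinorGenera QW L := by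
  rw [numSpinorGenera, numSpinorGenera, ← Nat.card_coe_set_eq, ← Nat.card_coe_set_eq,
    Nat.card_congr (spinorGeneraMapEquiv ψ hψ hc L)]

/-- Scaling the form does not change the number of spinor genera. -/
theorem numSpinorGenera_smul (hc : c ≠ 0) (L : Submodule ℤ V) :
    numSpinorGenera (c • QV) L = numSpinorGenera QV L := by
  have h := numSpinorGenera_mapLattice (QV := c • QV) (QW := QV) (c := c)
    (LinearEquiv.refl ℚ V) (fun x => rfl) hc L
  rw [← h]
  congr 1
  ext x
  rw [mem_mapLattice]
  rfl

end Transport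

/-! ### Gram determinants -/

section Gram

variable {K V : Type*} [Field K] [AddCommGroup V] [Module K V] (Q : QuadraticForm K V)

/-- The Gram determinant `det (B(b_i, b_j))` of three vectors. -/
def gram (b : Fin 3 → V) : K :=
  (Matrix.of fun i j : Fin 3 => bil Q (b i) (b j)).det

theorem gram_eq (b : Fin 3 → V) (P : Matrix (Fin 3) (Fin 3) K) {b' : Fin 3 → V}
    (h : ∀ j, b' j = ∑ i, P i j • b i) : gram Q b' = P.det * P.det * gram Q b := by
  have key : (Matrix.of fun i j : Fin 3 => bil Q (b' i) (b' j)) =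
      P.transpose * (Matrix.of fun i j : Fin 3 => bil Q (b i) (b j)) * P := by
    have hb : ∀ x y, bil Q x y = (QuadraticMap.polarBilin Q x y) / 2 := fun _ _ => rfl
    ext i j
    simp only [Matrix.of_apply, Matrix.mul_apply, Matrix.transpose_apply, hb, h,
      Fin.sum_univ_three]
    simp only [map_add, map_smul, LinearMap.add_apply, LinearMap.smul_apply, smul_eq_mul]
    ring
  rw [gram, key, Matrix.det_mul, Matrix.det_mul, Matrix.det_transpose, gram]
  ring

theorem gram_comp_of_mem {f : V ≃ₗ[K] V} (hf : f ∈ orthogonalGroup Q) (b : Fin 3 → V) :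
    gram Q (fun i => f (b i)) = gram Q b := by
  simp only [gram, bil, polar_map_of_mem Q hf]

theorem four_mul_gram (h2 : (2 : K) ≠ 0) (b : Fin 3 → V) :
    4 * gram Q b = 4 * Q (b 0) * Q (b 1) * Q (b 2)
      + QuadraticMap.polar Q (b 1) (b 2) * QuadraticMap.polar Q (b 0) (b 2)
        * QuadraticMap.polar Q (b 0) (b 1)
      - Q (b 0) * QuadraticMap.polar Q (b 1) (b 2) ^ 2
      - Q (b 1) * QuadraticMap.polar Q (b 0) (b 2) ^ 2
      - Q (b 2) * QuadraticMap.polar Q (b 0) (b 1) ^ 2 := by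
  rw [gram, Matrix.det_fin_three]
  simp only [Matrix.of_apply, bil, polar_self_eq]
  rw [QuadraticMap.polar_comm Q (b 1) (b 0), QuadraticMap.polar_comm Q (b 2) (b 0),
    QuadraticMap.polar_comm Q (b 2) (b 1)]
  field_simp
  ring

end Gram

section LocalGram

variable {p : ℕ} [Fact p.Prime] {V : Type*} [AddCommGroup V] [Module ℚ V]
  {E : Type*} [AddCommGroup E] [Module ℚ_[p] E] [Module ℤ_[p] E] [IsScalarTower ℤ_[p] ℚ_[p] E]

theorem norm_gram_le (Q : QuadraticForm ℚ_[p] E) {b b' : Fin 3 → E}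
    (h : Submodule.span ℤ_[p] (Set.range b') ≤ Submodule.span ℤ_[p] (Set.range b)) :
    ‖gram Q b'‖ ≤ ‖gram Q b‖ := by
  have h1 : ∀ j, ∃ c : Fin 3 → ℤ_[p], ∑ i, c i • b i = b' j := fun j =>
    (Submodule.mem_span_range_iff_exists_fun _).1 (h (Submodule.subset_span ⟨j, rfl⟩))
  choose c hc using h1
  let P : Matrix (Fin 3) (Fin 3) ℤ_[p] := fun i j => c j i
  rw [gram_eq Q b (P.map (algebraMap ℤ_[p] ℚ_[p])) fun j => by
    rw [← hc j]
    exact Finset.sum_congr rfl fun i _ => (algebraMap_smul ℚ_[p] (c j i) (b i)).symm]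
  have h2 : (P.map (algebraMap ℤ_[p] ℚ_[p])).det = (P.det : ℚ_[p]) :=
    (RingHom.map_det (algebraMap ℤ_[p] ℚ_[p]) P).symm
  rw [h2, norm_mul, norm_mul]
  have h3 : ‖(P.det : ℚ_[p])‖ ≤ 1 := P.det.2
  have h4 : ‖(P.det : ℚ_[p])‖ * ‖(P.det : ℚ_[p])‖ ≤ 1 := mul_le_one₀ h3 (norm_nonneg _) h3
  exact mul_le_of_le_one_left (norm_nonneg _) h4

/-- The Gram determinant of a local lattice is well defined up to the square of a unit. -/
theorem norm_gram_eq (Q : QuadraticForm ℚ_[p] E) {b b' : Fin 3 → E}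
    (h : Submodule.span ℤ_[p] (Set.range b') = Submodule.span ℤ_[p] (Set.range b)) :
    ‖gram Q b'‖ = ‖gram Q b‖ :=
  le_antisymm (norm_gram_le Q h.le) (norm_gram_le Q h.ge)

theorem gram_localForm (Q : QuadraticForm ℚ V) (b : Fin 3 → V) :
    gram (localForm p Q) (fun i => (1 : ℚ_[p]) ⊗ₜ[ℚ] b i) = (gram Q b : ℚ) := by
  have h : gram Q b = (Matrix.of fun i j : Fin 3 => bil Q (b i) (b j)).det := rfl
  rw [h, ← eq_ratCast (algebraMap ℚ ℚ_[p]), RingHom.map_det, gram]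
  congr 1
  ext i j
  simp only [bil, polar_localForm_one_tmul, Matrix.of_apply, RingHom.mapMatrix_apply,
    Matrix.map_apply, eq_ratCast]
  push_cast
  rfl

/-- A bound for the values of a form on a lattice holds on the localization as well. -/
theorem norm_localForm_le (Q : QuadraticForm ℚ V) {L : Submodule ℤ V} {ε : ℝ}
    (h : ∀ x ∈ L, ‖(Q x : ℚ_[p])‖ ≤ ε) {y : ℚ_[p] ⊗[ℚ] V} (hy : y ∈ localization p L) :
    ‖localForm p Q y‖ ≤ ε := by
  have hε : 0 ≤ ε := (norm_nonneg _).trans (h 0 (zero_mem _))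
  have hadd : ∀ {a b : ℚ_[p]}, ‖a‖ ≤ ε → ‖b‖ ≤ ε → ‖a + b‖ ≤ ε := fun ha hb =>
    (Padic.nonarchimedean _ _).trans (max_le ha hb)
  have hsmul : ∀ (c : ℤ_[p]) {a : ℚ_[p]}, ‖a‖ ≤ ε → ‖(c : ℚ_[p]) * a‖ ≤ ε := fun c a ha => by
    rw [norm_mul]
    exact (mul_le_of_le_one_left (norm_nonneg _) c.2).trans ha
  have hcast : ∀ (c : ℤ_[p]) (z : ℚ_[p] ⊗[ℚ] V), c • z = (c : ℚ_[p]) • z := fun c z =>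
    (algebraMap_smul ℚ_[p] c z).symm
  have hpolar : ∀ x ∈ L, ∀ x' ∈ L, ‖((QuadraticMap.polar Q x x' : ℚ) : ℚ_[p])‖ ≤ ε := by
    intro x hx x' hx'
    rw [QuadraticMap.polar]
    push_cast
    rw [sub_eq_add_neg, sub_eq_add_neg]
    exact hadd (hadd (h _ (add_mem hx hx')) (by rw [norm_neg]; exact h x hx))
      (by rw [norm_neg]; exact h x' hx')
  have hpolar1 : ∀ x ∈ L, ∀ z ∈ localization p L,
      ‖QuadraticMap.polar (localForm p Q) ((1 : ℚ_[p]) ⊗ₜ[ℚ] x) z‖ ≤ ε := by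
    intro x hx z hz
    induction hz using Submodule.span_induction with
    | mem z hz =>
      obtain ⟨x', hx', rfl⟩ := hz
      rw [polar_localForm_one_tmul]
      exact hpolar x hx x' hx'
    | zero => rw [QuadraticMap.polar_zero_right, norm_zero]; exact hε
    | add z z' _ _ hz hz' => rw [QuadraticMap.polar_add_right]; exact hadd hz hz'
    | smul c z _ hz => rw [hcast, QuadraticMap.polar_smul_right]; exact hsmul c hz
  have hpolar2 : ∀ z ∈ localization p L, ∀ w ∈ localization p L,
      ‖QuadraticMap.polar (localForm p Q) z w‖ ≤ ε := by
    intro z hz w hw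
    induction hz using Submodule.span_induction with
    | mem z hz =>
      obtain ⟨x', hx', rfl⟩ := hz
      exact hpolar1 x' hx' w hw
    | zero => rw [QuadraticMap.polar_zero_left, norm_zero]; exact hε
    | add z z' _ _ hz hz' => rw [QuadraticMap.polar_add_left]; exact hadd hz hz'
    | smul c z _ hz => rw [hcast, QuadraticMap.polar_smul_left]; exact hsmul c hz
  induction hy using Submodule.span_induction with
  | mem z hz =>
    obtain ⟨x, hx, rfl⟩ := hz
    rw [localForm_one_tmul]
    exact h x hx
  | zero => rw [QuadraticMap.map_zero, norm_zero]; exact hε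
  | add z z' hz hz' h1 h2 =>
    rw [QuadraticMap.map_add (localForm p Q)]
    exact hadd (hadd h1 h2) (hpolar2 z hz z' hz')
  | smul c z _ hz =>
    rw [hcast, QuadraticMap.map_smul, smul_eq_mul, mul_assoc]
    exact hsmul c (hsmul c hz)

end LocalGram

/-! ### Finiteness of the number of spinor genera -/

section Finiteness

variable {V : Type*} [AddCommGroup V] [Module ℚ V] {Q : QuadraticForm ℚ V}

theorem exists_int_basis (h3 : Module.finrank ℚ V = 3) (L : Submodule ℤ V) [L.IsLattice ℚ] :
    Nonempty (Module.Basis (Fin 3) ℤ L) := by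
  have h : Module.finrank ℤ L = 3 := by
    rw [← h3, Module.finrank, Module.finrank, Submodule.IsLattice.rank' ℚ L]
  exact ⟨Module.finBasisOfFinrankEq ℤ L h⟩

theorem span_range_coe_basis {V : Type*} [AddCommGroup V] {L : Submodule ℤ V}
    (b : Module.Basis (Fin 3) ℤ L) :
    Submodule.span ℤ (Set.range fun i => (b i : V)) = L := by
  have h : (fun i => (b i : V)) = L.subtype ∘ b := rfl
  rw [h, Set.range_comp, ← Submodule.map_span, b.span_eq, Submodule.map_top,
    Submodule.range_subtype]

theorem localization_eq_span {L : Submodule ℤ V} (p : ℕ) [Fact p.Prime]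
    (b : Module.Basis (Fin 3) ℤ L) : localization p L =
      Submodule.span ℤ_[p] (Set.range fun i => (1 : ℚ_[p]) ⊗ₜ[ℚ] (b i : V)) := by
  conv_lhs => rw [← span_range_coe_basis b]
  rw [localization_span_range]

theorem norm_disc_eq_of_mem_genus (h3 : Module.finrank ℚ V = 3) {K L : Submodule ℤ V}
    [L.IsLattice ℚ] (hK : K ∈ genus Q L) (p : ℕ) [Fact p.Prime] :
    ‖(disc Q K : ℚ_[p])‖ = ‖(disc Q L : ℚ_[p])‖ := by
  have := hK.1
  obtain ⟨b⟩ := exists_int_basis h3 K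
  obtain ⟨b'⟩ := exists_int_basis h3 L
  obtain ⟨τ, hτ⟩ := hK.2 p
  have hb := disc_eq Q K b
  have hb' := disc_eq Q L b'
  rw [← gram] at hb hb'
  rw [hb, hb', ← gram_localForm, ← gram_localForm,
    ← gram_comp_of_mem _ (toIsometryEquiv_mem _ τ) fun i => (1 : ℚ_[p]) ⊗ₜ[ℚ] (b' i : V)]
  refine norm_gram_eq _ ?_
  rw [← localization_eq_span, hτ, localization_eq_span p b', Submodule.map_span, ← Set.range_comp]
  rfl

/-- The reduction inequality in the ordered case `a ≤ b ≤ c`, for the sign under which it is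
hardest: the left side collects the terms that are subtracted from `4abc`. -/
theorem ternary_reduction_aux {a b c r s t : ℚ} (hr : 0 ≤ r) (hs : 0 ≤ s)
    (ht : 0 ≤ t) (hab : a ≤ b) (hbc : b ≤ c) (hrb : r ≤ b) (hsa : s ≤ a) (hta : t ≤ a)
    (h : r + s + t ≤ a + b) :
    r * s * t + a * r ^ 2 + b * s ^ 2 + c * t ^ 2 ≤ 3 * a * b * c := by
  have ha : 0 ≤ a := ht.trans hta
  have hb : 0 ≤ b := ha.trans hab
  have h1 : t ^ 2 ≤ a * b := by nlinarith
  have h2 : (c - b) * t ^ 2 ≤ (c - b) * (3 * a * b) := by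
    refine mul_le_mul_of_nonneg_left ?_ (sub_nonneg.2 hbc)
    nlinarith [mul_nonneg ha hb]
  have h3 : a * r ^ 2 ≤ a * b * r := by
    have := mul_le_mul_of_nonneg_left hrb (mul_nonneg ha hr)
    linarith
  have h4 : b * s ^ 2 ≤ a * b * s := by
    have := mul_le_mul_of_nonneg_left hsa (mul_nonneg hb hs)
    linarith
  have h5 : b * t ^ 2 ≤ a * b * t := by
    have := mul_le_mul_of_nonneg_left hta (mul_nonneg hb ht)
    linarith
  have h6 : r * s * t ≤ a * b * b := by
    have h7 : r * s ≤ b * a := mul_le_mul hrb hsa hs hb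
    have h8 : r * s * t ≤ b * a * b := mul_le_mul h7 (hta.trans hab) ht (mul_nonneg hb ha)
    linarith
  have h9 : a * b * (r + s + t) ≤ a * b * (b + b) :=
    mul_le_mul_of_nonneg_left (by linarith) (mul_nonneg ha hb)
  linarith

/-- The reduction inequality for a ternary form with Gram matrix entries `a, b, c` and
`r/2, s/2, t/2`. -/
theorem ternary_reduction {a b c r s t : ℚ}
    (hrb : |r| ≤ b) (hrc : |r| ≤ c) (hsa : |s| ≤ a) (hsc : |s| ≤ c) (hta : |t| ≤ a) (htb : |t| ≤ b)
    (h : r * s * t < 0 → |r| + |s| + |t| ≤ a + b ∧ |r| + |s| + |t| ≤ b + c ∧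
      |r| + |s| + |t| ≤ a + c) :
    a * b * c ≤ 4 * a * b * c + r * s * t - a * r ^ 2 - b * s ^ 2 - c * t ^ 2 := by
  have ha : 0 ≤ a := (abs_nonneg _).trans hsa
  have hb : 0 ≤ b := (abs_nonneg _).trans hrb
  have hc : 0 ≤ c := (abs_nonneg _).trans hrc
  rw [← sq_abs r, ← sq_abs s, ← sq_abs t]
  rcases lt_or_ge (r * s * t) 0 with h0 | h0
  · obtain ⟨h1, h2, h3⟩ := h h0
    have h4 : r * s * t = -(|r| * |s| * |t|) := by
      rw [← abs_mul, ← abs_mul, abs_of_neg h0, neg_neg]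
    rw [h4]
    have hr := abs_nonneg r
    have hs := abs_nonneg s
    have ht := abs_nonneg t
    generalize |r| = r at *
    generalize |s| = s at *
    generalize |t| = t at *
    have key : r * s * t + a * r ^ 2 + b * s ^ 2 + c * t ^ 2 ≤ 3 * a * b * c := by
      rcases le_total a b with hab | hab <;> rcases le_total b c with hbc | hbc <;>
        rcases le_total a c with hac | hac
      · linarith [ternary_reduction_aux hr hs ht hab hbc hrb hsa hta (by linarith)]
      · linarith [ternary_reduction_aux hr hs ht hab hbc hrb hsa hta (by linarith)]
      · linarith [ternary_reduction_aux hr ht hs hac hbc hrc hta hsa (by linarith)]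
      · linarith [ternary_reduction_aux ht hr hs hac hab hta hrc hsc (by linarith)]
      · linarith [ternary_reduction_aux hs hr ht hab hac hsa hrb htb (by linarith)]
      · linarith [ternary_reduction_aux hs ht hr hbc hac hsc htb hrb (by linarith)]
      · linarith [ternary_reduction_aux ht hs hr hbc hab htb hsc hrc (by linarith)]
      · linarith [ternary_reduction_aux ht hs hr hbc hab htb hsc hrc (by linarith)]
    linarith
  · have h1 : a * |r| ^ 2 ≤ a * b * c := by
      have := mul_le_mul hrb hrc (abs_nonneg _) hb
      nlinarith
    have h2 : b * |s| ^ 2 ≤ a * b * c := by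
      have := mul_le_mul hsa hsc (abs_nonneg _) ha
      nlinarith
    have h3 : c * |t| ^ 2 ≤ a * b * c := by
      have := mul_le_mul hta htb (abs_nonneg _) ha
      nlinarith
    linarith

theorem abs_add_abs_add_abs_le {r s t m : ℚ} (h1 : 0 ≤ m + t + s + r) (h2 : 0 ≤ m + t - s - r)
    (h3 : 0 ≤ m - t + s - r) (h4 : 0 ≤ m - t - s + r) (h : r * s * t < 0) :
    |r| + |s| + |t| ≤ m := by
  rcases le_total 0 r with hr | hr <;> rcases le_total 0 s with hs | hs <;>
    rcases le_total 0 t with ht | ht <;>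
    simp only [abs_of_nonneg, abs_of_nonpos, hr, hs, ht] <;>
    first
    | linarith
    | exact absurd h (not_lt.2 (mul_nonneg (mul_nonneg hr hs) ht))
    | exact absurd h (not_lt.2 (mul_nonneg (mul_nonneg_of_nonpos_of_nonpos hr hs) ht))
    | exact absurd h (not_lt.2 (mul_nonneg_of_nonpos_of_nonpos
        (mul_nonpos_of_nonneg_of_nonpos hr hs) ht))
    | exact absurd h (not_lt.2 (mul_nonneg_of_nonpos_of_nonpos
        (mul_nonpos_of_nonpos_of_nonneg hr hs) ht))

/-- A basis of minimal trace is Minkowski reduced enough to bound its Gram matrix in terms of the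
discriminant. -/
theorem exists_reduced_basis (hQ : Q.PosDef) (h3 : Module.finrank ℚ V = 3) (K : Submodule ℤ V)
    [K.IsLattice ℚ] (hK : ∀ x ∈ K, ∃ k : ℤ, Q x = k) :
    ∃ b : Module.Basis (Fin 3) ℤ K,
      Q (b 0 : V) * Q (b 1 : V) * Q (b 2 : V) ≤ 4 * gram Q (fun i => (b i : V)) ∧
      ∀ i j, i ≠ j → |QuadraticMap.polar Q (b i : V) (b j : V)| ≤ Q (b i : V) := by
  have : Nonempty (Module.Basis (Fin 3) ℤ K) := exists_int_basis h3 K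
  have hnat : ∀ x : K, ∃ k : ℕ, Q (x : V) = k := by
    intro x
    obtain ⟨k, hk⟩ := hK x x.2
    have h0 : 0 ≤ Q (x : V) := hQ.nonneg _
    rw [hk] at h0
    obtain ⟨m, rfl⟩ := Int.eq_ofNat_of_zero_le (by exact_mod_cast h0 : 0 ≤ k)
    exact ⟨m, by rw [hk]; simp⟩
  choose k hk using hnat
  let f : Module.Basis (Fin 3) ℤ K → ℕ := fun b => ∑ i, k (b i)
  obtain ⟨b, hb⟩ : ∃ b, ∀ b', f b ≤ f b' := ⟨Function.argmin f, fun b' => Function.argmin_le f b'⟩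
  -- replacing `b j` by `b j + v`, with `v` in the span of the others, does not lower the trace
  have hmin : ∀ (j : Fin 3) (v : K), b.coord j v = 0 → Q (b j : V) ≤ Q ((b j : V) + v) := by
    intro j v hv
    have h1 : ((f b : ℕ) : ℚ) ≤ f (b.map (LinearEquiv.transvection hv)) := by
      exact_mod_cast hb _
    have h2 : ∀ i, ((b.map (LinearEquiv.transvection hv) i : K) : V) =
        (b i : V) + (if i = j then (v : V) else 0) := by
      intro i
      rw [Module.Basis.map_apply, LinearEquiv.transvection.apply, Module.Basis.coord_apply,
        Module.Basis.repr_self, Finsupp.single_apply]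
      split_ifs <;> simp
    simp only [f, Nat.cast_sum, ← hk, h2] at h1
    rw [← Finset.add_sum_erase _ _ (Finset.mem_univ j),
      ← Finset.add_sum_erase _ _ (Finset.mem_univ j)] at h1
    have h4 : ∑ i ∈ Finset.univ.erase j, Q ((b i : V) + (if i = j then (v : V) else 0)) =
        ∑ i ∈ Finset.univ.erase j, Q (b i : V) :=
      Finset.sum_congr rfl fun i hi => by rw [if_neg (Finset.ne_of_mem_erase hi), add_zero]
    rw [h4, if_pos rfl] at h1
    exact le_of_add_le_add_right h1
  have hcoord : ∀ i j, i ≠ j → b.coord j (b i) = 0 := fun i j hij => by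
    rw [Module.Basis.coord_apply, Module.Basis.repr_self, Finsupp.single_eq_of_ne hij.symm]
  have htwo : ∀ i j, i ≠ j → |QuadraticMap.polar Q (b i : V) (b j : V)| ≤ Q (b i : V) := by
    intro i j hij
    have h1 := hmin j (b i) (hcoord i j hij)
    have h2 := hmin j (-b i) (by rw [map_neg, hcoord i j hij, neg_zero])
    rw [QuadraticMap.map_add Q, QuadraticMap.polar_comm] at h1
    rw [QuadraticMap.map_add Q, QuadraticMap.polar_comm, NegMemClass.coe_neg, QuadraticMap.map_neg,
      QuadraticMap.polar_neg_left] at h2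
    exact abs_le.2 ⟨by linarith, by linarith⟩
  have hthree : ∀ i j l, i ≠ j → l ≠ j → ∀ e e' : ℤ, e * e = 1 → e' * e' = 1 →
      0 ≤ Q (b i : V) + Q (b l : V) + (e * e') * QuadraticMap.polar Q (b i : V) (b l : V)
        + e * QuadraticMap.polar Q (b i : V) (b j : V)
        + e' * QuadraticMap.polar Q (b l : V) (b j : V) := by
    intro i j l hij hlj e e' he he'
    have h1 := hmin j (e • b i + e' • b l) (by
      rw [map_add, map_smul, map_smul, hcoord i j hij, hcoord l j hlj, smul_zero, smul_zero,
        add_zero])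
    have he2 : (e : ℚ) * e = 1 := by exact_mod_cast he
    have he2' : (e' : ℚ) * e' = 1 := by exact_mod_cast he'
    rw [Submodule.coe_add, Submodule.coe_smul, Submodule.coe_smul, QuadraticMap.map_add Q,
      QuadraticMap.map_add Q, ← Int.cast_smul_eq_zsmul ℚ, ← Int.cast_smul_eq_zsmul ℚ,
      QuadraticMap.map_smul, QuadraticMap.map_smul, he2, he2', one_smul, one_smul,
      QuadraticMap.polar_smul_left, QuadraticMap.polar_smul_right, QuadraticMap.polar_add_right,
      QuadraticMap.polar_smul_right, QuadraticMap.polar_smul_right,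
      QuadraticMap.polar_comm Q (b j : V), QuadraticMap.polar_comm Q (b j : V)] at h1
    simp only [smul_eq_mul] at h1
    linarith
  refine ⟨b, ?_, htwo⟩
  rw [four_mul_gram Q two_ne_zero]
  have hsymm : ∀ i j, i ≠ j → |QuadraticMap.polar Q (b j : V) (b i : V)| ≤ Q (b i : V) :=
    fun i j hij => by rw [QuadraticMap.polar_comm]; exact htwo i j hij
  refine ternary_reduction (htwo 1 2 (by decide)) (hsymm 2 1 (by decide)) (htwo 0 2 (by decide))
    (hsymm 2 0 (by decide)) (htwo 0 1 (by decide)) (hsymm 1 0 (by decide)) fun hneg => ⟨?_, ?_, ?_⟩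
  · have h := hthree 0 2 1 (by decide) (by decide)
    have e1 := h 1 1 rfl rfl
    have e2 := h 1 (-1) rfl rfl
    have e3 := h (-1) 1 rfl rfl
    have e4 := h (-1) (-1) rfl rfl
    push_cast at e1 e2 e3 e4
    exact abs_add_abs_add_abs_le (by linarith) (by linarith) (by linarith) (by linarith) hneg
  · have h := hthree 1 0 2 (by decide) (by decide)
    rw [QuadraticMap.polar_comm Q (b 1 : V) (b 0 : V),
      QuadraticMap.polar_comm Q (b 2 : V) (b 0 : V)] at h
    have e1 := h 1 1 rfl rfl
    have e2 := h 1 (-1) rfl rfl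
    have e3 := h (-1) 1 rfl rfl
    have e4 := h (-1) (-1) rfl rfl
    push_cast at e1 e2 e3 e4
    exact abs_add_abs_add_abs_le (by linarith) (by linarith) (by linarith) (by linarith) hneg
  · have h := hthree 0 1 2 (by decide) (by decide)
    rw [QuadraticMap.polar_comm Q (b 2 : V) (b 1 : V)] at h
    have e1 := h 1 1 rfl rfl
    have e2 := h 1 (-1) rfl rfl
    have e3 := h (-1) 1 rfl rfl
    have e4 := h (-1) (-1) rfl rfl
    push_cast at e1 e2 e3 e4
    exact abs_add_abs_add_abs_le (by linarith) (by linarith) (by linarith) (by linarith) hneg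

theorem disc_pos (hQ : Q.PosDef) (h3 : Module.finrank ℚ V = 3) (K : Submodule ℤ V)
    [K.IsLattice ℚ] (hK : ∀ x ∈ K, ∃ k : ℤ, Q x = k) : 0 < disc Q K := by
  obtain ⟨b, hb, -⟩ := exists_reduced_basis hQ h3 K hK
  rw [disc_eq Q K b, ← gram]
  have h : ∀ i, 0 < Q (b i : V) := fun i => hQ _ fun h => b.ne_zero i (Subtype.ext h)
  have := mul_pos (mul_pos (h 0) (h 1)) (h 2)
  linarith

theorem integral_of_mem_genus {K L : Submodule ℤ V}
    (hL : ∀ x ∈ L, ∃ k : ℤ, Q x = k) (hK : K ∈ genus Q L) : ∀ x ∈ K, ∃ k : ℤ, Q x = k := by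
  intro x hx
  refine rat_isInt_of_forall_norm_le_one fun p => ?_
  obtain ⟨τ, hτ⟩ := hK.2 p
  have h := tmul_mem_localization p hx
  rw [hτ] at h
  obtain ⟨y, hy, hyx⟩ := h
  rw [← localForm_one_tmul, ← hyx]
  have h1 : localForm p Q (τ y) = localForm p Q y := τ.map_app y
  refine (congrArg norm h1).trans_le (norm_localForm_le Q (fun z hz => ?_) hy)
  obtain ⟨k, hk⟩ := hL z hz
  rw [hk]
  exact_mod_cast Padic.norm_int_le_one k

theorem rat_eq_one_of_forall_norm_eq_one {q : ℚ} (h0 : 0 < q)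
    (h : ∀ p : PrimeIndex, ‖(q : ℚ_[p])‖ = 1) : q = 1 := by
  obtain ⟨k, hk⟩ := rat_isInt_of_forall_norm_le_one fun p => (h p).le
  obtain ⟨m, hm⟩ := rat_isInt_of_forall_norm_le_one (q := q⁻¹) fun p => by
    rw [Rat.cast_inv, norm_inv, h, inv_one]
  have hk0 : 0 < k := by rw [hk] at h0; exact_mod_cast h0
  have hkm : k * m = 1 := by
    have : (k : ℚ) * m = 1 := by rw [← hk, ← hm, mul_inv_cancel₀ h0.ne']
    exact_mod_cast this
  rw [hk, Int.eq_one_of_mul_eq_one_right hk0.le hkm, Int.cast_one]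

/-- The discriminants of lattices in a genus agree up to a unit at every prime, and they are
positive. -/
theorem disc_eq_of_mem_genus (hQ : Q.PosDef) (h3 : Module.finrank ℚ V = 3) {K L : Submodule ℤ V}
    [L.IsLattice ℚ] (hL : ∀ x ∈ L, ∃ k : ℤ, Q x = k) (hK : K ∈ genus Q L) :
    disc Q K = disc Q L := by
  have := hK.1
  have h1 := disc_pos hQ h3 L hL
  have h2 := disc_pos hQ h3 K (integral_of_mem_genus hL hK)
  rw [← div_eq_one_iff_eq h1.ne']
  refine rat_eq_one_of_forall_norm_eq_one (div_pos h2 h1) fun p => ?_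
  rw [Rat.cast_div, norm_div, norm_disc_eq_of_mem_genus h3 hK p, div_self]
  rw [norm_ne_zero_iff]
  exact_mod_cast h1.ne'

/-- Lattices with the same Gram matrix are isometric. -/
theorem exists_isometry_of_polar_eq (b b' : Module.Basis (Fin 3) ℚ V)
    (h : ∀ i j, QuadraticMap.polar Q (b i) (b j) = QuadraticMap.polar Q (b' i) (b' j)) :
    ∃ σ ∈ orthogonalGroup Q, ∀ i, σ (b i) = b' i := by
  refine ⟨b.equiv b' (Equiv.refl _), fun x => ?_, fun i => by simp⟩
  set σ := b.equiv b' (Equiv.refl _)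
  have h1 : (QuadraticMap.polarBilin Q).compl₁₂ σ.toLinearMap σ.toLinearMap =
      QuadraticMap.polarBilin Q := by
    refine b.ext fun i => b.ext fun j => ?_
    simp only [LinearMap.compl₁₂_apply, LinearEquiv.coe_coe, QuadraticMap.polarBilin_apply_apply,
      h, σ, Module.Basis.equiv_apply, Equiv.refl_apply]
  have h2 := LinearMap.congr_fun (LinearMap.congr_fun h1 x) x
  simp only [LinearMap.compl₁₂_apply, LinearEquiv.coe_coe, QuadraticMap.polarBilin_apply_apply,
    polar_self_eq] at h2
  exact mul_left_cancel₀ two_ne_zero h2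

/-- Isometric lattices lie in the same spinor genus. -/
theorem spinorGenus_mapLattice [FiniteDimensional ℚ V] (hQ : Q.PosDef) {σ : V ≃ₗ[ℚ] V}
    (hσ : σ ∈ orthogonalGroup Q) (K : Submodule ℤ V) [K.IsLattice ℚ] :
    spinorGenus Q (mapLattice σ K) = spinorGenus Q K := by
  have hK : K ∈ genus Q K :=
    (mem_genus_iff_exists_adelicImage K).2 ⟨1, eq_adelicImage fun p => act_one.symm⟩
  have hσK : mapLattice σ K ∈ spinorGenus Q K := by
    refine ⟨inferInstance, ⟨σ, hσ⟩, fun p hp => ⟨1, one_mem (spinorKernel _), ?_⟩⟩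
    have : (localization p K).map ((1 : Module.End ℚ_[p] (ℚ_[p] ⊗[ℚ] V)).restrictScalars ℤ_[p]) =
      localization p K := Submodule.map_id _
    rw [this, localization_mapLattice]
    rfl
  obtain ⟨τ, hτ⟩ := (mem_genus_iff_exists_adelicImage K).1 hK
  obtain ⟨υ, hυ⟩ := (mem_genus_iff_exists_adelicImage K).1 (spinorGenus_subset_genus hK hσK)
  rw [hυ] at hσK ⊢
  have h1 : spinorGenus Q K = spinorGenus Q (adelicImage K τ K) := congrArg _ hτ
  rw [h1] at hσK ⊢
  exact ((spinorGenus_adelicImage_eq_iff hQ τ υ).2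
    ((adelicImage_mem_spinorGenus_iff hQ τ υ).1 hσK)).symm

/-- The genus of an integral lattice contains finitely many spinor genera, because it contains
finitely many classes. -/
theorem finite_spinorGenera (hQ : Q.PosDef) (h3 : Module.finrank ℚ V = 3) (L : Submodule ℤ V)
    [L.IsLattice ℚ] (hL : ∀ x ∈ L, ∃ k : ℤ, Q x = k) : Finite (spinorGenera Q L) := by
  have : FiniteDimensional ℚ V := Module.finite_of_finrank_pos (by omega)
  obtain ⟨D, hD⟩ := exists_nat_ge (4 * disc Q L)
  -- every lattice in the genus has a basis whose Gram matrix lies in a fixed finite set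
  have key : ∀ S : spinorGenera Q L, ∃ (t : Fin 3 → Fin 3 → Finset.Icc (-(2 * D : ℤ)) (2 * D))
      (b : Module.Basis (Fin 3) ℚ V),
      S.1 = spinorGenus Q (Submodule.span ℤ (Set.range b)) ∧
      (Submodule.span ℤ (Set.range b)).IsLattice ℚ ∧
      ∀ i j, QuadraticMap.polar Q (b i) (b j) = (t i j : ℤ) := by
    rintro ⟨S, K, hK, rfl⟩
    have := hK.1
    have hKi := integral_of_mem_genus hL hK
    obtain ⟨b, hb, hbo⟩ := exists_reduced_basis hQ h3 K hKi
    have hdisc : 4 * gram Q (fun i => (b i : V)) ≤ D := by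
      have := disc_eq Q K b
      rw [← gram, disc_eq_of_mem_genus hQ h3 hL hK] at this
      rwa [← this]
    have hone : ∀ i, 1 ≤ Q (b i : V) := by
      intro i
      have h0 : 0 < Q (b i : V) := hQ _ fun h => b.ne_zero i (Subtype.ext h)
      obtain ⟨k, hk⟩ := hKi _ (b i).2
      rw [hk] at h0 ⊢
      have : 0 < k := by exact_mod_cast h0
      exact_mod_cast this
    have hle : ∀ i, Q (b i : V) ≤ D := by
      have h0 := hone 0
      have h1 := hone 1
      have h2 := hone 2
      have h01 := one_le_mul_of_one_le_of_one_le h0 h1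
      intro i
      refine le_trans ?_ (hb.trans hdisc)
      have hn0 : 0 ≤ Q (b 0 : V) := by linarith
      have hn1 : 0 ≤ Q (b 1 : V) := by linarith
      have hn2 : 0 ≤ Q (b 2 : V) := by linarith
      fin_cases i
      · exact (le_mul_of_one_le_right hn0 h1).trans (le_mul_of_one_le_right (by positivity) h2)
      · exact (le_mul_of_one_le_left hn1 h0).trans (le_mul_of_one_le_right (by positivity) h2)
      · exact le_mul_of_one_le_left hn2 h01
    have hpolar : ∀ i j, ∃ k : Finset.Icc (-(2 * D : ℤ)) (2 * D),
        QuadraticMap.polar Q (b i : V) (b j : V) = (k : ℤ) := by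
      intro i j
      obtain ⟨k1, hk1⟩ := hKi _ (b i + b j).2
      obtain ⟨k2, hk2⟩ := hKi _ (b i).2
      obtain ⟨k3, hk3⟩ := hKi _ (b j).2
      have h1 : QuadraticMap.polar Q (b i : V) (b j : V) = ((k1 - k2 - k3 : ℤ) : ℚ) := by
        rw [QuadraticMap.polar, hk2, hk3]
        push_cast
        rw [← hk1]
        rfl
      have h2 : |QuadraticMap.polar Q (b i : V) (b j : V)| ≤ 2 * D := by
        by_cases hij : i = j
        · rw [hij, polar_self_eq, abs_of_nonneg (by have := hone j; linarith)]
          have := hle j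
          linarith
        · have := (hbo i j hij).trans (hle i)
          have hD0 : (0 : ℚ) ≤ D := Nat.cast_nonneg D
          linarith
      rw [h1] at h2 ⊢
      have h4 : |k1 - k2 - k3| ≤ 2 * D := by exact_mod_cast h2
      exact ⟨⟨k1 - k2 - k3, Finset.mem_Icc.2 (abs_le.1 h4)⟩, rfl⟩
    choose t ht using hpolar
    have hspan : Submodule.span ℤ (Set.range (b.extendOfIsLattice ℚ)) = K := by
      conv_rhs => rw [← span_range_coe_basis b]
      congr 2
      ext i
      simp
    refine ⟨t, b.extendOfIsLattice ℚ, by rw [hspan], by rw [hspan]; infer_instance,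
      fun i j => ?_⟩
    simp only [Module.Basis.extendOfIsLattice_apply]
    exact ht i j
  -- lattices with equal Gram matrices are isometric, so the matrix determines the spinor genus
  choose t b hS hlat ht using key
  refine Finite.of_injective t fun S T hST => Subtype.ext ?_
  obtain ⟨σ, hσ, hσb⟩ := exists_isometry_of_polar_eq (Q := Q) (b S) (b T) fun i j => by
    rw [ht, ht, hST]
  have h1 : mapLattice σ (Submodule.span ℤ (Set.range (b S))) =
      Submodule.span ℤ (Set.range (b T)) := by
    rw [mapLattice, Submodule.map_span, ← Set.range_comp]
    congr 2
    ext i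
    exact hσb i
  have := hlat S
  rw [hS S, hS T, ← h1, spinorGenus_mapLattice hQ hσ]

end Finiteness

/-! ### Ternary `ℤ_p`-lattices and their sublattices of index `p` -/

section LocalLattice

variable {p : ℕ} [Fact p.Prime] {E : Type*} [AddCommGroup E]

theorem small_add {a b : ℚ_[p]} (ha : ‖a‖ < 1) (hb : ‖b‖ < 1) : ‖a + b‖ < 1 :=
  (Padic.nonarchimedean a b).trans_lt (max_lt ha hb)

theorem integral_add {a b : ℚ_[p]} (ha : ‖a‖ ≤ 1) (hb : ‖b‖ ≤ 1) : ‖a + b‖ ≤ 1 :=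
  (Padic.nonarchimedean a b).trans (max_le ha hb)

theorem small_sub {a b : ℚ_[p]} (ha : ‖a‖ < 1) (hb : ‖b‖ < 1) : ‖a - b‖ < 1 := by
  rw [sub_eq_add_neg]
  exact small_add ha (by rwa [norm_neg])

theorem integral_mul {a b : ℚ_[p]} (ha : ‖a‖ ≤ 1) (hb : ‖b‖ ≤ 1) : ‖a * b‖ ≤ 1 := by
  rw [norm_mul]
  exact mul_le_one₀ ha (norm_nonneg _) hb

theorem small_mul {a b : ℚ_[p]} (ha : ‖a‖ ≤ 1) (hb : ‖b‖ < 1) : ‖a * b‖ < 1 := by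
  rw [norm_mul]
  exact (mul_le_of_le_one_left (norm_nonneg _) ha).trans_lt hb

theorem norm_two_le_one : ‖(2 : ℚ_[p])‖ ≤ 1 := by
  exact_mod_cast Padic.norm_int_le_one (p := p) 2

theorem exists_padicInt_coe_eq {a : ℚ_[p]} (ha : ‖a‖ ≤ 1) : ∃ c : ℤ_[p], (c : ℚ_[p]) = a :=
  ⟨⟨a, ha⟩, rfl⟩

theorem norm_div_p_le_one {c : ℚ_[p]} (hc : ‖c‖ < 1) : ‖c / p‖ ≤ 1 := by
  obtain ⟨c, rfl⟩ := exists_padicInt_coe_eq hc.le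
  obtain ⟨d, hd⟩ := (PadicInt.norm_lt_one_iff_dvd c).1 hc
  have hp : (p : ℚ_[p]) ≠ 0 := by exact_mod_cast (Fact.out : p.Prime).ne_zero
  have h2 : (c : ℚ_[p]) = p * (d : ℚ_[p]) := congrArg Subtype.val hd
  rw [h2, mul_div_cancel_left₀ _ hp]
  exact d.2

section HyperbolicTriple

variable [Module ℚ_[p] E] (Q : QuadraticForm ℚ_[p] E)

/-- The vectors `e, f, g` are pairwise orthogonal except for the pair `e, f`, which spans a
hyperbolic plane with `e` and `f` isotropic. -/
structure IsHyperbolicTriple (e f g : E) : Prop where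
  fst_isotropic : Q e = 0
  snd_isotropic : Q f = 0
  fst_trd : QuadraticMap.polar Q e g = 0
  snd_trd : QuadraticMap.polar Q f g = 0

variable {Q}

theorem IsHyperbolicTriple.map_eq {e f g : E} (h : IsHyperbolicTriple Q e f g) (a b c : ℚ_[p]) :
    Q (a • e + b • f + c • g) = a * b * QuadraticMap.polar Q e f + c * c * Q g := by
  simp only [QuadraticMap.map_add Q, QuadraticMap.map_smul, QuadraticMap.polar_add_left,
    QuadraticMap.polar_smul_left, QuadraticMap.polar_smul_right, h.fst_isotropic, h.snd_isotropic,
    h.fst_trd, h.snd_trd, smul_eq_mul]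
  ring

theorem IsHyperbolicTriple.polar_fst {e f g : E} (h : IsHyperbolicTriple Q e f g) (a b c : ℚ_[p]) :
    QuadraticMap.polar Q e (a • e + b • f + c • g) = b * QuadraticMap.polar Q e f := by
  simp only [QuadraticMap.polar_add_right, QuadraticMap.polar_smul_right, polar_self_eq,
    h.fst_isotropic, h.fst_trd, smul_eq_mul]
  ring

theorem IsHyperbolicTriple.polar_snd {e f g : E} (h : IsHyperbolicTriple Q e f g) (a b c : ℚ_[p]) :
    QuadraticMap.polar Q f (a • e + b • f + c • g) = a * QuadraticMap.polar Q e f := by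
  simp only [QuadraticMap.polar_add_right, QuadraticMap.polar_smul_right, polar_self_eq,
    h.snd_isotropic, h.snd_trd, smul_eq_mul, QuadraticMap.polar_comm Q f e]
  ring

theorem IsHyperbolicTriple.polar_trd {e f g : E} (h : IsHyperbolicTriple Q e f g) (a b c : ℚ_[p]) :
    QuadraticMap.polar Q g (a • e + b • f + c • g) = c * (2 * Q g) := by
  simp only [QuadraticMap.polar_add_right, QuadraticMap.polar_smul_right, polar_self_eq,
    QuadraticMap.polar_comm Q g e, QuadraticMap.polar_comm Q g f, h.fst_trd, h.snd_trd, smul_eq_mul]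
  ring

end HyperbolicTriple

section Triple

variable [Module ℤ_[p] E]

/-- The `ℤ_p`-lattice spanned by three vectors. -/
def triple (u v w : E) : Submodule ℤ_[p] E := Submodule.span ℤ_[p] {u, v, w}

theorem triple_fst (u v w : E) : u ∈ triple (p := p) u v w :=
  Submodule.subset_span (by simp)

theorem triple_snd (u v w : E) : v ∈ triple (p := p) u v w :=
  Submodule.subset_span (by simp)

theorem triple_trd (u v w : E) : w ∈ triple (p := p) u v w :=
  Submodule.subset_span (by simp)

theorem triple_le {u v w : E} {Λ : Submodule ℤ_[p] E} (hu : u ∈ Λ) (hv : v ∈ Λ) (hw : w ∈ Λ) :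
    triple u v w ≤ Λ := by
  rw [triple, Submodule.span_le]
  rintro x (rfl | rfl | rfl)
  exacts [hu, hv, hw]

theorem triple_swap (u v w : E) : triple (p := p) u v w = triple v u w := by
  rw [triple, triple, Set.insert_comm]

end Triple

variable [Module ℚ_[p] E] [Module ℤ_[p] E]

theorem small_polar (Q : QuadraticForm ℚ_[p] E) {Λ : Submodule ℤ_[p] E}
    (h : ∀ x ∈ Λ, ‖Q x‖ < 1) {x y : E} (hx : x ∈ Λ) (hy : y ∈ Λ) :
    ‖QuadraticMap.polar Q x y‖ < 1 := by
  rw [QuadraticMap.polar]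
  exact small_sub (small_sub (h _ (add_mem hx hy)) (h _ hx)) (h _ hy)

theorem integral_polar (Q : QuadraticForm ℚ_[p] E) {Λ : Submodule ℤ_[p] E}
    (h : ∀ x ∈ Λ, ‖Q x‖ ≤ 1) {x y : E} (hx : x ∈ Λ) (hy : y ∈ Λ) :
    ‖QuadraticMap.polar Q x y‖ ≤ 1 := by
  rw [QuadraticMap.polar, sub_eq_add_neg, sub_eq_add_neg]
  exact integral_add (integral_add (h _ (add_mem hx hy)) (by rw [norm_neg]; exact h _ hx))
    (by rw [norm_neg]; exact h _ hy)

variable [IsScalarTower ℤ_[p] ℚ_[p] E]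

theorem coe_smul_eq (c : ℤ_[p]) (x : E) : (c : ℚ_[p]) • x = c • x := algebraMap_smul ℚ_[p] c x

theorem smul_mem_of_norm_le {Λ : Submodule ℤ_[p] E} {c : ℚ_[p]} (hc : ‖c‖ ≤ 1) {x : E}
    (hx : x ∈ Λ) : c • x ∈ Λ := by
  obtain ⟨c, rfl⟩ := exists_padicInt_coe_eq hc
  rw [coe_smul_eq]
  exact Λ.smul_mem c hx

theorem smul_mem_of_norm_lt {Λ : Submodule ℤ_[p] E} {c : ℚ_[p]} (hc : ‖c‖ < 1) {x : E}
    (hx : (p : ℚ_[p]) • x ∈ Λ) : c • x ∈ Λ := by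
  have hp : (p : ℚ_[p]) ≠ 0 := by exact_mod_cast (Fact.out : p.Prime).ne_zero
  have := smul_mem_of_norm_le (norm_div_p_le_one hc) hx
  rwa [smul_smul, div_mul_cancel₀ _ hp] at this

theorem mem_triple {u v w x : E} : x ∈ triple (p := p) u v w ↔
    ∃ a b c : ℚ_[p], ‖a‖ ≤ 1 ∧ ‖b‖ ≤ 1 ∧ ‖c‖ ≤ 1 ∧ x = a • u + b • v + c • w := by
  rw [triple, Submodule.mem_span_triple]
  constructor
  · rintro ⟨a, b, c, rfl⟩
    refine ⟨a, b, c, a.2, b.2, c.2, ?_⟩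
    simp only [coe_smul_eq]
  · rintro ⟨a, b, c, ha, hb, hc, rfl⟩
    obtain ⟨a, rfl⟩ := exists_padicInt_coe_eq ha
    obtain ⟨b, rfl⟩ := exists_padicInt_coe_eq hb
    obtain ⟨c, rfl⟩ := exists_padicInt_coe_eq hc
    exact ⟨a, b, c, by simp only [coe_smul_eq]⟩

theorem act_triple (f : E ≃ₗ[ℚ_[p]] E) (u v w : E) :
    act f (triple u v w) = triple (p := p) (f u) (f v) (f w) := by
  rw [act, triple, triple, Submodule.map_span, Set.image_insert_eq, Set.image_insert_eq,
    Set.image_singleton]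
  rfl

variable (Q : QuadraticForm ℚ_[p] E)

/-- If `x₁` pairs to a unit with `x₃` and `Q` vanishes modulo `p` on `x₁, x₂`, then Hensel's lemma
lifts `x₁` to an isotropic vector, and a hyperbolic plane splits off. -/
theorem exists_hyperbolic_of_unit {x₁ x₂ x₃ : E}
    (hN : ∀ t ∈ triple (p := p) x₁ x₂ x₃, ‖Q t‖ ≤ 1)
    (hM : ∀ t ∈ triple (p := p) x₁ x₂ ((p : ℚ_[p]) • x₃), ‖Q t‖ < 1)
    (hα : ‖QuadraticMap.polar Q x₁ x₃‖ = 1) :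
    ∃ e f g : E, IsHyperbolicTriple Q e f g ∧ QuadraticMap.polar Q e f = 1 ∧ ‖Q g‖ < 1 ∧
      triple (p := p) x₁ x₂ x₃ = triple e f g ∧
      triple (p := p) x₁ x₂ ((p : ℚ_[p]) • x₃) = triple e ((p : ℚ_[p]) • f) g := by
  set N := triple (p := p) x₁ x₂ x₃ with hNdef
  set M := triple (p := p) x₁ x₂ ((p : ℚ_[p]) • x₃) with hMdef
  have h1N : x₁ ∈ N := triple_fst _ _ _
  have h2N : x₂ ∈ N := triple_snd _ _ _
  have h3N : x₃ ∈ N := triple_trd _ _ _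
  have h1M : x₁ ∈ M := triple_fst _ _ _
  have h2M : x₂ ∈ M := triple_snd _ _ _
  have h3M : (p : ℚ_[p]) • x₃ ∈ M := triple_trd _ _ _
  set α := QuadraticMap.polar Q x₁ x₃ with hαdef
  -- a root `t ≡ 0` of `Q(x₁ + t x₃)`
  obtain ⟨t, ht, htroot⟩ : ∃ t : ℚ_[p], ‖t‖ < 1 ∧ Q x₃ * (t * t) + α * t + Q x₁ = 0 := by
    obtain ⟨γ, hγ⟩ := exists_padicInt_coe_eq (hN _ h3N)
    obtain ⟨α', hα'⟩ := exists_padicInt_coe_eq hα.le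
    obtain ⟨δ, hδ⟩ := exists_padicInt_coe_eq (hN _ h1N)
    let F : Polynomial ℤ_[p] := Polynomial.C γ * Polynomial.X ^ 2 +
      Polynomial.C α' * Polynomial.X + Polynomial.C δ
    have hd : ‖F.derivative.aeval (0 : ℤ_[p])‖ = 1 := by
      simp [F, PadicInt.norm_def, hα', hα]
    have hlt : ‖F.aeval (0 : ℤ_[p])‖ < ‖F.derivative.aeval (0 : ℤ_[p])‖ ^ 2 := by
      rw [hd]
      simp [F, PadicInt.norm_def, hδ, hM _ h1M]
    obtain ⟨z, hz, hz', -⟩ := hensels_lemma hlt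
    rw [hd, sub_zero] at hz'
    refine ⟨z, hz', ?_⟩
    have h := congrArg (fun a : ℤ_[p] => (a : ℚ_[p])) hz
    simp only [F, map_add, map_mul, Polynomial.aeval_C, Polynomial.aeval_X, map_pow,
      Algebra.algebraMap_self, RingHom.id_apply, PadicInt.coe_add, PadicInt.coe_mul,
      PadicInt.coe_pow, PadicInt.coe_zero] at h
    rw [← hγ, ← hα', ← hδ, ← sq]
    exact h
  set e := x₁ + t • x₃ with he
  have heM : e ∈ M := add_mem h1M (smul_mem_of_norm_lt ht h3M)
  have heN : e ∈ N := add_mem h1N (smul_mem_of_norm_le ht.le h3N)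
  have hQe : Q e = 0 := by
    rw [he, QuadraticMap.map_add Q, QuadraticMap.map_smul, QuadraticMap.polar_smul_right,
      smul_eq_mul, smul_eq_mul, ← htroot]
    ring
  set u := QuadraticMap.polar Q e x₃ with hu
  have hueq : u = α + t * (2 * Q x₃) := by
    rw [hu, he, QuadraticMap.polar_add_left, QuadraticMap.polar_smul_left, polar_self_eq,
      smul_eq_mul]
  have hu1 : ‖u‖ = 1 := by
    have h4 : ‖t * (2 * Q x₃)‖ < 1 := by
      rw [mul_comm]
      exact small_mul (integral_mul norm_two_le_one (hN _ h3N)) ht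
    rw [hueq, Padic.add_eq_max_of_ne (by rw [hα]; exact h4.ne'), hα, max_eq_left h4.le]
  have hu0 : u ≠ 0 := fun h => by rw [h, norm_zero] at hu1; exact zero_ne_one hu1
  have hui : ‖u⁻¹‖ ≤ 1 := by rw [norm_inv, hu1, inv_one]
  -- `f` is `x₃` moved along `e` to be isotropic, and `g` is `x₂` projected off the plane `e, f`
  set f := u⁻¹ • (x₃ - (u⁻¹ * Q x₃) • e) with hf
  have hγ : ‖u⁻¹ * Q x₃‖ ≤ 1 := integral_mul hui (hN _ h3N)
  have hfN : f ∈ N := smul_mem_of_norm_le hui (sub_mem h3N (smul_mem_of_norm_le hγ heN))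
  have hpN : ‖(p : ℚ_[p])‖ ≤ 1 := Padic.norm_p_lt_one.le
  have hfM : (p : ℚ_[p]) • f ∈ M := by
    rw [hf, smul_comm, smul_sub]
    exact smul_mem_of_norm_le hui (sub_mem h3M
      (smul_mem_of_norm_le hpN (smul_mem_of_norm_le hγ heM)))
  have hpee : QuadraticMap.polar Q e e = 0 := by rw [polar_self_eq, hQe, mul_zero]
  have hef : QuadraticMap.polar Q e f = 1 := by
    rw [hf, QuadraticMap.polar_smul_right, QuadraticMap.polar_sub_right,
      QuadraticMap.polar_smul_right, hpee, smul_zero, sub_zero, smul_eq_mul, ← hu,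
      inv_mul_cancel₀ hu0]
  have hQf : Q f = 0 := by
    rw [hf, QuadraticMap.map_smul, map_sub_smul, hQe, ← hu, mul_zero, add_zero,
      mul_right_comm, inv_mul_cancel₀ hu0, one_mul, sub_self, smul_zero]
  set r := QuadraticMap.polar Q e x₂ with hr
  set s := QuadraticMap.polar Q f x₂ with hs
  have hr1 : ‖r‖ < 1 := small_polar Q hM heM h2M
  have hs1 : ‖s‖ ≤ 1 := integral_polar Q hN hfN h2N
  set g := x₂ - s • e - r • f with hg
  have hgM : g ∈ M := sub_mem (sub_mem h2M (smul_mem_of_norm_le hs1 heM))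
    (smul_mem_of_norm_lt hr1 hfM)
  have hgN : g ∈ N := sub_mem (sub_mem h2N (smul_mem_of_norm_le hs1 heN))
    (smul_mem_of_norm_le hr1.le hfN)
  have hfe : QuadraticMap.polar Q f e = 1 := by rw [QuadraticMap.polar_comm, hef]
  have hff : QuadraticMap.polar Q f f = 0 := by rw [polar_self_eq, hQf, mul_zero]
  have hx₃ : x₃ = u • f + (u⁻¹ * Q x₃) • e := by
    rw [hf, smul_smul, mul_inv_cancel₀ hu0, one_smul, sub_add_cancel]
  have hx₁ : x₁ = e - t • x₃ := by rw [he, add_sub_cancel_right]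
  have hx₂ : x₂ = g + s • e + r • f := by
    rw [hg]
    abel
  refine ⟨e, f, g, ⟨hQe, hQf, ?_, ?_⟩, hef, hM _ hgM, le_antisymm ?_ (triple_le heN hfN hgN),
    le_antisymm ?_ (triple_le heM hfM hgM)⟩
  · rw [hg, QuadraticMap.polar_sub_right, QuadraticMap.polar_sub_right,
      QuadraticMap.polar_smul_right, QuadraticMap.polar_smul_right, hpee, hef, ← hr, smul_zero,
      smul_eq_mul, mul_one, sub_zero, sub_self]
  · rw [hg, QuadraticMap.polar_sub_right, QuadraticMap.polar_sub_right,
      QuadraticMap.polar_smul_right, QuadraticMap.polar_smul_right, hff, hfe, ← hs, smul_zero,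
      smul_eq_mul, mul_one, sub_zero, sub_self]
  · have k1 := triple_fst (p := p) e f g
    have k2 := triple_snd (p := p) e f g
    have k3 := triple_trd (p := p) e f g
    have k4 : x₃ ∈ triple (p := p) e f g := by
      rw [hx₃]
      exact add_mem (smul_mem_of_norm_le hu1.le k2) (smul_mem_of_norm_le hγ k1)
    refine triple_le ?_ ?_ k4
    · rw [hx₁]
      exact sub_mem k1 (smul_mem_of_norm_le ht.le k4)
    · rw [hx₂]
      exact add_mem (add_mem k3 (smul_mem_of_norm_le hs1 k1)) (smul_mem_of_norm_le hr1.le k2)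
  · have k1 := triple_fst (p := p) e ((p : ℚ_[p]) • f) g
    have k2 := triple_snd (p := p) e ((p : ℚ_[p]) • f) g
    have k3 := triple_trd (p := p) e ((p : ℚ_[p]) • f) g
    have k4 : (p : ℚ_[p]) • x₃ ∈ triple (p := p) e ((p : ℚ_[p]) • f) g := by
      rw [hx₃, smul_add, smul_comm (p : ℚ_[p]) u]
      exact add_mem (smul_mem_of_norm_le hu1.le k2)
        (smul_mem_of_norm_le hpN (smul_mem_of_norm_le hγ k1))
    refine triple_le ?_ ?_ k4
    · rw [hx₁]
      exact sub_mem k1 (smul_mem_of_norm_lt ht k4)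
    · rw [hx₂]
      exact add_mem (add_mem k3 (smul_mem_of_norm_le hs1 k1)) (smul_mem_of_norm_lt hr1 k2)

/-- The reduction of `Q` modulo `p` vanishes on the plane `M / pN` of `N / pN`, so it is a product
of two linear forms. Either these are proportional, and then `M` consists of the vectors of `N`
with values divisible by `p` and lies in the radical modulo `p`; or a hyperbolic plane splits. -/
theorem sublattice_dichotomy {x₁ x₂ x₃ : E}
    (hN : ∀ t ∈ triple (p := p) x₁ x₂ x₃, ‖Q t‖ ≤ 1)
    (hM : ∀ t ∈ triple (p := p) x₁ x₂ ((p : ℚ_[p]) • x₃), ‖Q t‖ < 1)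
    (hprim : ∃ t ∈ triple (p := p) x₁ x₂ x₃, ‖Q t‖ = 1) :
    ((∀ t ∈ triple (p := p) x₁ x₂ x₃, ‖Q t‖ < 1 → t ∈ triple (p := p) x₁ x₂ ((p : ℚ_[p]) • x₃)) ∧
      ∀ t ∈ triple (p := p) x₁ x₂ ((p : ℚ_[p]) • x₃), ∀ y ∈ triple (p := p) x₁ x₂ x₃,
        ‖QuadraticMap.polar Q t y‖ < 1) ∨
    ∃ e f g : E, IsHyperbolicTriple Q e f g ∧ QuadraticMap.polar Q e f = 1 ∧ ‖Q g‖ < 1 ∧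
      triple (p := p) x₁ x₂ x₃ = triple e f g ∧
      triple (p := p) x₁ x₂ ((p : ℚ_[p]) • x₃) = triple e ((p : ℚ_[p]) • f) g := by
  set M := triple (p := p) x₁ x₂ ((p : ℚ_[p]) • x₃) with hMdef
  have h1N := triple_fst (p := p) x₁ x₂ x₃
  have h2N := triple_snd (p := p) x₁ x₂ x₃
  have h3N := triple_trd (p := p) x₁ x₂ x₃
  have h1M : x₁ ∈ M := triple_fst _ _ _
  have h2M : x₂ ∈ M := triple_snd _ _ _
  have h3M : (p : ℚ_[p]) • x₃ ∈ M := triple_trd _ _ _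
  rcases (integral_polar Q hN h1N h3N).lt_or_eq with hα | hα
  · rcases (integral_polar Q hN h2N h3N).lt_or_eq with hβ | hβ
    · left
      have hpx : ∀ a b : ℚ_[p], ‖a‖ ≤ 1 → ‖b‖ ≤ 1 →
          ‖QuadraticMap.polar Q (a • x₁ + b • x₂) x₃‖ < 1 := by
        intro a b ha hb
        rw [QuadraticMap.polar_add_left, QuadraticMap.polar_smul_left,
          QuadraticMap.polar_smul_left]
        exact small_add (small_mul ha hα) (small_mul hb hβ)
      have hmem : ∀ a b : ℚ_[p], ‖a‖ ≤ 1 → ‖b‖ ≤ 1 → a • x₁ + b • x₂ ∈ M := fun a b ha hb =>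
        add_mem (smul_mem_of_norm_le ha h1M) (smul_mem_of_norm_le hb h2M)
      have hQ : ∀ a b c : ℚ_[p], ‖a‖ ≤ 1 → ‖b‖ ≤ 1 → ‖c‖ ≤ 1 →
          ‖Q (a • x₁ + b • x₂ + c • x₃) - c * c * Q x₃‖ < 1 := by
        intro a b c ha hb hc
        rw [QuadraticMap.map_add Q, QuadraticMap.map_smul, QuadraticMap.polar_smul_right,
          smul_eq_mul, smul_eq_mul, add_right_comm, add_sub_cancel_right]
        exact small_add (hM _ (hmem a b ha hb)) (small_mul hc (hpx a b ha hb))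
      have hγ : ‖Q x₃‖ = 1 := by
        refine (hN _ h3N).lt_or_eq.resolve_left fun h => ?_
        obtain ⟨t, ht, ht1⟩ := hprim
        obtain ⟨a, b, c, ha, hb, hc, rfl⟩ := mem_triple.1 ht
        have := small_add (hQ a b c ha hb hc) (small_mul (integral_mul hc hc) h)
        rw [sub_add_cancel, ht1] at this
        exact lt_irrefl _ this
      constructor
      · intro t ht hQt
        obtain ⟨a, b, c, ha, hb, hc, rfl⟩ := mem_triple.1 ht
        have h4 := small_sub hQt (hQ a b c ha hb hc)
        rw [sub_sub_cancel, norm_mul, hγ, mul_one, norm_mul] at h4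
        have hc1 : ‖c‖ < 1 := by
          refine hc.lt_or_eq.resolve_right fun h => ?_
          rw [h, mul_one] at h4
          exact lt_irrefl _ h4
        exact add_mem (hmem a b ha hb) (smul_mem_of_norm_lt hc1 h3M)
      · intro t ht y hy
        obtain ⟨a, b, c, ha, hb, hc, rfl⟩ := mem_triple.1 hy
        rw [QuadraticMap.polar_add_right, QuadraticMap.polar_smul_right]
        refine small_add (small_polar Q hM ht (hmem a b ha hb)) (small_mul hc ?_)
        obtain ⟨a, b, c, ha, hb, hc, rfl⟩ := mem_triple.1 ht
        rw [QuadraticMap.polar_add_left, QuadraticMap.polar_smul_left,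
          QuadraticMap.polar_smul_left, polar_self_eq]
        refine small_add (hpx a b ha hb) (small_mul hc ?_)
        rw [smul_eq_mul, mul_comm]
        exact small_mul (integral_mul norm_two_le_one (hN _ h3N)) Padic.norm_p_lt_one
    · right
      rw [hMdef]
      rw [triple_swap x₁ x₂ x₃] at hN ⊢
      rw [hMdef, triple_swap x₁ x₂] at hM
      rw [triple_swap x₁ x₂]
      exact exists_hyperbolic_of_unit Q hN hM hβ
  · right
    exact exists_hyperbolic_of_unit Q hN hM hα

/-- Sublattices of `N` that contain `pN` and have a cyclic quotient are comparable only if they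
are equal. -/
theorem eq_of_le_of_cyclic {N M M' : Submodule ℤ_[p] E} (hMN : ¬ N ≤ M)
    (hMN' : M ≤ N) (hp : ∀ x ∈ N, (p : ℚ_[p]) • x ∈ M') {y : E} (hy : y ∈ N)
    (hcyc : ∀ x ∈ N, ∃ m ∈ M', ∃ c : ℚ_[p], ‖c‖ ≤ 1 ∧ x = m + c • y) (hle : M' ≤ M) :
    M' = M := by
  refine le_antisymm hle fun x hx => ?_
  obtain ⟨m, hm, c, hc, rfl⟩ := hcyc x (hMN' hx)
  refine add_mem hm ?_
  rcases hc.lt_or_eq with h | h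
  · exact smul_mem_of_norm_lt h (hp y hy)
  · exfalso
    have hc0 : c ≠ 0 := fun h0 => by rw [h0, norm_zero] at h; exact zero_ne_one h
    have hyM : y ∈ M := by
      have h1 : c • y ∈ M := by
        have := sub_mem hx (hle hm)
        rwa [add_sub_cancel_left] at this
      have h2 := smul_mem_of_norm_le (c := c⁻¹) (by rw [norm_inv, h, inv_one]) h1
      rwa [smul_smul, inv_mul_cancel₀ hc0, one_smul] at h2
    refine hMN fun z hz => ?_
    obtain ⟨m', hm', c', hc', rfl⟩ := hcyc z hz
    exact add_mem (hle hm') (smul_mem_of_norm_le hc' hyM)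

/-- All sublattices of `N` of index `p` on which `Q` is divisible by `p` are conjugate under the
isometries of `N`: there is one in the first case of the dichotomy and there are two, swapped by
the reflection in `e - f`, in the second. -/
theorem exists_isometry_sublattice {x₁ x₂ x₃ : E}
    (hN : ∀ t ∈ triple (p := p) x₁ x₂ x₃, ‖Q t‖ ≤ 1)
    (hM : ∀ t ∈ triple (p := p) x₁ x₂ ((p : ℚ_[p]) • x₃), ‖Q t‖ < 1)
    (hprim : ∃ t ∈ triple (p := p) x₁ x₂ x₃, ‖Q t‖ = 1)
    {M' : Submodule ℤ_[p] E} (hM'N : M' ≤ triple x₁ x₂ x₃) (hM' : ∀ t ∈ M', ‖Q t‖ < 1)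
    (hp : ∀ x ∈ triple (p := p) x₁ x₂ x₃, (p : ℚ_[p]) • x ∈ M')
    {y : E} (hy : y ∈ triple (p := p) x₁ x₂ x₃)
    (hcyc : ∀ x ∈ triple (p := p) x₁ x₂ x₃, ∃ m ∈ M', ∃ c : ℚ_[p], ‖c‖ ≤ 1 ∧ x = m + c • y) :
    ∃ μ ∈ orthogonalGroup Q, act μ (triple x₁ x₂ x₃) = triple (p := p) x₁ x₂ x₃ ∧
      act μ (triple x₁ x₂ ((p : ℚ_[p]) • x₃)) = M' := by
  have hpN : ‖(p : ℚ_[p])‖ ≤ 1 := Padic.norm_p_lt_one.le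
  have hnot : ∀ Λ : Submodule ℤ_[p] E, (∀ t ∈ Λ, ‖Q t‖ < 1) → ¬ triple x₁ x₂ x₃ ≤ Λ := by
    intro Λ hΛ hle
    obtain ⟨t, ht, ht1⟩ := hprim
    exact (hΛ t (hle ht)).ne ht1
  rcases sublattice_dichotomy Q hN hM hprim with ⟨h1, -⟩ | ⟨e, f, g, h, hef, hg, hNe, hMe⟩
  · refine ⟨1, one_mem _, act_one, ?_⟩
    rw [act_one]
    refine (eq_of_le_of_cyclic (hnot _ hM) (triple_le (triple_fst _ _ _) (triple_snd _ _ _)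
      (smul_mem_of_norm_le hpN (triple_trd _ _ _))) hp hy hcyc fun t ht => ?_).symm
    exact h1 t (hM'N ht) (hM' t ht)
  · rw [hNe] at hnot hM'N hp hy hcyc ⊢
    rw [hMe] at hM ⊢
    -- the coordinates of a vector of `M'` with respect to `e` and `f` are not both units
    have hprod : ∀ t ∈ M', ‖QuadraticMap.polar Q e t‖ < 1 ∨ ‖QuadraticMap.polar Q f t‖ < 1 := by
      intro t ht
      obtain ⟨a, b, c, ha, hb, hc, rfl⟩ := mem_triple.1 (hM'N ht)
      rw [h.polar_fst, h.polar_snd, hef, mul_one, mul_one]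
      by_contra! hcon
      have h2 := hM' _ ht
      rw [h.map_eq, hef, mul_one] at h2
      have h3 := small_sub h2 (small_mul (integral_mul hc hc) hg)
      rw [add_sub_cancel_right, norm_mul] at h3
      exact absurd h3 (not_lt.2 (one_le_mul_of_one_le_of_one_le hcon.2 hcon.1))
    -- a group is not the union of two proper subgroups, so one alternative holds throughout
    have hunion : (∀ t ∈ M', ‖QuadraticMap.polar Q e t‖ < 1) ∨
        ∀ t ∈ M', ‖QuadraticMap.polar Q f t‖ < 1 := by
      by_contra! hcon
      obtain ⟨⟨t, ht, ht1⟩, ⟨t', ht', ht1'⟩⟩ := hcon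
      have h2 := (hprod t ht).resolve_left (not_lt.2 ht1)
      have h3 := (hprod t' ht').resolve_right (not_lt.2 ht1')
      rcases hprod _ (add_mem ht ht') with h4 | h4
      · rw [QuadraticMap.polar_add_right] at h4
        have := small_sub h4 h3
        rw [add_sub_cancel_right] at this
        exact absurd this (not_lt.2 ht1)
      · rw [QuadraticMap.polar_add_right] at h4
        have := small_sub h4 h2
        rw [add_sub_cancel_left] at this
        exact absurd this (not_lt.2 ht1')
    rcases hunion with hall | hall
    · refine ⟨1, one_mem _, act_one, ?_⟩
      rw [act_one]
      refine (eq_of_le_of_cyclic (hnot _ hM) (triple_le (triple_fst _ _ _)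
        (smul_mem_of_norm_le hpN (triple_snd _ _ _)) (triple_trd _ _ _)) hp hy hcyc
          fun t ht => ?_).symm
      have hb1 := hall t ht
      obtain ⟨a, b, c, ha, hb, hc, rfl⟩ := mem_triple.1 (hM'N ht)
      rw [h.polar_fst, hef, mul_one] at hb1
      exact add_mem (add_mem (smul_mem_of_norm_le ha (triple_fst _ _ _))
        (smul_mem_of_norm_lt hb1 (triple_snd _ _ _))) (smul_mem_of_norm_le hc (triple_trd _ _ _))
    · have hv : Q (e - f) ≠ 0 := by
        have := h.map_eq 1 (-1) 0
        rw [one_smul, neg_smul, one_smul, zero_smul, add_zero, ← sub_eq_add_neg, hef] at this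
        rw [this]
        simp
      have hQv : Q (e - f) = -1 := by
        have := h.map_eq 1 (-1) 0
        rw [one_smul, neg_smul, one_smul, zero_smul, add_zero, ← sub_eq_add_neg, hef] at this
        rw [this]
        ring
      have hfe : QuadraticMap.polar Q f e = 1 := by rw [QuadraticMap.polar_comm, hef]
      have hμe : symmetryEquiv Q hv e = f := by
        change symmetry Q (e - f) e = f
        rw [symmetry_apply, hQv, QuadraticMap.polar_sub_left, polar_self_eq, h.fst_isotropic, hfe]
        norm_num
      have hμf : symmetryEquiv Q hv f = e := by
        change symmetry Q (e - f) f = e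
        rw [symmetry_apply, hQv, QuadraticMap.polar_sub_left, polar_self_eq, h.snd_isotropic, hef]
        norm_num
      have hμg : symmetryEquiv Q hv g = g := by
        change symmetry Q (e - f) g = g
        rw [symmetry_of_polar_eq_zero]
        rw [QuadraticMap.polar_sub_left, h.fst_trd, h.snd_trd, sub_zero]
      refine ⟨symmetryEquiv Q hv, symmetryEquiv_mem _ _, ?_, ?_⟩
      · rw [act_triple, hμe, hμf, hμg, triple_swap]
      · rw [act_triple, hμe, hμg, map_smul, hμf]
        have hM2 : ∀ t ∈ triple (p := p) f ((p : ℚ_[p]) • e) g, ‖Q t‖ < 1 := by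
          intro t ht
          have h5 : triple (p := p) f ((p : ℚ_[p]) • e) g =
              act (symmetryEquiv Q hv) (triple e ((p : ℚ_[p]) • f) g) := by
            rw [act_triple, hμe, hμg, map_smul, hμf]
          rw [h5] at ht
          obtain ⟨t', ht', rfl⟩ := ht
          have h6 : Q (symmetryEquiv Q hv t') = Q t' := symmetryEquiv_mem Q hv t'
          exact (congrArg norm h6).trans_lt (hM t' ht')
        refine (eq_of_le_of_cyclic (hnot _ hM2) (triple_le (triple_snd _ _ _)
          (smul_mem_of_norm_le hpN (triple_fst _ _ _)) (triple_trd _ _ _)) hp hy hcyc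
            fun t ht => ?_).symm
        have hb1 := hall t ht
        obtain ⟨a, b, c, ha, hb, hc, rfl⟩ := mem_triple.1 (hM'N ht)
        rw [h.polar_snd, hef, mul_one] at hb1
        exact add_mem (add_mem (smul_mem_of_norm_lt hb1 (triple_snd _ _ _))
          (smul_mem_of_norm_le hb (triple_fst _ _ _))) (smul_mem_of_norm_le hc (triple_trd _ _ _))

end LocalLattice

section LocalSpinor

variable {p : ℕ} [Fact p.Prime] {E : Type*} [AddCommGroup E] [Module ℚ_[p] E] [Module ℤ_[p] E]
  [IsScalarTower ℤ_[p] ℚ_[p] E] (Q : QuadraticForm ℚ_[p] E)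

/-! ### Local lattices with full spinor norm group -/

theorem exists_unit_mul_sq {x : ℚ_[p]} (hx : x ≠ 0) (h : Even x.valuation) :
    ∃ u r : ℚ_[p], ‖u‖ = 1 ∧ r ≠ 0 ∧ x = u * (r * r) := by
  obtain ⟨k, hk⟩ := h
  have hp : (p : ℚ_[p]) ≠ 0 := by exact_mod_cast (Fact.out : p.Prime).ne_zero
  have hr : (p : ℚ_[p]) ^ k ≠ 0 := zpow_ne_zero _ hp
  refine ⟨x / ((p : ℚ_[p]) ^ k * (p : ℚ_[p]) ^ k), (p : ℚ_[p]) ^ k, ?_, hr, ?_⟩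
  · rw [norm_div, norm_mul, Padic.norm_p_zpow, Padic.norm_eq_zpow_neg_valuation hx, hk]
    have hp0 : (p : ℝ) ≠ 0 := by exact_mod_cast (Fact.out : p.Prime).ne_zero
    rw [neg_add, zpow_add₀ hp0]
    exact div_self (mul_ne_zero (zpow_ne_zero _ hp0) (zpow_ne_zero _ hp0))
  · field_simp

theorem act_symmetryEquiv_eq {v : E} (hv : Q v ≠ 0) {Λ : Submodule ℤ_[p] E}
    (h : act (symmetryEquiv Q hv) Λ ≤ Λ) : act (symmetryEquiv Q hv) Λ = Λ := by
  refine le_antisymm h ?_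
  have h1 := act_mono (f := symmetryEquiv Q hv) h
  rwa [← act_mul, show symmetryEquiv Q hv * symmetryEquiv Q hv = 1 from
    mul_inv_cancel (symmetryEquiv Q hv), act_one] at h1

/-- The symmetries of `e + u f` with `u` a unit preserve the lattice spanned by a hyperbolic
triple. -/
theorem act_symmetryEquiv_hyperbolic {e f g : E} (h : IsHyperbolicTriple Q e f g)
    {u : ℚ_[p]} (hu : ‖u‖ = 1) (hv : Q (e + u • f) ≠ 0) :
    act (symmetryEquiv Q hv) (triple e f g) = triple (p := p) e f g := by
  have hQv : Q (e + u • f) = u * QuadraticMap.polar Q e f := by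
    have := h.map_eq 1 u 0
    rwa [one_smul, zero_smul, add_zero, one_mul, mul_zero, zero_mul, add_zero] at this
  have hu0 : u ≠ 0 := fun h0 => by rw [h0, norm_zero] at hu; exact zero_ne_one hu
  have hπ : QuadraticMap.polar Q e f ≠ 0 := fun h0 => hv (by rw [hQv, h0, mul_zero])
  have hτe : symmetryEquiv Q hv e = -(u • f) := by
    change symmetry Q (e + u • f) e = -(u • f)
    rw [symmetry_apply, hQv, QuadraticMap.polar_add_left, QuadraticMap.polar_smul_left,
      polar_self_eq, h.fst_isotropic, QuadraticMap.polar_comm Q f, mul_zero, zero_add, smul_eq_mul,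
      inv_mul_cancel₀ (mul_ne_zero hu0 hπ), one_smul]
    abel
  have hτf : symmetryEquiv Q hv f = -(u⁻¹ • e) := by
    change symmetry Q (e + u • f) f = -(u⁻¹ • e)
    rw [symmetry_apply, hQv, QuadraticMap.polar_add_left, QuadraticMap.polar_smul_left,
      polar_self_eq, h.snd_isotropic, mul_zero, smul_zero, add_zero, mul_inv,
      inv_mul_cancel_right₀ hπ, smul_add, smul_smul, inv_mul_cancel₀ hu0, one_smul]
    abel
  have hτg : symmetryEquiv Q hv g = g := by
    change symmetry Q (e + u • f) g = g
    rw [symmetry_of_polar_eq_zero]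
    rw [QuadraticMap.polar_add_left, QuadraticMap.polar_smul_left, h.fst_trd, h.snd_trd, smul_zero,
      add_zero]
  refine act_symmetryEquiv_eq Q hv ?_
  rw [act_triple, hτe, hτf, hτg]
  exact triple_le (neg_mem (smul_mem_of_norm_le hu.le (triple_snd _ _ _)))
    (neg_mem (smul_mem_of_norm_le (by rw [norm_inv, hu, inv_one]) (triple_fst _ _ _)))
    (triple_trd _ _ _)

theorem act_symmetryEquiv_trd {e f g : E} (h : IsHyperbolicTriple Q e f g) (hv : Q g ≠ 0) :
    act (symmetryEquiv Q hv) (triple e f g) = triple (p := p) e f g := by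
  have hτe : symmetryEquiv Q hv e = e :=
    symmetry_of_polar_eq_zero Q (by rw [QuadraticMap.polar_comm, h.fst_trd])
  have hτf : symmetryEquiv Q hv f = f :=
    symmetry_of_polar_eq_zero Q (by rw [QuadraticMap.polar_comm, h.snd_trd])
  have hτg : symmetryEquiv Q hv g = -g := symmetry_self Q hv
  refine act_symmetryEquiv_eq Q hv ?_
  rw [act_triple, hτe, hτf, hτg]
  exact triple_le (triple_fst _ _ _) (triple_snd _ _ _) (neg_mem (triple_trd _ _ _))

/-- If the orders of `B(e, f)` and `Q(g)` differ in parity, the symmetries of the lattice spanned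
by `e, f, g` take all spinor norms: those of the vectors `e + u f` give the units, and that of `g`
changes the parity. So every isometry is a product of an isometry of the lattice and an element of
the spinor kernel. -/
theorem exists_stabilizer_mul_spinorKernel {e f g : E} (h : IsHyperbolicTriple Q e f g)
    (hπ : QuadraticMap.polar Q e f ≠ 0) (hg : Q g ≠ 0)
    (hodd : Odd ((QuadraticMap.polar Q e f).valuation + (Q g).valuation))
    {ν : E ≃ₗ[ℚ_[p]] E} {l : List E} (hν : IsSymmetryProd Q ν.toLinearMap l) :
    ∃ k ∈ orthogonalGroup Q, act k (triple e f g) = triple (p := p) e f g ∧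
      k⁻¹ * ν ∈ spinorKernel Q := by
  set π := QuadraticMap.polar Q e f with hπdef
  set d := (l.map Q).prod with hd
  have hd0 : d ≠ 0 := by
    rw [hd]
    refine List.prod_ne_zero fun h0 => ?_
    obtain ⟨v, hv, hv0⟩ := List.mem_map.1 h0
    exact hν.1 v hv hv0
  have hQv : ∀ u : ℚ_[p], Q (e + u • f) = u * π := by
    intro u
    have := h.map_eq 1 u 0
    rwa [one_smul, zero_smul, add_zero, one_mul, mul_zero, zero_mul, add_zero] at this
  have hQ1 : Q (e + (1 : ℚ_[p]) • f) ≠ 0 := by rwa [hQv, one_mul]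
  -- a product `k₀` of symmetries of the lattice whose number of factors has the right parity
  -- and whose spinor norm has an order of the right parity
  obtain ⟨k₀, l₀, hk₀, hk₀O, hk₀s, hpar, hB0, hval⟩ : ∃ (k₀ : E ≃ₗ[ℚ_[p]] E) (l₀ : List E),
      IsSymmetryProd Q k₀.toLinearMap l₀ ∧ k₀ ∈ orthogonalGroup Q ∧
      act k₀ (triple e f g) = triple (p := p) e f g ∧ Even (l₀.length + 1 + l.length) ∧
      (l₀.map Q).prod ≠ 0 ∧ Even (d * ((l₀.map Q).prod * π)).valuation := by
    have s1 := isSymmetryProd_symmetry hQ1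
    have sg := isSymmetryProd_symmetry hg
    have a1 := act_symmetryEquiv_hyperbolic (p := p) Q h norm_one hQ1
    have ag := act_symmetryEquiv_trd (p := p) Q h hg
    have hp1 : ((([e + (1 : ℚ_[p]) • f] : List E).map Q).prod) = π := by
      rw [List.map_singleton, List.prod_singleton, hQv, one_mul]
    have hpg : ((([g] : List E).map Q).prod) = Q g := by simp
    have hp0 : (((([] : List E)).map Q).prod) = 1 := by simp
    have hpg1 : ((([g] ++ [e + (1 : ℚ_[p]) • f] : List E).map Q).prod) = Q g * π := by
      rw [List.map_append, List.prod_append, List.map_singleton, List.prod_singleton,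
        List.map_singleton, List.prod_singleton, hQv, one_mul]
    rcases Nat.even_or_odd l.length with hl | hl
    · by_cases hdv : Even d.valuation
      · refine ⟨_, _, s1, symmetryEquiv_mem Q hQ1, a1, ?_, by rwa [hp1], ?_⟩
        · simp only [List.length_singleton]
          exact (by decide : Even (1 + 1)).add hl
        · rw [hp1, Padic.valuation_mul hd0 (mul_ne_zero hπ hπ), Padic.valuation_mul hπ hπ]
          exact hdv.add ⟨_, rfl⟩
      · refine ⟨_, _, sg, symmetryEquiv_mem Q hg, ag, ?_, by rwa [hpg], ?_⟩
        · simp only [List.length_singleton]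
          exact (by decide : Even (1 + 1)).add hl
        · rw [hpg, Padic.valuation_mul hd0 (mul_ne_zero hg hπ), Padic.valuation_mul hg hπ,
            add_comm (Q g).valuation]
          exact (Int.not_even_iff_odd.1 hdv).add_odd hodd
    · by_cases hdv : Even (d.valuation + π.valuation)
      · refine ⟨1, _, isSymmetryProd_nil, one_mem _, act_one, ?_,
          by rw [hp0]; exact one_ne_zero, ?_⟩
        · simp only [List.length_nil, zero_add]
          rw [add_comm]
          exact hl.add_one
        · rwa [hp0, one_mul, Padic.valuation_mul hd0 hπ]
      · refine ⟨_, _, sg.mul s1, mul_mem (symmetryEquiv_mem Q hg) (symmetryEquiv_mem Q hQ1),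
          by rw [act_mul, a1, ag], ?_, by rw [hpg1]; exact mul_ne_zero hg hπ, ?_⟩
        · simp only [List.length_append, List.length_singleton]
          exact (by decide : Odd (1 + 1 + 1)).add_odd hl
        · rw [hpg1, Padic.valuation_mul hd0 (mul_ne_zero (mul_ne_zero hg hπ) hπ),
            Padic.valuation_mul (mul_ne_zero hg hπ) hπ, Padic.valuation_mul hg hπ]
          have h2 := (Int.not_even_iff_odd.1 hdv).add_odd hodd
          have h3 : d.valuation + π.valuation + (π.valuation + (Q g).valuation) =
              d.valuation + ((Q g).valuation + π.valuation + π.valuation) := by ring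
          rwa [h3] at h2
  -- the symmetry of `e + u f` corrects the remaining unit of the spinor norm
  obtain ⟨u, r, hu, hr, hur⟩ := exists_unit_mul_sq (mul_ne_zero hd0 (mul_ne_zero hB0 hπ)) hval
  have hu0 : u ≠ 0 := fun h0 => by rw [h0, norm_zero] at hu; exact zero_ne_one hu
  have hQu : Q (e + u • f) ≠ 0 := by
    rw [hQv]
    exact mul_ne_zero hu0 hπ
  have hk : IsSymmetryProd Q (k₀ * symmetryEquiv Q hQu).toLinearMap _ :=
    hk₀.mul (isSymmetryProd_symmetry hQu)
  refine ⟨k₀ * symmetryEquiv Q hQu, mul_mem hk₀O (symmetryEquiv_mem _ _), ?_, ?_⟩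
  · rw [act_mul, act_symmetryEquiv_hyperbolic Q h hu, hk₀s]
  · refine inSpinorKernel_iff.2 ⟨_, hk.inv.mul hν, ?_, ?_⟩
    · rw [List.length_append, List.length_reverse, List.length_append, List.length_singleton]
      exact hpar
    · rw [List.map_append, List.prod_append, List.map_reverse, List.prod_reverse, List.map_append,
        List.prod_append, List.map_singleton, List.prod_singleton, hQv, ← hd]
      refine ⟨u * r, ?_⟩
      linear_combination u * hur

/-! ### Jordan decompositions -/

theorem mem_span_pair_coe {u v x : E} (h : x ∈ Submodule.span ℤ_[p] {u, v}) :
    ∃ a b : ℚ_[p], ‖a‖ ≤ 1 ∧ ‖b‖ ≤ 1 ∧ x = a • u + b • v := by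
  obtain ⟨a, b, rfl⟩ := Submodule.mem_span_pair.1 h
  exact ⟨a, b, a.2, b.2, by simp only [coe_smul_eq]⟩

theorem mem_span_singleton_coe {u x : E} (h : x ∈ Submodule.span ℤ_[p] {u}) :
    ∃ a : ℚ_[p], ‖a‖ ≤ 1 ∧ x = a • u := by
  obtain ⟨a, rfl⟩ := Submodule.mem_span_singleton.1 h
  exact ⟨a, a.2, by rw [coe_smul_eq]⟩

theorem norm_half_le_iff {a b : ℚ_[p]} : ‖a / 2‖ ≤ ‖b / 2‖ ↔ ‖a‖ ≤ ‖b‖ := by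
  rw [norm_div, norm_div]
  exact div_le_div_iff_of_pos_right (norm_pos_iff.2 two_ne_zero)

/-- If a hyperbolic plane splits off with complement divisible by `p`, it is the
`(1/2)ℤ_p`-modular component of a Jordan decomposition. -/
theorem exists_jordanDecomposition {e f g : E} (h : IsHyperbolicTriple Q e f g)
    (hef : QuadraticMap.polar Q e f = 1) (hg : ‖Q g‖ < 1) (hg0 : Q g ≠ 0) :
    ∃ J : ℤ → Submodule ℤ_[p] E, IsJordanDecomposition Q (triple e f g) J ∧
      Module.finrank ℤ_[p] (J 0) = 2 := by
  have h2g : 2 * Q g ≠ 0 := mul_ne_zero two_ne_zero hg0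
  have hfe : QuadraticMap.polar Q f e = 1 := by rw [QuadraticMap.polar_comm, hef]
  have hge : QuadraticMap.polar Q g e = 0 := by rw [QuadraticMap.polar_comm, h.fst_trd]
  have hgf : QuadraticMap.polar Q g f = 0 := by rw [QuadraticMap.polar_comm, h.snd_trd]
  have hee : QuadraticMap.polar Q e e = 0 := by rw [polar_self_eq, h.fst_isotropic, mul_zero]
  have hff : QuadraticMap.polar Q f f = 0 := by rw [polar_self_eq, h.snd_isotropic, mul_zero]
  set k := (2 * Q g).valuation with hk
  have hpk : ‖(p : ℚ_[p]) ^ k‖ = ‖2 * Q g‖ := by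
    rw [Padic.norm_p_zpow, Padic.norm_eq_zpow_neg_valuation h2g]
  have hk0 : k ≠ 0 := by
    intro h0
    rw [h0, zpow_zero, norm_one] at hpk
    exact (small_mul norm_two_le_one hg).ne hpk.symm
  let J : ℤ → Submodule ℤ_[p] E := fun i =>
    if i = 0 then Submodule.span ℤ_[p] {e, f} else if i = k then Submodule.span ℤ_[p] {g} else ⊥
  have hJ0 : J 0 = Submodule.span ℤ_[p] {e, f} := if_pos rfl
  have hJk : J k = Submodule.span ℤ_[p] {g} := by simp only [J, if_neg hk0, if_true]
  have hJ : ∀ i, i ≠ 0 → i ≠ k → J i = ⊥ := fun i h0 hk => by simp only [J, if_neg h0, if_neg hk]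
  have heJ : e ∈ J 0 := by rw [hJ0]; exact Submodule.subset_span (by simp)
  have hfJ : f ∈ J 0 := by rw [hJ0]; exact Submodule.subset_span (by simp)
  have hgJ : g ∈ J k := by rw [hJk]; exact Submodule.subset_span (by simp)
  have hle : ∀ i, J i ≤ triple e f g := by
    intro i
    by_cases h0 : i = 0
    · rw [h0, hJ0, Submodule.span_le]
      rintro x (rfl | rfl)
      exacts [triple_fst _ _ _, triple_snd _ _ _]
    · by_cases hik : i = k
      · rw [hik, hJk, Submodule.span_le]
        rintro x rfl
        exact triple_trd _ _ _
      · rw [hJ i h0 hik]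
        exact bot_le
  have hort0k : ∀ x ∈ J 0, ∀ y ∈ J k, QuadraticMap.polar Q x y = 0 := by
    intro x hx y hy
    rw [hJ0] at hx
    rw [hJk] at hy
    obtain ⟨a, b, -, -, rfl⟩ := mem_span_pair_coe hx
    obtain ⟨c, -, rfl⟩ := mem_span_singleton_coe hy
    rw [QuadraticMap.polar_smul_right, QuadraticMap.polar_add_left, QuadraticMap.polar_smul_left,
      QuadraticMap.polar_smul_left, h.fst_trd, h.snd_trd, smul_zero, smul_zero, add_zero, smul_zero]
  have hort : ∀ i j, i ≠ j → ∀ x ∈ J i, ∀ y ∈ J j, QuadraticMap.polar Q x y = 0 := by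
    intro i j hij x hx y hy
    by_cases hi : i = 0 ∨ i = k
    · by_cases hj : j = 0 ∨ j = k
      · rcases hi with rfl | rfl <;> rcases hj with rfl | rfl
        · exact absurd rfl hij
        · exact hort0k x hx y hy
        · rw [QuadraticMap.polar_comm]
          exact hort0k y hy x hx
        · exact absurd rfl hij
      · rw [not_or] at hj
        rw [hJ j hj.1 hj.2, Submodule.mem_bot] at hy
        rw [hy, QuadraticMap.polar_zero_right]
    · rw [not_or] at hi
      rw [hJ i hi.1 hi.2, Submodule.mem_bot] at hx
      rw [hx, QuadraticMap.polar_zero_left]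
  have hnondeg : ∀ x ∈ triple (p := p) e f g, QuadraticMap.polar Q e x = 0 →
      QuadraticMap.polar Q f x = 0 → QuadraticMap.polar Q g x = 0 → x = 0 := by
    intro x hx h1 h2 h3
    obtain ⟨a, b, c, -, -, -, rfl⟩ := mem_triple.1 hx
    rw [h.polar_fst, hef, mul_one] at h1
    rw [h.polar_snd, hef, mul_one] at h2
    rw [h.polar_trd, mul_eq_zero, or_iff_left h2g] at h3
    rw [h1, h2, h3, zero_smul, zero_smul, zero_smul, add_zero, add_zero]
  refine ⟨J, ⟨?_, ?_, ?_, ?_⟩, ?_⟩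
  · intro i x hx
    by_cases h0 : i = 0
    · subst h0
      rw [hJ0, Submodule.span_span_of_tower] at hx
      obtain ⟨a, b, rfl⟩ := Submodule.mem_span_pair.1 hx
      rw [zpow_zero]
      constructor
      · intro hx y hy
        rw [bil, norm_half_le_iff, norm_one]
        rw [hJ0] at hx hy
        obtain ⟨a', b', ha', hb', hab⟩ := mem_span_pair_coe hx
        obtain ⟨c, d, hc, hd, rfl⟩ := mem_span_pair_coe hy
        rw [hab]
        simp only [QuadraticMap.polar_add_left, QuadraticMap.polar_add_right,
          QuadraticMap.polar_smul_left, QuadraticMap.polar_smul_right, hee, hff, hef, hfe,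
          smul_eq_mul, mul_zero, mul_one, add_zero, zero_add]
        exact integral_add (integral_mul hc hb') (integral_mul hd ha')
      · intro hx
        have h1 := hx e heJ
        have h2 := hx f hfJ
        rw [bil, norm_half_le_iff, norm_one] at h1 h2
        simp only [QuadraticMap.polar_add_left, QuadraticMap.polar_smul_left, hee, hff, hef, hfe,
          smul_eq_mul, mul_zero, mul_one, add_zero, zero_add] at h1 h2
        exact add_mem (smul_mem_of_norm_le h2 heJ) (smul_mem_of_norm_le h1 hfJ)
    · by_cases hik : i = k
      · subst hik
        rw [hJk, Submodule.span_span_of_tower] at hx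
        obtain ⟨a, rfl⟩ := Submodule.mem_span_singleton.1 hx
        constructor
        · intro hx y hy
          rw [bil, norm_half_le_iff, hpk]
          rw [hJk] at hx hy
          obtain ⟨a', ha', hab⟩ := mem_span_singleton_coe hx
          obtain ⟨c, hc, rfl⟩ := mem_span_singleton_coe hy
          rw [hab, QuadraticMap.polar_smul_left, QuadraticMap.polar_smul_right, polar_self_eq,
            smul_eq_mul, smul_eq_mul, ← mul_assoc, norm_mul]
          exact mul_le_of_le_one_left (norm_nonneg _) (integral_mul ha' hc)
        · intro hx
          have h1 := hx g hgJ
          rw [bil, norm_half_le_iff, hpk, QuadraticMap.polar_smul_left, polar_self_eq, smul_eq_mul,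
            norm_mul] at h1
          have h2 : ‖a‖ ≤ 1 := (mul_le_iff_le_one_left (norm_pos_iff.2 h2g)).1 h1
          exact smul_mem_of_norm_le h2 hgJ
      · rw [hJ i h0 hik] at hx ⊢
        have hx0 : x = 0 := by
          rw [Submodule.bot_coe, Submodule.span_singleton_eq_bot.2 rfl, Submodule.mem_bot] at hx
          exact hx
        rw [hx0]
        refine iff_of_true (zero_mem _) fun y _ => ?_
        rw [bil, QuadraticMap.polar_zero_left, zero_div, norm_zero]
        exact norm_nonneg _
  · intro i j hij x hx y hy
    rw [bil, hort i j hij x hx y hy, zero_div]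
  · intro i
    rw [Submodule.disjoint_def]
    intro x hx hx'
    have hperp : ∀ y ∈ J i, QuadraticMap.polar Q y x = 0 := by
      intro y hy
      have hsup : ⨆ j, ⨆ (_ : j ≠ i), J j ≤
          LinearMap.ker ((QuadraticMap.polarBilin Q y).restrictScalars ℤ_[p]) :=
        iSup₂_le fun j hj z hz => hort i j hj.symm y hy z hz
      exact hsup hx'
    have hall : ∀ j, ∀ y ∈ J j, QuadraticMap.polar Q y x = 0 := by
      intro j y hy
      by_cases hij : j = i
      · subst hij
        exact hperp y hy
      · exact hort j i hij y hy x hx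
    exact hnondeg x (hle i hx) (hall _ e heJ) (hall _ f hfJ) (hall _ g hgJ)
  · refine le_antisymm (iSup_le hle) (triple_le ?_ ?_ ?_)
    exacts [Submodule.mem_iSup_of_mem 0 heJ, Submodule.mem_iSup_of_mem 0 hfJ,
      Submodule.mem_iSup_of_mem k hgJ]
  · have hli : LinearIndependent ℤ_[p] ![e, f] := by
      rw [LinearIndependent.pair_iff]
      intro a b hab
      have h1 := congrArg (QuadraticMap.polar Q e) hab
      have h2 := congrArg (QuadraticMap.polar Q f) hab
      simp only [← coe_smul_eq, QuadraticMap.polar_add_right, QuadraticMap.polar_smul_right, hee,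
        hff, hef, hfe, smul_eq_mul, mul_zero, mul_one, add_zero, zero_add,
        QuadraticMap.polar_zero_right, PadicInt.coe_eq_zero] at h1 h2
      exact ⟨h2, h1⟩
    have h3 := finrank_span_eq_card hli
    rw [Matrix.range_cons, Matrix.range_cons, Matrix.range_empty, Set.union_empty,
      Set.singleton_union, Fintype.card_fin] at h3
    rw [hJ0]
    exact h3

/-- If `M` lies in the radical of `N` modulo `p` and `N / M` is cyclic of order `p`, then the
`(1/2)ℤ_p`-modular components of `N` have rank at most one, since they meet `M` in their multiples
of `p`. -/
theorem finrank_ne_two_of_radical {x₁ x₂ x₃ : E}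
    (hrad : ∀ t ∈ triple (p := p) x₁ x₂ ((p : ℚ_[p]) • x₃), ∀ y ∈ triple (p := p) x₁ x₂ x₃,
      ‖QuadraticMap.polar Q t y‖ < 1)
    {J : ℤ → Submodule ℤ_[p] E} (hJ : IsJordanDecomposition Q (triple x₁ x₂ x₃) J) :
    Module.finrank ℤ_[p] (J 0) ≠ 2 := by
  intro hrank
  set N := triple (p := p) x₁ x₂ x₃ with hN
  set M := triple (p := p) x₁ x₂ ((p : ℚ_[p]) • x₃) with hM
  have hp : (p : ℚ_[p]) ≠ 0 := by exact_mod_cast (Fact.out : p.Prime).ne_zero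
  have hJN : J 0 ≤ N := by
    rw [← hJ.2.2.2]
    exact le_iSup J 0
  -- vectors of the component that lie in `M` are divisible by `p`
  have hdiv : ∀ w ∈ J 0, w ∈ M → (p : ℚ_[p])⁻¹ • w ∈ J 0 := by
    intro w hw hwM
    refine (hJ.1 0 _ (Submodule.smul_mem _ _ (Submodule.subset_span hw))).2 fun y hy => ?_
    rw [bil, zpow_zero, norm_half_le_iff, norm_one, QuadraticMap.polar_smul_left, smul_eq_mul,
      ← div_eq_inv_mul]
    exact norm_div_p_le_one (hrad w hwM y (hJN hy))
  have hNM : ∀ u ∈ N, ∀ v ∈ N, u ∈ M ∨ ∃ c : ℤ_[p], v - c • u ∈ M := by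
    intro u hu v hv
    obtain ⟨a, b, c, ha, hb, hc, rfl⟩ := mem_triple.1 hu
    obtain ⟨a', b', c', ha', hb', hc', rfl⟩ := mem_triple.1 hv
    have hmem : ∀ a b : ℚ_[p], ‖a‖ ≤ 1 → ‖b‖ ≤ 1 → a • x₁ + b • x₂ ∈ M := fun a b ha hb =>
      add_mem (smul_mem_of_norm_le ha (triple_fst _ _ _))
        (smul_mem_of_norm_le hb (triple_snd _ _ _))
    rcases hc.lt_or_eq with h | h
    · exact Or.inl (add_mem (hmem a b ha hb) (smul_mem_of_norm_lt h (triple_trd _ _ _)))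
    · right
      have hc0 : c ≠ 0 := fun h0 => by rw [h0, norm_zero] at h; exact zero_ne_one h
      obtain ⟨d, hd⟩ := exists_padicInt_coe_eq (a := c' / c) (by rwa [norm_div, h, div_one])
      refine ⟨d, ?_⟩
      have h1 : (a' • x₁ + b' • x₂ + c' • x₃) - d • (a • x₁ + b • x₂ + c • x₃) =
          (a' • x₁ + b' • x₂) - (d : ℚ_[p]) • (a • x₁ + b • x₂) := by
        rw [← coe_smul_eq, smul_add (d : ℚ_[p]) (a • x₁ + b • x₂), smul_smul (d : ℚ_[p]) c, hd,
          div_mul_cancel₀ _ hc0]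
        abel
      rw [h1]
      exact sub_mem (hmem a' b' ha' hb') (smul_mem_of_norm_le d.2 (hmem a b ha hb))
  have hfree : Module.IsTorsionFree ℤ_[p] E := Module.IsTorsionFree.trans_faithfulSMul ℤ_[p] ℚ_[p] E
  have hfin : Module.Finite ℤ_[p] (J 0) := by
    have : IsNoetherian ℤ_[p] N :=
      isNoetherian_of_fg_of_noetherian N (Submodule.fg_span (Set.toFinite _))
    exact Module.Finite.of_injective (Submodule.inclusion hJN) (Submodule.inclusion_injective hJN)
  let b := Module.finBasisOfFinrankEq ℤ_[p] (J 0) hrank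
  have hcontra : ∀ (w w' : J 0) (i : Fin 2), (w : E) = (p : ℚ_[p]) • (w' : E) →
      b.repr w i ≠ 1 := by
    intro w w' i hw h1
    have hw2 : w = (p : ℤ_[p]) • w' := Subtype.ext (by
      rw [hw, Submodule.coe_smul, ← coe_smul_eq, PadicInt.coe_natCast])
    rw [hw2, map_smul, Finsupp.smul_apply, smul_eq_mul] at h1
    have h2 := congrArg norm h1
    rw [norm_one] at h2
    have h3 : ‖(p : ℤ_[p]) * b.repr w' i‖ < 1 := by
      rw [mul_comm]
      exact PadicInt.norm_lt_one_mul (by rw [PadicInt.norm_p]; exact inv_lt_one_of_one_lt₀ (by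
        exact_mod_cast (Fact.out : p.Prime).one_lt))
    exact h3.ne h2
  -- modulo `M`, one of two basis vectors of the component is a multiple of the other, so some basis
  -- vector would be divisible by `p`
  rcases hNM (b 0) (hJN (b 0).2) (b 1) (hJN (b 1).2) with h | ⟨c, h⟩
  · refine hcontra (b 0) ⟨_, hdiv _ (b 0).2 h⟩ 0 ?_ (by simp)
    rw [smul_smul, mul_inv_cancel₀ hp, one_smul]
  · refine hcontra (b 1 - c • b 0) ⟨_, hdiv _ (b 1 - c • b 0).2 h⟩ 1 ?_ (by simp)
    rw [smul_smul, mul_inv_cancel₀ hp, one_smul]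

end LocalSpinor

/-! ### Sublattices of square-free index -/

section Sublattice

variable {V : Type*} [AddCommGroup V]

/-- Two diagonal entries `a, b` of a diagonal basis of a sublattice can be replaced by `1, a * b`
if they are coprime. -/
theorem span_pair_coprime (u v : V) {a b s t : ℤ} (h : s * a + t * b = 1) :
    Submodule.span ℤ {u, v} = Submodule.span ℤ {a • u + b • v, -t • u + s • v} ∧
    Submodule.span ℤ {a • u, b • v} =
      Submodule.span ℤ {a • u + b • v, (a * b) • (-t • u + s • v)} := by
  have hle : ∀ {x y x' y' : V}, x ∈ Submodule.span ℤ {x', y'} → y ∈ Submodule.span ℤ {x', y'} →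
      Submodule.span ℤ {x, y} ≤ Submodule.span ℤ {x', y'} := by
    intro x y x' y' hx hy
    rw [Submodule.span_le]
    rintro z (rfl | rfl)
    exacts [hx, hy]
  constructor
  · refine le_antisymm (hle ?_ ?_) (hle ?_ ?_) <;> rw [Submodule.mem_span_pair]
    · refine ⟨s, -b, ?_⟩
      match_scalars <;> first | ring1 | linear_combination h
    · refine ⟨t, a, ?_⟩
      match_scalars <;> first | ring1 | linear_combination h
    · exact ⟨a, b, rfl⟩
    · exact ⟨-t, s, rfl⟩
  · refine le_antisymm (hle ?_ ?_) (hle ?_ ?_) <;> rw [Submodule.mem_span_pair]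
    · refine ⟨s * a, -1, ?_⟩
      match_scalars <;> first | ring1 | linear_combination a * h
    · refine ⟨t * b, 1, ?_⟩
      match_scalars <;> first | ring1 | linear_combination b * h
    · exact ⟨1, 1, by rw [one_smul, one_smul]⟩
    · refine ⟨-(t * b), s * a, ?_⟩
      match_scalars <;> ring

theorem span_triple_congr {u v u' v' : V} (w : V)
    (h : Submodule.span ℤ {u, v} = Submodule.span ℤ {u', v'}) :
    Submodule.span ℤ {w, u, v} = Submodule.span ℤ {w, u', v'} := by
  rw [Submodule.span_insert, h, ← Submodule.span_insert]

theorem span_triple_rotate (u v w : V) :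
    Submodule.span ℤ {u, v, w} = Submodule.span ℤ {w, u, v} := by
  congr 1
  ext x
  simp only [Set.mem_insert_iff, Set.mem_singleton_iff]
  tauto

/-- A lattice with diagonal basis `a₀u, a₁v, a₂w` has one with entries `1, 1, a₀a₁a₂` if the `aᵢ`
are pairwise coprime. -/
theorem exists_span_triple_coprime (u v w : V) {a₀ a₁ a₂ : ℤ} (h01 : IsCoprime a₀ a₁)
    (h2 : IsCoprime (a₀ * a₁) a₂) : ∃ u' v' w' : V,
      Submodule.span ℤ {u, v, w} = Submodule.span ℤ {u', v', w'} ∧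
      Submodule.span ℤ {a₀ • u, a₁ • v, a₂ • w} =
        Submodule.span ℤ {u', v', (a₀ * a₁ * a₂) • w'} := by
  obtain ⟨s, t, h⟩ := h01
  obtain ⟨s', t', h'⟩ := h2
  obtain ⟨e1, e2⟩ := span_pair_coprime u v h
  obtain ⟨e3, e4⟩ := span_pair_coprime (-t • u + s • v) w h'
  refine ⟨a₀ • u + a₁ • v, (a₀ * a₁) • (-t • u + s • v) + a₂ • w,
    -t' • (-t • u + s • v) + s' • w, ?_, ?_⟩
  · rw [span_triple_rotate, span_triple_congr w e1, ← span_triple_rotate,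
      span_triple_congr _ e3]
  · rw [span_triple_rotate, span_triple_congr _ e2, ← span_triple_rotate,
      span_triple_congr _ e4]

theorem exists_basis_of_span [Module ℚ V] {N : Submodule ℤ V} (b : Module.Basis (Fin 3) ℤ N)
    {u v w : V} (h : N = Submodule.span ℤ {u, v, w}) :
    ∃ x : Module.Basis (Fin 3) ℤ N, (x 0 : V) = u ∧ (x 1 : V) = v ∧ (x 2 : V) = w := by
  have hu : u ∈ N := by rw [h]; exact Submodule.subset_span (by simp)
  have hv : v ∈ N := by rw [h]; exact Submodule.subset_span (by simp)
  have hw : w ∈ N := by rw [h]; exact Submodule.subset_span (by simp)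
  have : Module.Free ℤ N := Module.Free.of_basis b
  have hf : Module.finrank ℤ N = 3 := by rw [Module.finrank_eq_card_basis b, Fintype.card_fin]
  let y : Fin 3 → N := ![⟨u, hu⟩, ⟨v, hv⟩, ⟨w, hw⟩]
  have htop : ⊤ ≤ Submodule.span ℤ (Set.range y) := by
    intro z _
    obtain ⟨a, b, c, habc⟩ := Submodule.mem_span_triple.1 (h.le z.2)
    have : z = a • y 0 + b • y 1 + c • y 2 := Subtype.ext habc.symm
    rw [this]
    exact add_mem (add_mem (Submodule.smul_mem _ _ (Submodule.subset_span ⟨0, rfl⟩))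
      (Submodule.smul_mem _ _ (Submodule.subset_span ⟨1, rfl⟩)))
      (Submodule.smul_mem _ _ (Submodule.subset_span ⟨2, rfl⟩))
  refine ⟨basisOfTopLeSpanOfCardEqFinrank y htop (by rw [Fintype.card_fin, hf]), ?_⟩
  rw [coe_basisOfTopLeSpanOfCardEqFinrank]
  exact ⟨rfl, rfl, rfl⟩

variable [Module ℚ V]

/-- A sublattice of square-free index `n` has a cyclic quotient, hence is of the form
`ℤ x₁ + ℤ x₂ + ℤ (n x₃)`: the elementary divisors are pairwise coprime. -/
theorem exists_basis_eq_sublattice (h3 : Module.finrank ℚ V = 3) {N M : Submodule ℤ V}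
    [N.IsLattice ℚ] [M.IsLattice ℚ] (hle : M ≤ N) {n : ℕ} (hn : Squarefree n)
    (hidx : M.toAddSubgroup.relIndex N.toAddSubgroup = n) :
    ∃ x : Module.Basis (Fin 3) ℤ N, M = sublattice x n := by
  obtain ⟨bN⟩ := exists_int_basis h3 N
  obtain ⟨bM⟩ := exists_int_basis h3 M
  obtain ⟨b, a, ab, hab⟩ := Submodule.exists_smith_normal_form_of_rank_eq bN
    (N := M.comap N.subtype) (by
      rw [(Submodule.comapSubtypeEquivOfLe hle).finrank_eq, Module.finrank_eq_card_basis bM,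
        Module.finrank_eq_card_basis bN])
  let bM' : Module.Basis (Fin 3) ℤ M := ab.map (Submodule.comapSubtypeEquivOfLe hle)
  have hbM' : ∀ i, (bM' i : V) = a i • (b i : V) := fun i => congrArg Subtype.val (hab i)
  have hprod : (a 0 * a 1 * a 2).natAbs = n := by
    rw [← hidx, AddSubgroup.relIndex_eq_natAbs_det M.toAddSubgroup N.toAddSubgroup hle bM' b]
    have : (fun i => (⟨bM' i, hle (SetLike.coe_mem (bM' i))⟩ : N)) = fun i => a i • b i :=
      funext fun i => Subtype.ext (hbM' i)
    change _ = (b.det (fun i => (⟨bM' i, hle (SetLike.coe_mem (bM' i))⟩ : N))).natAbs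
    rw [this, AlternatingMap.map_smul_univ, b.det_self, Fin.prod_univ_three, smul_eq_mul, mul_one]
  have hsq : Squarefree (a 0 * a 1 * a 2) := by
    rw [← Int.squarefree_natAbs, hprod]
    exact hn
  have hN : N = Submodule.span ℤ {(b 0 : V), (b 1 : V), (b 2 : V)} := by
    conv_lhs => rw [← span_range_coe_basis b]
    congr 1
    ext z
    simp only [Set.mem_range, Fin.exists_fin_succ, Set.mem_insert_iff, Set.mem_singleton_iff]
    simp [eq_comm]
  have hM : M = Submodule.span ℤ {a 0 • (b 0 : V), a 1 • (b 1 : V), a 2 • (b 2 : V)} := by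
    conv_lhs => rw [← span_range_coe_basis bM']
    congr 1
    ext z
    simp only [hbM', Set.mem_range, Fin.exists_fin_succ, Set.mem_insert_iff,
      Set.mem_singleton_iff]
    simp [eq_comm]
  obtain ⟨u, v, w, e1, e2⟩ := exists_span_triple_coprime (b 0 : V) (b 1 : V) (b 2 : V)
    (squarefree_mul_iff.1 (squarefree_mul_iff.1 hsq).2.1).1.isCoprime
    (squarefree_mul_iff.1 hsq).1.isCoprime
  obtain ⟨x, rfl, rfl, rfl⟩ := exists_basis_of_span bN (hN.trans e1)
  refine ⟨x, ?_⟩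
  rw [hM, e2, sublattice]
  rcases Int.natAbs_eq (a 0 * a 1 * a 2) with h | h <;> rw [hprod] at h <;> rw [h]
  · rw [natCast_zsmul]
  · rw [neg_smul, natCast_zsmul, Submodule.span_insert, Submodule.span_insert,
      ← Set.neg_singleton, Submodule.span_neg, ← Submodule.span_insert, ← Submodule.span_insert]

/-- The discriminants of a lattice and a sublattice differ by the square of the index. -/
theorem disc_eq_relIndex_sq_mul (h3 : Module.finrank ℚ V = 3) (Q : QuadraticForm ℚ V)
    {N M : Submodule ℤ V} [N.IsLattice ℚ] [M.IsLattice ℚ] (hle : M ≤ N) :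
    disc Q M = (M.toAddSubgroup.relIndex N.toAddSubgroup : ℚ) ^ 2 * disc Q N := by
  obtain ⟨b⟩ := exists_int_basis h3 N
  obtain ⟨b'⟩ := exists_int_basis h3 M
  set c : Fin 3 → N := fun i => ⟨b' i, hle (b' i).2⟩ with hc
  have hdet : M.toAddSubgroup.relIndex N.toAddSubgroup = (b.det c).natAbs :=
    AddSubgroup.relIndex_eq_natAbs_det M.toAddSubgroup N.toAddSubgroup hle b' b
  have hd := disc_eq Q N b
  have hd' := disc_eq Q M b'
  rw [← gram] at hd hd'
  have hP : ∀ j, (b' j : V) = ∑ i, ((b.toMatrix c).map (Int.cast : ℤ → ℚ)) i j • (b i : V) := by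
    intro j
    have h1 := congrArg (Subtype.val) (b.sum_toMatrix_smul_self c j)
    rw [AddSubmonoidClass.coe_finsetSum] at h1
    refine h1.symm.trans (Finset.sum_congr rfl fun i _ => ?_)
    exact (Int.cast_smul_eq_zsmul ℚ (b.toMatrix c i j) (b i : V)).symm
  rw [hd, hd', gram_eq Q _ _ hP, ← Int.cast_det, ← Module.Basis.det_apply, hdet, Nat.cast_natAbs,
    Int.cast_abs, sq_abs, sq]

theorem sublattice_le {N : Submodule ℤ V} (x : Module.Basis (Fin 3) ℤ N) (k : ℕ) :
    sublattice x k ≤ N := by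
  rw [sublattice, Submodule.span_le]
  rintro z (rfl | rfl | rfl)
  exacts [(x 0).2, (x 1).2, nsmul_mem (x 2).2 k]

theorem smul_mem_sublattice {N : Submodule ℤ V} (x : Module.Basis (Fin 3) ℤ N) (k : ℕ) {z : V}
    (hz : z ∈ N) : k • z ∈ sublattice x k := by
  have h0 : (x 0 : V) ∈ sublattice x k := Submodule.subset_span (by simp)
  have h1 : (x 1 : V) ∈ sublattice x k := Submodule.subset_span (by simp)
  have h2 : k • (x 2 : V) ∈ sublattice x k := Submodule.subset_span (by simp)
  have hz' := congrArg Subtype.val (x.sum_repr ⟨z, hz⟩)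
  rw [Fin.sum_univ_three, Submodule.coe_add, Submodule.coe_add, Submodule.coe_smul,
    Submodule.coe_smul, Submodule.coe_smul] at hz'
  rw [← show _ = z from hz', smul_add, smul_add, smul_comm k, smul_comm k, smul_comm k]
  exact add_mem (add_mem (Submodule.smul_mem _ _ (nsmul_mem h0 k))
    (Submodule.smul_mem _ _ (nsmul_mem h1 k))) (Submodule.smul_mem _ _ h2)

theorem isLattice_sublattice {N : Submodule ℤ V} [N.IsLattice ℚ] (x : Module.Basis (Fin 3) ℤ N)
    {k : ℕ} (hk : k ≠ 0) : (sublattice x k).IsLattice ℚ :=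
  isLattice_of_smul_mem hk (fun _ hz => smul_mem_sublattice x k hz)
    fun _ hz => nsmul_mem (sublattice_le x k hz) k

end Sublattice

/-! ### Localizations of sublattices -/

section LocalSublattice

theorem triple_smul_congr {p : ℕ} [Fact p.Prime] {E : Type*} [AddCommGroup E] [Module ℚ_[p] E]
    [Module ℤ_[p] E] [IsScalarTower ℤ_[p] ℚ_[p] E] (u v w : E) {c d : ℚ_[p]} (h : ‖c‖ = ‖d‖)
    (hd : d ≠ 0) : triple (p := p) u v (c • w) = triple u v (d • w) := by
  have hc : c ≠ 0 := norm_pos_iff.1 (h ▸ norm_pos_iff.2 hd)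
  have key : ∀ {c d : ℚ_[p]}, ‖c‖ = ‖d‖ → d ≠ 0 → triple (p := p) u v (c • w) ≤
      triple u v (d • w) := by
    intro c d h hd
    refine triple_le (triple_fst _ _ _) (triple_snd _ _ _) ?_
    have h1 : c • w = (c / d) • (d • w) := by rw [smul_smul, div_mul_cancel₀ _ hd]
    rw [h1]
    refine smul_mem_of_norm_le ?_ (triple_trd _ _ _)
    rw [norm_div, h, div_self (norm_ne_zero_iff.2 hd)]
  exact le_antisymm (key h hd) (key h.symm hc)

variable {V : Type*} [AddCommGroup V] [Module ℚ V] {N : Submodule ℤ V}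
  (x : Module.Basis (Fin 3) ℤ N) (p : ℕ) [Fact p.Prime]

theorem localization_eq_triple : localization p N =
    triple ((1 : ℚ_[p]) ⊗ₜ[ℚ] (x 0 : V)) ((1 : ℚ_[p]) ⊗ₜ[ℚ] (x 1 : V))
      ((1 : ℚ_[p]) ⊗ₜ[ℚ] (x 2 : V)) := by
  rw [localization_eq_span p x, triple]
  congr 1
  ext z
  simp only [Set.mem_range, Fin.exists_fin_succ, Set.mem_insert_iff, Set.mem_singleton_iff]
  simp [eq_comm]

theorem localization_sublattice (k : ℕ) : localization p (sublattice x k) =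
    triple ((1 : ℚ_[p]) ⊗ₜ[ℚ] (x 0 : V)) ((1 : ℚ_[p]) ⊗ₜ[ℚ] (x 1 : V))
      ((k : ℚ_[p]) • ((1 : ℚ_[p]) ⊗ₜ[ℚ] (x 2 : V))) := by
  have hr : sublattice x k =
      Submodule.span ℤ (Set.range ![(x 0 : V), (x 1 : V), k • (x 2 : V)]) := by
    rw [sublattice, Matrix.range_cons, Matrix.range_cons, Matrix.range_cons, Matrix.range_empty,
      Set.union_empty]
    rfl
  rw [hr, localization_span_range, triple]
  have hk : (k : ℚ_[p]) • ((1 : ℚ_[p]) ⊗ₜ[ℚ] (x 2 : V)) = (1 : ℚ_[p]) ⊗ₜ[ℚ] (k • (x 2 : V)) := by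
    rw [natCast_tmul, ← coe_smul_eq, PadicInt.coe_natCast]
  rw [hk]
  congr 1
  ext z
  simp only [Set.mem_range, Fin.exists_fin_succ, Set.mem_insert_iff, Set.mem_singleton_iff]
  simp [eq_comm]

/-- Away from `k`, the lattice `ℤ x₁ + ℤ x₂ + ℤ (k x₃)` agrees with `N`. -/
theorem localization_sublattice_of_not_dvd {k : ℕ} (hk : ¬ p ∣ k) :
    localization p (sublattice x k) = localization p N := by
  have h1 : ‖(k : ℚ_[p])‖ = ‖(1 : ℚ_[p])‖ := by
    have := norm_natCast_eq_one p hk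
    rw [PadicInt.norm_def, PadicInt.coe_natCast] at this
    rw [this, norm_one]
  rw [localization_sublattice, triple_smul_congr _ _ _ h1 one_ne_zero, one_smul,
    localization_eq_triple x]

theorem localization_sublattice_of_dvd {k : ℕ} (hk : Squarefree k) (h : p ∣ k) :
    localization p (sublattice x k) =
    triple ((1 : ℚ_[p]) ⊗ₜ[ℚ] (x 0 : V)) ((1 : ℚ_[p]) ⊗ₜ[ℚ] (x 1 : V))
      ((p : ℚ_[p]) • ((1 : ℚ_[p]) ⊗ₜ[ℚ] (x 2 : V))) := by
  have hp : p.Prime := Fact.out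
  obtain ⟨m, rfl⟩ := h
  have hm : ¬ p ∣ m := fun hm =>
    hp.one_lt.ne' (Nat.isUnit_iff.1 (hk p (mul_dvd_mul_left p hm)))
  have h1 : ‖((p * m : ℕ) : ℚ_[p])‖ = ‖(p : ℚ_[p])‖ := by
    have := norm_natCast_eq_one p hm
    rw [PadicInt.norm_def, PadicInt.coe_natCast] at this
    rw [Nat.cast_mul, norm_mul, this, mul_one]
  rw [localization_sublattice, triple_smul_congr _ _ _ h1 (by exact_mod_cast hp.ne_zero)]

end LocalSublattice

/-! ### Local comparison of the stabilizers -/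

section LocalPair

variable {p : ℕ} [Fact p.Prime] {E : Type*} [AddCommGroup E] [Module ℚ_[p] E] [Module ℤ_[p] E]
  [IsScalarTower ℤ_[p] ℚ_[p] E] (Q : QuadraticForm ℚ_[p] E)

/-- If `τ` maps one lattice onto another, it can be modified by a stabilizer so as to carry along
sublattices of index `p` on which `Q` vanishes modulo `p`. -/
theorem exists_stabilizer_mul_act_eq {x₁ x₂ x₃ y₁ y₂ y₃ : E}
    (hN : ∀ t ∈ triple (p := p) x₁ x₂ x₃, ‖Q t‖ ≤ 1)
    (hM : ∀ t ∈ triple (p := p) x₁ x₂ ((p : ℚ_[p]) • x₃), ‖Q t‖ < 1)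
    (hprim : ∃ t ∈ triple (p := p) x₁ x₂ x₃, ‖Q t‖ = 1)
    (hM' : ∀ t ∈ triple (p := p) y₁ y₂ ((p : ℚ_[p]) • y₃), ‖Q t‖ < 1)
    {τ : E ≃ₗ[ℚ_[p]] E} (hτ : τ ∈ orthogonalGroup Q)
    (hxy : triple y₁ y₂ y₃ = act τ (triple (p := p) x₁ x₂ x₃)) :
    ∃ μ ∈ orthogonalGroup Q, act μ (triple x₁ x₂ x₃) = triple (p := p) x₁ x₂ x₃ ∧
      act (τ * μ) (triple x₁ x₂ ((p : ℚ_[p]) • x₃)) =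
        triple (p := p) y₁ y₂ ((p : ℚ_[p]) • y₃) := by
  have hpN : ‖(p : ℚ_[p])‖ ≤ 1 := Padic.norm_p_lt_one.le
  have h1 := triple_fst (p := p) y₁ y₂ ((p : ℚ_[p]) • y₃)
  have h2 := triple_snd (p := p) y₁ y₂ ((p : ℚ_[p]) • y₃)
  have h3 := triple_trd (p := p) y₁ y₂ ((p : ℚ_[p]) • y₃)
  have hmem : ∀ z, z ∈ act τ⁻¹ (triple (p := p) y₁ y₂ ((p : ℚ_[p]) • y₃)) ↔
      τ z ∈ triple (p := p) y₁ y₂ ((p : ℚ_[p]) • y₃) := fun z => by rw [mem_act, inv_inv]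
  have hτN : ∀ z, z ∈ triple (p := p) x₁ x₂ x₃ ↔ τ z ∈ triple (p := p) y₁ y₂ y₃ := fun z => by
    rw [hxy, apply_mem_act]
  have hex : ∃ μ ∈ orthogonalGroup Q, act μ (triple x₁ x₂ x₃) = triple (p := p) x₁ x₂ x₃ ∧
      act μ (triple x₁ x₂ ((p : ℚ_[p]) • x₃)) =
        act τ⁻¹ (triple (p := p) y₁ y₂ ((p : ℚ_[p]) • y₃)) := by
    refine exists_isometry_sublattice Q hN hM hprim (y := τ⁻¹ y₃) ?_ ?_ ?_ ?_ ?_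
    · intro z hz
      rw [hmem] at hz
      rw [hτN]
      exact triple_le (triple_fst _ _ _) (triple_snd _ _ _)
        (smul_mem_of_norm_le hpN (triple_trd _ _ _)) hz
    · intro z hz
      rw [hmem] at hz
      rw [← hτ z]
      exact hM' _ hz
    · intro z hz
      rw [hmem, map_smul]
      rw [hτN] at hz
      obtain ⟨a, b, c, ha, hb, hc, h⟩ := mem_triple.1 hz
      rw [h, smul_add, smul_add, smul_comm _ c]
      exact add_mem (add_mem (smul_mem_of_norm_le hpN (smul_mem_of_norm_le ha h1))
        (smul_mem_of_norm_le hpN (smul_mem_of_norm_le hb h2))) (smul_mem_of_norm_le hc h3)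
    · rw [hτN]
      have h4 : τ (τ⁻¹ y₃) = y₃ := τ.apply_symm_apply y₃
      rw [h4]
      exact triple_trd y₁ y₂ y₃
    · intro z hz
      rw [hτN] at hz
      obtain ⟨a, b, c, ha, hb, hc, h⟩ := mem_triple.1 hz
      refine ⟨τ⁻¹ (a • y₁ + b • y₂), ?_, c, hc, ?_⟩
      · rw [hmem]
        have h4 : τ (τ⁻¹ (a • y₁ + b • y₂)) = a • y₁ + b • y₂ := τ.apply_symm_apply _
        rw [h4]
        exact add_mem (smul_mem_of_norm_le ha h1) (smul_mem_of_norm_le hb h2)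
      · rw [← map_smul, ← map_add, ← h]
        exact (τ.symm_apply_apply z).symm
  obtain ⟨μ, hμ, hμN, hμM⟩ := hex
  refine ⟨μ, hμ, hμN, ?_⟩
  rw [act_mul, hμM, ← act_mul, mul_inv_cancel, act_one]

end LocalPair

section Comparison

variable {V : Type*} [AddCommGroup V] [Module ℚ V] {Q : QuadraticForm ℚ V} {N : Submodule ℤ V}

theorem norm_localForm_le_one (hN : IsIntegral Q N) (p : ℕ) [Fact p.Prime] {y : ℚ_[p] ⊗[ℚ] V}
    (hy : y ∈ localization p N) : ‖localForm p Q y‖ ≤ 1 := by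
  refine norm_localForm_le Q (fun z hz => ?_) hy
  obtain ⟨k, hk⟩ := hN z hz
  rw [hk, Rat.cast_intCast]
  exact Padic.norm_int_le_one k

theorem norm_localForm_lt_one {M : Submodule ℤ V} {n : ℕ} (hM : ∀ z ∈ M, ∃ k : ℤ, Q z = n * k)
    (p : ℕ) [Fact p.Prime] (hp : p ∣ n) {y : ℚ_[p] ⊗[ℚ] V} (hy : y ∈ localization p M) :
    ‖localForm p Q y‖ < 1 := by
  refine (norm_localForm_le Q (ε := ‖(p : ℚ_[p])‖) (fun z hz => ?_) hy).trans_lt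
    Padic.norm_p_lt_one
  obtain ⟨k, hk⟩ := hM z hz
  obtain ⟨m, rfl⟩ := hp
  rw [hk]
  push_cast
  rw [mul_assoc, norm_mul]
  refine mul_le_of_le_one_right (norm_nonneg _) ?_
  exact_mod_cast Padic.norm_int_le_one (p := p) (m * k)

theorem exists_norm_localForm_eq_one {n : ℕ} (h : NormPrimeTo Q N n) (p : ℕ) [Fact p.Prime]
    (hp : p ∣ n) : ∃ y ∈ localization p N, ‖localForm p Q y‖ = 1 := by
  obtain ⟨z, hz, k, hk, hpk⟩ := h p Fact.out hp
  refine ⟨_, tmul_mem_localization p hz, ?_⟩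
  rw [localForm_one_tmul, hk, Rat.cast_intCast]
  refine le_antisymm (Padic.norm_int_le_one k) (not_lt.1 fun hlt => hpk ?_)
  exact Padic.norm_intCast_lt_one_iff.1 hlt

theorem padicValRat_eq_valuation {p : ℕ} [Fact p.Prime] {q : ℚ} {y : ℚ_[p]} (hq : q ≠ 0)
    (h : ‖(q : ℚ_[p])‖ = ‖y‖) : padicValRat p q = y.valuation := by
  have hq0 : (q : ℚ_[p]) ≠ 0 := Rat.cast_ne_zero.2 hq
  have hy : y ≠ 0 := norm_ne_zero_iff.1 (h ▸ norm_ne_zero_iff.2 hq0)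
  have hp : (1 : ℝ) < p := by exact_mod_cast (Fact.out : p.Prime).one_lt
  rw [Padic.eq_padicNorm, padicNorm.eq_zpow_of_nonzero hq, Padic.norm_eq_zpow_neg_valuation hy] at h
  push_cast at h
  exact neg_injective (zpow_right_injective₀ (by linarith) hp.ne' h)

/-- At a prime `p` dividing `n`, every local isometry that fixes `N` or `M = ℤ x₁ + ℤ x₂ + ℤ (n x₃)`
is, up to the spinor kernel, an isometry that fixes `L = ℤ x₁ + ℤ x₂ + ℤ (k x₃)`. If the
`(1/2)ℤ_p`-modular component of `N_p` does not have rank two, then `L_p = M_p` is characterised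
within `N_p` as the set of vectors where `Q` is divisible by `p`; otherwise `L_p` is the one of
`N_p, M_p` for which the spinor norms of the stabilizer exhaust all of `ℚ_pˣ`. -/
theorem exists_stabilizer_mul_spinorKernel_of_dvd (hQ : Q.PosDef) (h3 : Module.finrank ℚ V = 3)
    [N.IsLattice ℚ] (x : Module.Basis (Fin 3) ℤ N) {n k : ℕ} (hn : Squarefree n)
    (hk : Squarefree k) (hN : IsIntegral Q N) (hM : ∀ z ∈ sublattice x n, ∃ k : ℤ, Q z = n * k)
    (hprim : NormPrimeTo Q N n) (p : ℕ) [Fact p.Prime] (hp : p ∣ n)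
    (hpk : p ∣ k ↔ (¬ HalfModularRankTwo Q N p ∨ Even (padicValRat p (4 * disc Q N))))
    {ν : (ℚ_[p] ⊗[ℚ] V) ≃ₗ[ℚ_[p]] (ℚ_[p] ⊗[ℚ] V)} (hν : ν ∈ orthogonalGroup (localForm p Q))
    (hstab : act ν (localization p N) = localization p N ∨
      act ν (localization p (sublattice x n)) = localization p (sublattice x n)) :
    ∃ κ ∈ orthogonalGroup (localForm p Q),
      act κ (localization p (sublattice x k)) = localization p (sublattice x k) ∧
        κ⁻¹ * ν ∈ spinorKernel (localForm p Q) := by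
  have : FiniteDimensional ℚ V := Module.finite_of_finrank_pos (by omega)
  have hp0 : (p : ℚ_[p]) ≠ 0 := by exact_mod_cast (Fact.out : p.Prime).ne_zero
  have hNp := localization_eq_triple x p
  have hMp := localization_sublattice_of_dvd x p hn hp
  have hN' := fun t (ht : t ∈ localization p N) => norm_localForm_le_one hN p ht
  have hM' := fun t (ht : t ∈ localization p (sublattice x n)) => norm_localForm_lt_one hM p hp ht
  have hprim' := exists_norm_localForm_eq_one hprim p hp
  rw [hNp] at hN' hprim'
  rw [hMp] at hM'
  rcases sublattice_dichotomy (localForm p Q) hN' hM' hprim' with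
    ⟨hcan, hrad⟩ | ⟨e, f, g, h, hef, hg, hNe, hMe⟩
  · have hnot : ¬ HalfModularRankTwo Q N p := by
      rintro ⟨_, J, hJ, hr⟩
      rw [hNp] at hJ
      exact finrank_ne_two_of_radical _ hrad hJ hr
    have hLM : localization p (sublattice x k) = localization p (sublattice x n) := by
      rw [localization_sublattice_of_dvd x p hk (hpk.2 (Or.inl hnot)), hMp]
    refine ⟨ν, hν, ?_, by rw [inv_mul_cancel]; exact one_mem _⟩
    rw [hLM]
    refine hstab.elim (fun hs => ?_) id
    have hmem : ∀ t, t ∈ localization p (sublattice x n) ↔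
        t ∈ localization p N ∧ ‖localForm p Q t‖ < 1 := by
      intro t
      refine ⟨fun ht => ⟨localization_mono p (sublattice_le x n) ht, ?_⟩, fun ht => ?_⟩
      · exact hM' t (hMp ▸ ht)
      · rw [hMp]
        exact hcan t (hNp ▸ ht.1) ht.2
    ext t
    have hν' : ν⁻¹ ∈ orthogonalGroup (localForm p Q) := inv_mem hν
    rw [mem_act, hmem, hmem, ← mem_act, hs, hν' t]
  · -- the Gram matrix of `e, f, g` gives `4 dN = -Q(g)` up to the square of a unit
    have hdisc : ‖((4 * disc Q N : ℚ) : ℚ_[p])‖ = ‖localForm p Q g‖ := by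
      have hd := disc_eq Q N x
      rw [← gram] at hd
      have hspan : Submodule.span ℤ_[p] (Set.range fun i => (1 : ℚ_[p]) ⊗ₜ[ℚ] (x i : V)) =
          Submodule.span ℤ_[p] (Set.range ![e, f, g]) := by
        rw [← localization_eq_span, hNp, hNe, triple, Matrix.range_cons, Matrix.range_cons,
          Matrix.range_cons, Matrix.range_empty, Set.union_empty]
        rfl
      have h4 := four_mul_gram (localForm p Q) two_ne_zero ![e, f, g]
      simp only [Matrix.cons_val_zero, Matrix.cons_val_one, Matrix.cons_val, h.fst_isotropic,
        h.snd_isotropic, h.fst_trd, h.snd_trd, hef] at h4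
      rw [hd, Rat.cast_mul, ← gram_localForm, norm_mul, norm_gram_eq _ hspan,
        show ((4 : ℚ) : ℚ_[p]) = 4 by norm_cast, ← norm_mul, h4, ← norm_neg]
      congr 1
      ring
    have hd0 : (4 * disc Q N : ℚ) ≠ 0 := mul_ne_zero four_ne_zero (disc_pos hQ h3 N hN).ne'
    have hg0 : localForm p Q g ≠ 0 := by
      rw [← norm_ne_zero_iff, ← hdisc, norm_ne_zero_iff, Rat.cast_ne_zero]
      exact hd0
    have hval := padicValRat_eq_valuation hd0 hdisc
    have hhm : HalfModularRankTwo Q N p := by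
      obtain ⟨J, hJ, hr⟩ := exists_jordanDecomposition (localForm p Q) h hef hg hg0
      exact ⟨inferInstance, J, by rwa [hNp, hNe], hr⟩
    rw [hval] at hpk
    obtain ⟨l, hl⟩ := exists_isSymmetryProd_localForm p hQ hν
    by_cases hpk' : p ∣ k
    · have heven := (hpk.1 hpk').resolve_left (not_not_intro hhm)
      have hh : IsHyperbolicTriple (localForm p Q) e ((p : ℚ_[p]) • f) g :=
        ⟨h.fst_isotropic, by rw [QuadraticMap.map_smul, h.snd_isotropic, smul_zero], h.fst_trd,
          by rw [QuadraticMap.polar_smul_left, h.snd_trd, smul_zero]⟩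
      have hpol : QuadraticMap.polar (localForm p Q) e ((p : ℚ_[p]) • f) = p := by
        rw [QuadraticMap.polar_smul_right, hef, smul_eq_mul, mul_one]
      rw [localization_sublattice_of_dvd x p hk hpk', hMe]
      refine exists_stabilizer_mul_spinorKernel _ hh (by rwa [hpol]) hg0 ?_ hl
      rw [hpol, Padic.valuation_p]
      exact odd_one.add_even heven
    · have hodd : ¬ Even (localForm p Q g).valuation := fun he => hpk' (hpk.2 (Or.inr he))
      rw [localization_sublattice_of_not_dvd x p hpk', hNp, hNe]
      refine exists_stabilizer_mul_spinorKernel _ h (by rw [hef]; exact one_ne_zero) hg0 ?_ hl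
      rw [hef, Padic.valuation_one, zero_add]
      exact Int.not_even_iff_odd.1 hodd

theorem adelicStabilizer_le_spinorStabilizer (L : Submodule ℤ V) :
    adelicStabilizer Q N L ≤ spinorStabilizer Q N L := le_sup_right

/-- The stabilizers satisfy `H_L = H_N H_M` if locally `L` is `N` or `M` and if the local
stabilizers of `N` and `M` are contained in that of `L`, up to the spinor kernel. -/
theorem spinorStabilizer_eq_sup [N.IsLattice ℚ] {L M : Submodule ℤ V} [L.IsLattice ℚ]
    [M.IsLattice ℚ] (hL : ∀ p : PrimeIndex, localization p L = localization p N ∨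
      localization p L = localization p M)
    (hfac : ∀ (p : PrimeIndex) (ν : (ℚ_[p] ⊗[ℚ] V) ≃ₗ[ℚ_[p]] (ℚ_[p] ⊗[ℚ] V)),
      ν ∈ orthogonalGroup (localForm p Q) →
      (act ν (localization p N) = localization p N ∨
        act ν (localization p M) = localization p M) →
      ∃ κ ∈ orthogonalGroup (localForm p Q), act κ (localization p L) = localization p L ∧
        κ⁻¹ * ν ∈ spinorKernel (localForm p Q)) :
    spinorStabilizer Q N L = spinorStabilizer Q N N ⊔ spinorStabilizer Q N M := by
  have key : ∀ ν : adelicGroup Q N, (∀ p : PrimeIndex,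
      act (ν.1 p) (localization p N) = localization p N ∨
        act (ν.1 p) (localization p M) = localization p M) → ν ∈ spinorStabilizer Q N L := by
    intro ν hν
    choose κ hκ hκL hκν using fun p => hfac p (ν.1 p) (ν.2.1 p) (hν p)
    let κ' : adelicGroup Q N := ⟨κ, mem_adelicGroup_of_stabilizes Q N L hκ hκL⟩
    have h1 : κ' ∈ spinorStabilizer Q N L := adelicStabilizer_le_spinorStabilizer L hκL
    have h2 : κ'⁻¹ * ν ∈ spinorStabilizer Q N L := adelicKernel_le_spinorStabilizer L hκν
    have := mul_mem h1 h2
    rwa [mul_inv_cancel_left] at this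
  have hrat : ∀ K : Submodule ℤ V,
      rationalIsometries Q N ⊔ adelicKernel Q N ≤ spinorStabilizer Q N K := fun K => le_sup_left
  refine le_antisymm (sup_le ((hrat N).trans le_sup_left) fun ν hν => ?_)
    (sup_le (sup_le (hrat L) fun ν hν => key ν fun p => Or.inl (hν p))
      (sup_le (hrat L) fun ν hν => key ν fun p => Or.inr (hν p)))
  -- split `ν` into its components at the primes with `L_p = N_p` and at the other primes
  classical
  let ν₁ : ∀ p : PrimeIndex, (ℚ_[p] ⊗[ℚ] V) ≃ₗ[ℚ_[p]] (ℚ_[p] ⊗[ℚ] V) := fun p =>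
    if localization p L = localization p N then ν.1 p else 1
  have h1O : ∀ p : PrimeIndex, ν₁ p ∈ orthogonalGroup (localForm p Q) := by
    intro p
    simp only [ν₁]
    split_ifs
    exacts [ν.2.1 p, one_mem _]
  have h1N : ∀ p : PrimeIndex, act (ν₁ p) (localization p N) = localization p N := by
    intro p
    simp only [ν₁]
    split_ifs with h
    · rw [← h]
      exact hν p
    · exact act_one
  let ν₁' : adelicGroup Q N := ⟨ν₁, mem_adelicGroup_of_stabilizes Q N N h1O h1N⟩
  have h2 : ν₁'⁻¹ * ν ∈ adelicStabilizer Q N M := by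
    intro p
    change act ((ν₁ p)⁻¹ * ν.1 p) _ = _
    simp only [ν₁]
    split_ifs with h
    · rw [inv_mul_cancel, act_one]
    · rw [inv_one, one_mul, ← (hL p).resolve_left h]
      exact hν p
  have := mul_mem
    (Subgroup.mem_sup_left (T := spinorStabilizer Q N M)
      (adelicStabilizer_le_spinorStabilizer N (x := ν₁') h1N))
    (Subgroup.mem_sup_right (S := spinorStabilizer Q N N)
      (adelicStabilizer_le_spinorStabilizer M h2))
  rwa [mul_inv_cancel_left] at this

end Comparison

/-! ### Pairs of a lattice and a sublattice of index `n` -/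

section Pairs

variable {V : Type*} [AddCommGroup V] [Module ℚ V] {Q : QuadraticForm ℚ V} {N : Submodule ℤ V}

theorem self_mem_spinorGenus [FiniteDimensional ℚ V] (hQ : Q.PosDef) (L : Submodule ℤ V)
    [L.IsLattice ℚ] : L ∈ spinorGenus Q L := by
  have h : L = adelicImage L (1 : adelicGroup Q L) L := eq_adelicImage fun p => act_one.symm
  have h1 := (adelicImage_mem_spinorGenus_iff hQ (L := L) (1 : adelicGroup Q L) 1).2
    (by rw [inv_one, one_mul]; exact one_mem _)
  rwa [← h] at h1

theorem spinorGenus_eq_of_mem [FiniteDimensional ℚ V] (hQ : Q.PosDef) {K L : Submodule ℤ V}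
    [L.IsLattice ℚ] (hK : K ∈ spinorGenus Q L) : spinorGenus Q K = spinorGenus Q L := by
  have h : L = adelicImage L (1 : adelicGroup Q L) L := eq_adelicImage fun p => act_one.symm
  have hg : L ∈ genus Q L := (mem_genus_iff_exists_adelicImage L).2 ⟨1, h⟩
  obtain ⟨τ, rfl⟩ := (mem_genus_iff_exists_adelicImage L).1 (spinorGenus_subset_genus hg hK)
  have h1 : adelicImage L τ L ∈ spinorGenus Q (adelicImage L (1 : adelicGroup Q L) L) := by
    rwa [← h]
  have h2 := (spinorGenus_adelicImage_eq_iff hQ 1 τ).2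
    ((adelicImage_mem_spinorGenus_iff hQ 1 τ).1 h1)
  rw [← h2, ← h]

variable [N.IsLattice ℚ] {M : Submodule ℤ V} [M.IsLattice ℚ]

theorem adelicImage_mono (τ : adelicGroup Q N) (h : M ≤ N) :
    adelicImage N τ M ≤ adelicImage N τ N := by
  refine le_of_forall_localization_le fun p => ?_
  rw [localization_adelicImage, localization_adelicImage]
  exact act_mono (localization_mono p h)

theorem relIndex_adelicImage (hQ : Q.PosDef) (h3 : Module.finrank ℚ V = 3)
    (hN : IsIntegral Q N) (h : M ≤ N) (τ : adelicGroup Q N) :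
    (adelicImage N τ M).toAddSubgroup.relIndex (adelicImage N τ N).toAddSubgroup =
      M.toAddSubgroup.relIndex N.toAddSubgroup := by
  have h1 := disc_eq_relIndex_sq_mul h3 Q (adelicImage_mono τ h)
  rw [disc_eq_of_mem_genus hQ h3 (fun z hz => hN z (h hz)) (adelicImage_mem_genus N τ M),
    disc_eq_of_mem_genus hQ h3 hN (adelicImage_mem_genus N τ N), disc_eq_relIndex_sq_mul h3 Q h]
    at h1
  have h2 := mul_right_cancel₀ (disc_pos hQ h3 N hN).ne' h1
  have h4 := (sq_eq_sq₀ (Nat.cast_nonneg _) (Nat.cast_nonneg _)).1 h2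
  exact_mod_cast h4.symm

/-- The spinor genera of `τN` and `υM` contain lattices `N' ⊇ M'` with `[N' : M'] = n` if and only
if the cosets `τ H_N` and `υ H_M` meet, where `H_N, H_M` are the stabilizers of the spinor genera.
Only if: for `N' = τ'N` and `M' = υ'M`, the sublattice `τ'⁻¹M'` of `N` is the image of `M` under
some element `μ` of the stabilizer of `N`, and then `τ'μ` lies in both cosets. -/
theorem exists_pair_iff (hQ : Q.PosDef) (h3 : Module.finrank ℚ V = 3) {n : ℕ}
    (hn : Squarefree n) (hN : IsIntegral Q N) (hMN : M ≤ N)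
    (hidx : M.toAddSubgroup.relIndex N.toAddSubgroup = n)
    (hM : ∀ z ∈ M, ∃ k : ℤ, Q z = n * k) (hprim : NormPrimeTo Q N n) (τ υ : adelicGroup Q N) :
    (∃ N' ∈ spinorGenus Q (adelicImage N τ N), ∃ M' ∈ spinorGenus Q (adelicImage N υ M),
      M' ≤ N' ∧ M'.toAddSubgroup.relIndex N'.toAddSubgroup = n) ↔
      τ⁻¹ * υ ∈ spinorStabilizer Q N N ⊔ spinorStabilizer Q N M := by
  have : FiniteDimensional ℚ V := Module.finite_of_finrank_pos (by omega)
  have hnN : (spinorStabilizer Q N N).Normal :=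
    normal_of_adelicKernel_le hQ (adelicKernel_le_spinorStabilizer N)
  constructor
  · rintro ⟨N', hN', M', hM', hle, hidx'⟩
    obtain ⟨τ', rfl⟩ := (mem_genus_iff_exists_adelicImage N).1
      (spinorGenus_subset_genus (adelicImage_mem_genus N τ N) hN')
    obtain ⟨υ', hυ'⟩ := (mem_genus_iff_exists_adelicImage N).1
      (spinorGenus_subset_genus (adelicImage_mem_genus N υ M) hM')
    have : M'.IsLattice ℚ := hM'.1
    rw [adelicImage_mem_spinorGenus_iff hQ] at hN'
    rw [hυ', adelicImage_mem_spinorGenus_iff hQ] at hM'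
    obtain ⟨x, hx⟩ := exists_basis_eq_sublattice h3 hMN hn hidx
    obtain ⟨y, hy⟩ := exists_basis_eq_sublattice h3 hle hn hidx'
    have hloc : ∀ p : PrimeIndex, ∃ μ ∈ orthogonalGroup (localForm p Q),
        act μ (localization p N) = localization p N ∧
          act (τ'.1 p * μ) (localization p M) = localization p M' := by
      intro p
      by_cases hp : (p : ℕ) ∣ n
      · rw [hx, hy, localization_sublattice_of_dvd x p hn hp,
          localization_sublattice_of_dvd y p hn hp, localization_eq_triple x p]
        refine exists_stabilizer_mul_act_eq (localForm p Q) ?_ ?_ ?_ ?_ (τ'.2.1 p) ?_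
        · rw [← localization_eq_triple x p]
          exact fun t ht => norm_localForm_le_one hN p ht
        · rw [← localization_sublattice_of_dvd x p hn hp, ← hx]
          exact fun t ht => norm_localForm_lt_one hM p hp ht
        · rw [← localization_eq_triple x p]
          exact exists_norm_localForm_eq_one hprim p hp
        · rw [← localization_sublattice_of_dvd y p hn hp, ← hy, hυ', localization_adelicImage]
          intro t ht
          rw [mem_act] at ht
          have hinv : (υ'.1 p)⁻¹ ∈ orthogonalGroup (localForm p Q) := inv_mem (υ'.2.1 p)
          rw [← hinv t]
          exact norm_localForm_lt_one hM p hp ht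
        · rw [← localization_eq_triple x p, ← localization_eq_triple y p, localization_adelicImage]
      · refine ⟨1, one_mem _, act_one, ?_⟩
        rw [mul_one, hx, hy, localization_sublattice_of_not_dvd x p hp,
          localization_sublattice_of_not_dvd y p hp, localization_adelicImage]
    choose μ hμ hμN hμM using hloc
    let μ' : adelicGroup Q N := ⟨μ, mem_adelicGroup_of_stabilizes Q N N hμ hμN⟩
    have h1 : τ⁻¹ * τ' * μ' ∈ spinorStabilizer Q N N :=
      mul_mem hN' (adelicStabilizer_le_spinorStabilizer N hμN)
    have h2 : υ'⁻¹ * (τ' * μ') ∈ spinorStabilizer Q N M := by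
      refine adelicStabilizer_le_spinorStabilizer M fun p => ?_
      change act ((υ'.1 p)⁻¹ * (τ'.1 p * μ p)) _ = _
      rw [act_mul, hμM, act_inv_eq_iff, hυ', localization_adelicImage]
    have h4 := mul_mem (Subgroup.mem_sup_left (T := spinorStabilizer Q N M) h1)
      (Subgroup.mem_sup_right (S := spinorStabilizer Q N N) (inv_mem (mul_mem hM' h2)))
    have h5 : τ⁻¹ * τ' * μ' * (υ⁻¹ * υ' * (υ'⁻¹ * (τ' * μ')))⁻¹ = τ⁻¹ * υ := by group
    rwa [h5] at h4
  · intro h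
    obtain ⟨a, ha, b, hb, hab⟩ := Subgroup.mem_sup_of_normal_left.1 h
    refine ⟨adelicImage N (τ * a) N, (adelicImage_mem_spinorGenus_iff hQ _ _).2 ?_,
      adelicImage N (τ * a) M, (adelicImage_mem_spinorGenus_iff hQ _ _).2 ?_,
      adelicImage_mono _ hMN, by rw [relIndex_adelicImage hQ h3 hN hMN, hidx]⟩
    · rwa [inv_mul_cancel_left]
    · have : υ⁻¹ * (τ * a) = b⁻¹ := by
        rw [eq_inv_iff_mul_eq_one, mul_assoc, mul_assoc, hab, mul_inv_cancel_left, inv_mul_cancel]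
      rw [this]
      exact inv_mem hb

end Pairs

/-! ### Bipartite graphs whose edges are the coincidences of two maps -/

/-- If two vertices `x ∈ X` and `y ∈ Y` are joined exactly if `f x = g y`, then the connected
components are the complete bipartite graphs on the fibres of `f` and `g`. -/
theorem exists_iso_completeBipartiteGraph {X Y Z : Type*} [Finite X] [Finite Y]
    {G : SimpleGraph (X ⊕ Y)} {f : X → Z} {g : Y → Z}
    (hX : ∀ x x', ¬ G.Adj (.inl x) (.inl x')) (hY : ∀ y y', ¬ G.Adj (.inr y) (.inr y'))
    (hXY : ∀ x y, G.Adj (.inl x) (.inr y) ↔ f x = g y) (hf : Function.Surjective f)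
    (hg : Function.Surjective g) {a b : ℕ} (ha : ∀ z, Nat.card {y // g y = z} = a)
    (hb : ∀ z, Nat.card {x // f x = z} = b) (C : G.ConnectedComponent) :
    ∃ e : C.toSimpleGraph ≃g completeBipartiteGraph (Fin a) (Fin b),
      ∀ v, (e v).isLeft = v.1.isRight := by
  let h : X ⊕ Y → Z := Sum.elim f g
  have hadj : ∀ u v, G.Adj u v → h u = h v := by
    rintro (x | y) (x' | y') huv
    · exact absurd huv (hX _ _)
    · exact (hXY _ _).1 huv
    · exact ((hXY _ _).1 huv.symm).symm
    · exact absurd huv (hY _ _)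
  have hreach : ∀ u v, G.Reachable u v ↔ h u = h v := by
    intro u v
    constructor
    · rintro ⟨w⟩
      induction w with
      | nil => rfl
      | cons huv _ ih => exact (hadj _ _ huv).trans ih
    · intro huv
      rcases u with x | y <;> rcases v with x' | y'
      · obtain ⟨y, hy⟩ := hg (f x)
        exact ((hXY x y).2 hy.symm).reachable.trans
          ((hXY x' y).2 (huv.symm.trans hy.symm)).symm.reachable
      · exact ((hXY _ _).2 huv).reachable
      · exact ((hXY _ _).2 huv.symm).symm.reachable
      · obtain ⟨x, hx⟩ := hf (g y)
        exact ((hXY x y).2 hx).symm.reachable.trans ((hXY x y').2 (hx.trans huv)).reachable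
  induction C using SimpleGraph.ConnectedComponent.ind with | _ u =>
  have hsupp : ∀ v, v ∈ (G.connectedComponentMk u).supp ↔ h v = h u := by
    intro v
    rw [SimpleGraph.ConnectedComponent.mem_supp_iff, SimpleGraph.ConnectedComponent.eq, hreach]
  let eX : {x // f x = h u} ≃ Fin b := Finite.equivFinOfCardEq (hb _)
  let eY : {y // g y = h u} ≃ Fin a := Finite.equivFinOfCardEq (ha _)
  let E : (G.connectedComponentMk u).supp ≃ Fin a ⊕ Fin b :=
    ((Equiv.subtypeEquivRight hsupp).trans Equiv.subtypeSum).trans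
      ((Equiv.sumComm _ _).trans (Equiv.sumCongr eY eX))
  have hE1 : ∀ x hv, E ⟨.inl x, hv⟩ = .inr (eX ⟨x, (hsupp _).1 hv⟩) := fun _ _ => rfl
  have hE2 : ∀ y hv, E ⟨.inr y, hv⟩ = .inl (eY ⟨y, (hsupp _).1 hv⟩) := fun _ _ => rfl
  refine ⟨⟨E, ?_⟩, ?_⟩
  · rintro ⟨x | y, hv⟩ ⟨x' | y', hw⟩
    · rw [hE1, hE1]
      exact iff_of_false (by simp) (hX x x')
    · rw [hE1, hE2]
      refine iff_of_true (by simp) ((hXY x y').2 ?_)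
      exact ((hsupp _).1 hv).trans ((hsupp _).1 hw).symm
    · rw [hE1, hE2]
      refine iff_of_true (by simp) (SimpleGraph.Adj.symm ((hXY x' y).2 ?_))
      exact ((hsupp _).1 hw).trans ((hsupp _).1 hv).symm
    · rw [hE2, hE2]
      exact iff_of_false (by simp) (hY y y')
  · rintro ⟨x | y, hv⟩ <;> rfl

theorem card_fiber_quotientMapOfLE {G X : Type*} [Group G] {H K : Subgroup G} (h : H ≤ K)
    (e : X ≃ G ⧸ H) (z : G ⧸ K) :
    Nat.card {x // Subgroup.quotientMapOfLE h (e x) = z} = H.relIndex K := by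
  have h1 : ∀ q : G ⧸ H, (Subgroup.quotientEquivProdOfLE h q).1 = Subgroup.quotientMapOfLE h q := by
    intro q
    induction q using QuotientGroup.induction_on with | _ q => rfl
  rw [Subgroup.relIndex, Subgroup.index]
  refine Nat.card_congr ?_
  refine ((e.trans (Subgroup.quotientEquivProdOfLE h)).subtypeEquiv
    (q := fun w => w.1 = z) fun x => ?_).trans ?_
  · rw [Equiv.trans_apply, h1]
  · exact ⟨fun w => w.1.2, fun w => ⟨(z, w), rfl⟩,
      fun w => Subtype.ext (Prod.ext w.2.symm rfl), fun _ => rfl⟩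

/-! ### The integers `n₁` and `n₂(e)` -/

section Arithmetic

theorem prod_primeFactors_filter_dvd {m : ℕ} (hm : Squarefree m) (P : ℕ → Prop)
    [DecidablePred P] : ∏ p ∈ m.primeFactors with P p, p ∣ m := by
  conv_rhs => rw [← Nat.prod_primeFactors_of_squarefree hm]
  exact Finset.prod_dvd_prod_of_subset _ _ _ (Finset.filter_subset _ _)

theorem dvd_prod_primeFactors_filter {m : ℕ} (hm : m ≠ 0) (P : ℕ → Prop) [DecidablePred P] {p : ℕ}
    (hp : p.Prime) : p ∣ ∏ q ∈ m.primeFactors with P q, q ↔ p ∣ m ∧ P p := by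
  rw [hp.prime.dvd_finsetProd_iff]
  constructor
  · rintro ⟨q, hq, hpq⟩
    rw [Finset.mem_filter, Nat.mem_primeFactors] at hq
    rw [(Nat.prime_dvd_prime_iff_eq hp hq.1.1).1 hpq]
    exact ⟨hq.1.2.1, hq.2⟩
  · rintro ⟨h1, h2⟩
    exact ⟨p, Finset.mem_filter.2 ⟨Nat.mem_primeFactors.2 ⟨hp, h1, hm⟩, h2⟩, dvd_rfl⟩

variable {V : Type*} [AddCommGroup V] [Module ℚ V] (Q : QuadraticForm ℚ V) (N : Submodule ℤ V)
  {n : ℕ}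

theorem n₂_dvd (hn : Squarefree n) : n₂ n Q N ∣ n := by
  classical exact prod_primeFactors_filter_dvd hn _

theorem n₁_mul_n₂e_dvd (hn : Squarefree n) : n₁ n Q N * n₂e n Q N ∣ n := by
  conv_rhs => rw [← Nat.div_mul_cancel (n₂_dvd Q N hn)]
  exact mul_dvd_mul_left _ (prod_primeFactors_filter_dvd (hn.squarefree_of_dvd (n₂_dvd Q N hn)) _)

theorem dvd_n₁_mul_n₂e (hn : Squarefree n) {p : ℕ} (hp : p.Prime) (hpn : p ∣ n) :
    p ∣ n₁ n Q N * n₂e n Q N ↔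
      (¬ HalfModularRankTwo Q N p ∨ Even (padicValRat p (4 * disc Q N))) := by
  classical
  have h2 : p ∣ n₂ n Q N ↔ HalfModularRankTwo Q N p :=
    (dvd_prod_primeFactors_filter hn.ne_zero _ hp).trans (and_iff_right hpn)
  have hmul : n₁ n Q N * n₂ n Q N = n := Nat.div_mul_cancel (n₂_dvd Q N hn)
  have hco : Nat.Coprime (n₁ n Q N) (n₂ n Q N) := by
    rw [← hmul] at hn
    exact Nat.coprime_of_squarefree_mul hn
  have h1 : p ∣ n₁ n Q N ↔ ¬ p ∣ n₂ n Q N := by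
    refine ⟨fun h h' => Nat.not_coprime_of_dvd_of_dvd hp.one_lt h h' hco, fun h => ?_⟩
    rw [← hmul] at hpn
    exact (hp.dvd_mul.1 hpn).resolve_right h
  have he : p ∣ n₂e n Q N ↔ p ∣ n₂ n Q N ∧ Even (padicValRat p (4 * disc Q N)) :=
    dvd_prod_primeFactors_filter (hn.squarefree_of_dvd (n₂_dvd Q N hn)).ne_zero _ hp
  rw [hp.dvd_mul, h1, he, h2]
  tauto

end Arithmetic

/-! ### Representations and similitudes -/

section Representation

variable {V W : Type*} [AddCommGroup V] [Module ℚ V] [AddCommGroup W] [Module ℚ W]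
  {QN : QuadraticForm ℚ V} {QM : QuadraticForm ℚ W}

/-- A similitude between spaces of the same dimension is bijective. -/
theorem exists_equiv_of_similitude (hV : Module.finrank ℚ V = 3) (hW : Module.finrank ℚ W = 3)
    (hQM : QM.PosDef) {c : ℚ} (hc : c ≠ 0) {φ : W →ₗ[ℚ] V} (hφ : ∀ x, QN (φ x) = c * QM x) :
    ∃ ψ : W ≃ₗ[ℚ] V, ψ.toLinearMap = φ := by
  have : FiniteDimensional ℚ V := Module.finite_of_finrank_pos (by omega)
  have : FiniteDimensional ℚ W := Module.finite_of_finrank_pos (by omega)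
  have hinj : Function.Injective φ := by
    rw [← LinearMap.ker_eq_bot, LinearMap.ker_eq_bot']
    intro x hx
    by_contra h0
    have := hφ x
    rw [hx, QuadraticMap.map_zero] at this
    exact mul_ne_zero hc (hQM x h0).ne' this.symm
  exact ⟨φ.linearEquivOfInjective hinj (hW.trans hV.symm), LinearMap.ext fun _ => rfl⟩

/-- Two representations of scaled lattices differ by an isometry of `V`, so the edges of the graph
of spinor genera can be tested with the inclusions into `V` provided by one fixed similitude. -/
theorem exists_isRepresentablePair_iff (hV : Module.finrank ℚ V = 3) (hW : Module.finrank ℚ W = 3)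
    (hQN : QN.PosDef) (hQM : QM.PosDef) {n : ℕ} (hn : n ≠ 0) (ψ : W ≃ₗ[ℚ] V)
    (hψ : ∀ x, QN (ψ x) = n * QM x) (S : Set (Submodule ℤ V)) (M : Submodule ℤ W)
    [M.IsLattice ℚ] :
    (∃ N' ∈ S, ∃ M' ∈ spinorGenus QM M, IsRepresentablePair n QN QM N' M') ↔
      ∃ N' ∈ S, ∃ M' ∈ spinorGenus QN (mapLattice ψ M),
        M' ≤ N' ∧ M'.toAddSubgroup.relIndex N'.toAddSubgroup = n := by
  have : FiniteDimensional ℚ V := Module.finite_of_finrank_pos (by omega)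
  have hn0 : (n : ℚ) ≠ 0 := Nat.cast_ne_zero.2 hn
  constructor
  · rintro ⟨N', hN', M', hM', φ, hφ, hle, hidx⟩
    have : M'.IsLattice ℚ := hM'.1
    obtain ⟨χ, rfl⟩ := exists_equiv_of_similitude hV hW hQM hn0 hφ
    let σ : V ≃ₗ[ℚ] V := ψ.symm.trans χ
    have hσ : σ ∈ orthogonalGroup QN := by
      intro v
      change QN (χ (ψ.symm v)) = QN v
      have h1 : QN (χ (ψ.symm v)) = n * QM (ψ.symm v) := hφ _
      rw [h1, ← hψ, LinearEquiv.apply_symm_apply]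
    have h1 : mapLattice χ M' = mapLattice σ (mapLattice ψ M') := by
      ext v
      rw [mem_mapLattice, mem_mapLattice, mem_mapLattice]
      change _ ↔ ψ.symm (ψ (χ.symm v)) ∈ M'
      rw [LinearEquiv.symm_apply_apply]
    refine ⟨N', hN', mapLattice χ M', ?_, hle, hidx⟩
    have h2 := spinorGenus_eq_of_mem hQN ((mapLattice_mem_spinorGenus_iff ψ hψ hn0).2 hM')
    rw [← h2, ← spinorGenus_mapLattice hQN hσ, ← h1]
    exact self_mem_spinorGenus hQN _
  · rintro ⟨N', hN', M', hM', hle, hidx⟩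
    rw [← image_mapLattice_spinorGenus ψ hψ hn0] at hM'
    obtain ⟨M', hM', rfl⟩ := hM'
    exact ⟨N', hN', M', hM', ψ.toLinearMap, hψ, hle, hidx⟩

end Representation

/-! ### The components of the graph of spinor genera -/

section Main

variable {V W : Type*} [AddCommGroup V] [Module ℚ V] [AddCommGroup W] [Module ℚ W]

/-- For `L = L_{N,M}`, the stabilizers of the spinor genera satisfy `H_L = H_N H_M`. -/
theorem spinorStabilizer_intermediate (hV : Module.finrank ℚ V = 3) {Q : QuadraticForm ℚ V}
    (hQ : Q.PosDef) {N : Submodule ℤ V} [N.IsLattice ℚ] (hN : IsIntegral Q N) {n : ℕ}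
    (hn : Squarefree n) (hprim : NormPrimeTo Q N n) (x : Module.Basis (Fin 3) ℤ N)
    [(sublattice x n).IsLattice ℚ] [(sublattice x (n₁ n Q N * n₂e n Q N)).IsLattice ℚ]
    (hM : ∀ z ∈ sublattice x n, ∃ k : ℤ, Q z = n * k) :
    spinorStabilizer Q N (sublattice x (n₁ n Q N * n₂e n Q N)) =
      spinorStabilizer Q N N ⊔ spinorStabilizer Q N (sublattice x n) := by
  set k := n₁ n Q N * n₂e n Q N with hk
  have hkn : k ∣ n := n₁_mul_n₂e_dvd Q N hn
  have hksq : Squarefree k := hn.squarefree_of_dvd hkn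
  refine spinorStabilizer_eq_sup (fun p => ?_) fun p ν hν hstab => ?_
  · by_cases hp : (p : ℕ) ∣ k
    · right
      rw [localization_sublattice_of_dvd x p hksq hp,
        localization_sublattice_of_dvd x p hn (hp.trans hkn)]
    · exact Or.inl (localization_sublattice_of_not_dvd x p hp)
  · by_cases hp : (p : ℕ) ∣ n
    · exact exists_stabilizer_mul_spinorKernel_of_dvd hQ hV x hn hksq hN hM hprim p hp
        (dvd_n₁_mul_n₂e Q N hn p.2 hp) hν hstab
    · refine ⟨ν, hν, ?_, by rw [inv_mul_cancel]; exact one_mem _⟩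
      rw [localization_sublattice_of_not_dvd x p hp, or_self] at hstab
      rwa [localization_sublattice_of_not_dvd x p fun h => hp (h.trans hkn)]

end Main

end SpinorGenera

end

theorem theorem5p4
    {V W : Type*} [AddCommGroup V] [Module ℚ V] [AddCommGroup W] [Module ℚ W]
    (hV : Module.finrank ℚ V = 3) (hW : Module.finrank ℚ W = 3)
    (QN : QuadraticForm ℚ V) (QM : QuadraticForm ℚ W)
    (hQN : QN.PosDef) (hQM : QM.PosDef)
    (N : Submodule ℤ V) (M : Submodule ℤ W)
    (hNlat : N.IsLattice ℚ) (hMlat : M.IsLattice ℚ)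
    (hN : SpinorGenera.IsIntegral QN N) (hM : SpinorGenera.IsIntegral QM M)
    (n : ℕ) (hn : Squarefree n)
    (hprim : SpinorGenera.NormPrimeTo QN N n)
    (φ : W →ₗ[ℚ] V) (hφ : SpinorGenera.IsScaledRep n QN QM N M φ) :
    -- a basis of `N` as in the construction of `L_{N,M}` exists
    (∃ x : Module.Basis (Fin 3) ℤ N,
      M.map (φ.restrictScalars ℤ) = SpinorGenera.sublattice x n) ∧
    -- for every such basis, the claim holds
    ∀ x : Module.Basis (Fin 3) ℤ N,
      M.map (φ.restrictScalars ℤ) = SpinorGenera.sublattice x n →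
      0 < SpinorGenera.gInter n QN x ∧
      SpinorGenera.gInter n QN x ∣ SpinorGenera.numSpinorGenera QM M ∧
      SpinorGenera.gInter n QN x ∣ SpinorGenera.numSpinorGenera QN N ∧
      0 < SpinorGenera.numSpinorGenera QM M ∧ 0 < SpinorGenera.numSpinorGenera QN N ∧
      ∀ C : (SpinorGenera.spinorGraph n QN QM N M).ConnectedComponent,
        ∃ e : C.toSimpleGraph ≃g completeBipartiteGraph
            (Fin (SpinorGenera.numSpinorGenera QM M / SpinorGenera.gInter n QN x))
            (Fin (SpinorGenera.numSpinorGenera QN N / SpinorGenera.gInter n QN x)),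
          -- the `α` vertices lie in `gen(M)_S` and the `β` vertices in `gen(N)_S`
          ∀ v, (e v).isLeft = v.1.isRight := by
  open SpinorGenera in
  have : FiniteDimensional ℚ V := Module.finite_of_finrank_pos (by omega)
  obtain ⟨hsim, hle, hidx⟩ := hφ
  have hn0 : (n : ℚ) ≠ 0 := Nat.cast_ne_zero.2 hn.ne_zero
  obtain ⟨ψ, rfl⟩ := exists_equiv_of_similitude hV hW hQM hn0 hsim
  change mapLattice ψ M ≤ N at hle
  change (mapLattice ψ M).toAddSubgroup.relIndex N.toAddSubgroup = n at hidx
  refine ⟨exists_basis_eq_sublattice (M := mapLattice ψ M) hV hle hn hidx, fun x hx => ?_⟩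
  change mapLattice ψ M = sublattice x n at hx
  have hψM : ∀ z ∈ mapLattice ψ M, ∃ k : ℤ, QN z = n * k := by
    rintro _ ⟨z, hz, rfl⟩
    obtain ⟨k, hk⟩ := hM z hz
    exact ⟨k, (hsim z).trans (by rw [hk])⟩
  have hk : n₁ n QN N * n₂e n QN N ≠ 0 := ne_zero_of_dvd_ne_zero hn.ne_zero (n₁_mul_n₂e_dvd QN N hn)
  have hlatL := isLattice_sublattice x hk
  have hlatM := isLattice_sublattice x hn.ne_zero
  -- the numbers of spinor genera are the indices of the stabilizers
  set H := spinorStabilizer QN N N with hH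
  set H' := spinorStabilizer QN N (mapLattice ψ M) with hH'
  have hgL : gInter n QN x = (H ⊔ H').index := by
    have h1 : (1 / ((n₁ n QN N * n₂e n QN N : ℕ) : ℚ)) ≠ 0 :=
      one_div_ne_zero (Nat.cast_ne_zero.2 hk)
    rw [gInter, numSpinorGenera_smul h1, numSpinorGenera_eq_index hQN (N := N),
      spinorStabilizer_intermediate hV hQN hN hn hprim x (hx ▸ hψM), hH, hH']
    simp only [hx]
  have hgN : numSpinorGenera QN N = H.index := numSpinorGenera_eq_index hQN N
  have hgM : numSpinorGenera QM M = H'.index := by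
    rw [← numSpinorGenera_mapLattice ψ hsim hn0, numSpinorGenera_eq_index hQN (N := N)]
  let eN : spinorGenera QN N ≃ adelicGroup QN N ⧸ H := (spinorGeneraEquiv hQN N N).symm
  let eM : spinorGenera QM M ≃ adelicGroup QN N ⧸ H' :=
    (spinorGeneraMapEquiv ψ hsim hn0 M).trans (spinorGeneraEquiv hQN N (mapLattice ψ M)).symm
  have hfN : Finite (spinorGenera QN N) := finite_spinorGenera hQN hV N hN
  have hfM : Finite (spinorGenera QM M) := finite_spinorGenera hQM hW M hM
  have hposN : H.index ≠ 0 := by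
    have := Finite.of_equiv _ eN
    exact Subgroup.index_ne_zero_of_finite
  have hposM : H'.index ≠ 0 := by
    have := Finite.of_equiv _ eM
    exact Subgroup.index_ne_zero_of_finite
  have hmulN := Subgroup.relIndex_mul_index (le_sup_left : H ≤ H ⊔ H')
  have hmulM := Subgroup.relIndex_mul_index (le_sup_right : H' ≤ H ⊔ H')
  have hposL : 0 < (H ⊔ H').index :=
    Nat.pos_of_ne_zero fun h0 => hposN (by rw [← hmulN, h0, mul_zero])
  rw [hgL, hgN, hgM]
  refine ⟨hposL, ⟨_, (mul_comm _ _).trans hmulM |>.symm⟩, ⟨_, (mul_comm _ _).trans hmulN |>.symm⟩,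
    Nat.pos_of_ne_zero hposM, Nat.pos_of_ne_zero hposN, ?_⟩
  rw [← hmulN, ← hmulM, Nat.mul_div_cancel _ hposL, Nat.mul_div_cancel _ hposL]
  refine exists_iso_completeBipartiteGraph
    (f := fun S => Subgroup.quotientMapOfLE le_sup_left (eN S))
    (g := fun T => Subgroup.quotientMapOfLE le_sup_right (eM T)) (fun _ _ h => h) (fun _ _ h => h)
    (fun S T => ?_) ?_ ?_ (card_fiber_quotientMapOfLE le_sup_right eM)
    (card_fiber_quotientMapOfLE le_sup_left eN)
  · obtain ⟨τ, hτ⟩ := QuotientGroup.mk_surjective (eN S)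
    obtain ⟨υ, hυ⟩ := QuotientGroup.mk_surjective (eM T)
    have hS : (S : Set (Submodule ℤ V)) = spinorGenus QN (adelicImage N τ N) := by
      rw [← spinorGeneraEquiv_mk hQN N τ, hτ]
      exact congrArg Subtype.val (Equiv.apply_symm_apply _ _).symm
    obtain ⟨_, K, hK, rfl⟩ := T
    have hT : spinorGenus QN (mapLattice ψ K) =
        spinorGenus QN (adelicImage N υ (mapLattice ψ M)) := by
      rw [← spinorGeneraEquiv_mk hQN (mapLattice ψ M) υ, hυ,
        ← image_mapLattice_spinorGenus ψ hsim hn0]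
      exact congrArg Subtype.val (Equiv.apply_symm_apply (spinorGeneraEquiv hQN N (mapLattice ψ M))
        (spinorGeneraMapEquiv ψ hsim hn0 M ⟨spinorGenus QM K, K, hK, rfl⟩)).symm
    have hKlat : K.IsLattice ℚ := hK.1
    rw [← hτ, ← hυ]
    change (∃ N' ∈ S.1, ∃ M' ∈ spinorGenus QM K, IsRepresentablePair n QN QM N' M') ↔
      (QuotientGroup.mk τ : adelicGroup QN N ⧸ H ⊔ H') = QuotientGroup.mk υ
    rw [exists_isRepresentablePair_iff hV hW hQN hQM hn.ne_zero ψ hsim, hS, hT,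
      exists_pair_iff hQN hV hn hN hle hidx hψM hprim, QuotientGroup.eq]
  · intro z
    obtain ⟨τ, rfl⟩ := QuotientGroup.mk_surjective z
    exact ⟨eN.symm (QuotientGroup.mk τ), by
      beta_reduce
      rw [Equiv.apply_symm_apply]
      rfl⟩
  · intro z
    obtain ⟨τ, rfl⟩ := QuotientGroup.mk_surjective z
    exact ⟨eM.symm (QuotientGroup.mk τ), by
      beta_reduce
      rw [Equiv.apply_symm_apply]
      rfl⟩
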